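/- **Conventions.** For $s\in\hat{\mathbb Q}=\mathbb Q\cup\{\infty\}$ let $(S^3,K(s))=(B^3,t(\infty))\cup(B^3,t(s))$ be the $2$-bridge link of slope $s$, the sum of the rational tangles of slopes $\infty$ and $s$, whose common boundary is the Conway sphere $(\mathbb R^2,\mathbb Z^2)/H$, where $H$ is generated by the $\pi$-rotations about the points of $\mathbb Z^2$. The link group is $G(K(s))=\pi_1(S^3-K(s))$. Let $\alpha_s$ be the simple loop on the $4$-punctured Conway sphere that is the image of a line of slope $s$ in $\mathbb R^2-\mathbb Z^2$; the loop $\alpha_r$ is a meridian of the lower tunnel of $K(r)$, i.e. of the core tunnel of $(B^3,t(r))$, and the complement of $K(r)$ and its lower tunnel has the fundamental group $\pi_1(B^3-t(\infty))$. For a rational number $r$ and an integer $n\ge 2$, the (even) Heckoid group $\mathrm{Hecke}(r;n)$ is the orbifold fundamental group of the orbifold with underlying space the complement (exterior) of $K(r)$ and singular set the lower tunnel with index $n$, that is, $\mathrm{Hecke}(r;n)=\pi_1(B^3-t(\infty))/\langle\langle\alpha_r^n\rangle\rangle$. If $n=m/2$ with $m\ge 3$ an odd integer, consider the $(\mathbb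 Z/2)^2$-symmetry of $K(r)$ induced by the translations of $\mathbb R^2$ by $\mathbb Z^2$, and let $\mathbf O(r;m)$ be the orbifold obtained from the quotient of the complement of $K(r)$ by this symmetry by giving the image of the lower tunnel the index $m$; its fundamental group is the orbifold fundamental group of $(B^3-t(\infty))/(\mathbb Z/2)^2$ divided by the normal closure of $\beta_r^m$, where $\beta_r$ is the image of a line of slope $r$ in the quotient, so that $\beta_r^2=\alpha_r$. The (odd) Heckoid group $\mathrm{Hecke}(r;n)$ is then the image of $\pi_1(B^3-t(\infty))$ in $\pi_1(\mathbf O(r;m))$, that is, the fundamental group of the corresponding double covering of $\mathbf O(r;m)$. The upper meridian pair $\{a,b\}$ of $\pi_1(B^3-t(\infty))$ consists of the two meridians of $t(\infty)$ at the endpoints of its core tunnel, joined by this tunnel; its images in $G(K(s))$ and in $\mathrm{Hecke}(r;n)$ are also called upper meridian pairs. They are considered up to the order of the pair, replacing either member by its inverse, and simultaneous conjugation. A homomorphism $G(K(s))\to\mathrm{Hecke}(r;n)$ is upper-meridian-pair-preserving if it sends the upper meridian pair to the upper meridian pair in this sense. For $r\in\mathbb Q$ and $n$ with $2n\in\mathbb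 Z$, let $\Gamma(r;n)$ be the group of automorphisms of the Farey tessellation generated by the reflections in the Farey edges with an endpoint $\infty$ and by the parabolic transformation centered at $r$ by $2n$ units (it fixes $r$ and moves each Farey edge with endpoint $r$ to the $2n$-th next one). It acts on $\hat{\mathbb Q}$. **Theorem.** Let $r$ be a rational number and let $n>1$ be an integer or a half-integer (half of an odd integer). For $s\in\hat{\mathbb Q}$, if $s$ or $s+1$ belongs to the $\Gamma(r;n)$-orbit of $\infty$ (where $\infty+1=\infty$), then there is an upper-meridian-pair-preserving epimorphism from $G(K(s))$ onto $\mathrm{Hecke}(r;n)$. -/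

import Mathlib

open scoped unitInterval

noncomputable section

namespace Heckoid

/-! ### Slopes and the Farey tessellation -/

/-- The primitive integral vector `(numerator, denominator)` of a slope; `∞ = 1 / 0`. -/
def fareyVec (s : OnePoint ℚ) : Fin 2 → ℚ :=
  OnePoint.elim s ![1, 0] (fun q : ℚ => ![(q.num : ℚ), (q.den : ℚ)])

/-- Two slopes are the ideal endpoints of an edge of the Farey tessellation. -/
def FareyEdge (u v : OnePoint ℚ) : Prop :=
  |fareyVec u 0 * fareyVec v 1 - fareyVec u 1 * fareyVec v 0| = 1

/-- The reflections of the hyperbolic plane in the Farey edges with an endpoint `r`. The reflection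
in the geodesic with endpoints `r`, `v` acts on the ideal points as the projective map which is the
identity on the line `r` and minus the identity on the line `v`. -/
def edgeReflections (r : OnePoint ℚ) : Set (GL (Fin 2) ℚ) :=
  {g | ∃ v, FareyEdge r v ∧ g.1.mulVec (fareyVec r) = fareyVec r ∧
    g.1.mulVec (fareyVec v) = -fareyVec v}

/-- The group generated by the reflections in the Farey edges with an endpoint `r`. -/
def reflectionGroup (r : OnePoint ℚ) : Subgroup (GL (Fin 2) ℚ) :=
  Subgroup.closure (edgeReflections r)

/-- The parabolic transformations centered at `r` by `m` units, in both directions: in the cyclic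
order of the Farey edges ending at `r`, an edge is moved to the `m`-th next one. -/
def parabolics (r : OnePoint ℚ) (m : ℕ) : Set (GL (Fin 2) ℚ) :=
  {g | ∃ v, FareyEdge r v ∧ g.1.mulVec (fareyVec r) = fareyVec r ∧
    g.1.mulVec (fareyVec v) = fareyVec v + (m : ℚ) • fareyVec r}

/-- The infinite cyclic group `C_r(m)`. -/
def parabolicGroup (r : OnePoint ℚ) (m : ℕ) : Subgroup (GL (Fin 2) ℚ) :=
  Subgroup.closure (parabolics r m)

/-- The group `Γ(r; m/2)`, generated by the reflections in the Farey edges ending at `∞` and by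
`C_r(m)`. -/
def slopeGroup (r : ℚ) (m : ℕ) : Subgroup (GL (Fin 2) ℚ) :=
  reflectionGroup OnePoint.infty ⊔ parabolicGroup (r : OnePoint ℚ) m

/-- `s` lies in the orbit of `∞` under `Γ(r; m/2)`. -/
def InOrbitOfInfty (r : ℚ) (m : ℕ) (s : OnePoint ℚ) : Prop :=
  s ∈ MulAction.orbit (slopeGroup r m) (OnePoint.infty : OnePoint ℚ)

/-- `s ↦ s + 1`, with `∞ + 1 = ∞`. -/
def slopeSucc (s : OnePoint ℚ) : OnePoint ℚ := OnePoint.map (fun q : ℚ => q + 1) s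

/-! ### 2-bridge links -/

/-- A direction vector, in the plane, of the lines of slope `s`. -/
def slopeDir (s : OnePoint ℚ) : ℝ × ℝ := ((fareyVec s 1 : ℚ), (fareyVec s 0 : ℚ))

/-- The integral lattice in the plane. -/
def lattice : Set (ℝ × ℝ) := {x | ∃ a b : ℤ, x = ((a : ℝ), (b : ℝ))}

/-- The identifications on `ℝ² × [0,1]` which produce the 3-sphere as the union of two rational
tangles. On every level one divides by the group generated by the `π`-rotations about the lattice
points, so that the intermediate levels are Conway spheres. On the level `1` every line of slope `∞`
is in addition collapsed to a point, which turns the part over `[1/2,1]` into the ball of the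
rational tangle of slope `∞`; on the level `0` every line of slope `s` is collapsed to a point,
which turns the part over `[0,1/2]` into the ball of the rational tangle of slope `s`. -/
inductive GlueRel (s : OnePoint ℚ) : (ℝ × ℝ) × I → (ℝ × ℝ) × I → Prop
  | rotate (x : ℝ × ℝ) (t : I) (a b : ℤ) :
      GlueRel s (x, t) ((2 * (a : ℝ) - x.1, 2 * (b : ℝ) - x.2), t)
  | upper (x : ℝ × ℝ) (c : ℝ) : GlueRel s (x, 1) (x + c • slopeDir OnePoint.infty, 1)
  | lower (x : ℝ × ℝ) (c : ℝ) : GlueRel s (x, 0) (x + c • slopeDir s, 0)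

/-- The 3-sphere, as the union of the balls of the rational tangles of slopes `∞` and `s`. -/
abbrev LinkSphere (s : OnePoint ℚ) : Type := Quot (GlueRel s)

/-- The 2-bridge link `K(s)`: the union of the strings of the two tangles, that is the image of
`ℤ² × [0,1]`. -/
def link (s : OnePoint ℚ) : Set (LinkSphere s) :=
  {z | ∃ x t, x ∈ lattice ∧ z = Quot.mk _ (x, t)}

/-- The lower tunnel of `K(s)`: the core tunnel of the rational tangle of slope `s`, an arc which
joins its two strings. -/
def lowerTunnel (s : OnePoint ℚ) : Set (LinkSphere s) :=
  {z | ∃ x, z = Quot.mk _ (x, 0)}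

/-- The complement of `K(s)` in the 3-sphere. -/
abbrev LinkComplement (s : OnePoint ℚ) : Type := {z : LinkSphere s // z ∉ link s}

/-- The complement of `K(s)` and of its lower tunnel in the 3-sphere. -/
abbrev TunnelComplement (s : OnePoint ℚ) : Type :=
  {z : LinkSphere s // z ∉ link s ∧ z ∉ lowerTunnel s}

/-- The plane without the lattice points. -/
abbrev PuncturedPlane : Type := {x : ℝ × ℝ // x ∉ lattice}

def midLevel : I := ⟨1 / 2, by norm_num, by norm_num⟩

theorem neg_mem_lattice_iff (x : ℝ × ℝ) (a b : ℤ) :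
    (2 * (a : ℝ) - x.1, 2 * (b : ℝ) - x.2) ∈ lattice ↔ x ∈ lattice := by
  constructor
  · rintro ⟨c, d, h⟩
    rw [Prod.ext_iff] at h
    refine ⟨2 * a - c, 2 * b - d, Prod.ext ?_ ?_⟩ <;> push_cast <;> linarith [h.1, h.2]
  · rintro ⟨c, d, rfl⟩
    exact ⟨2 * a - c, 2 * b - d, by push_cast; rfl⟩

/-- The predicate "on the middle level and not over a lattice point". -/
def onBridge (s : OnePoint ℚ) : LinkSphere s → Prop :=
  Quot.lift (fun p => p.2 = midLevel ∧ p.1 ∉ lattice) (by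
    have h1 : (1 : I) ≠ midLevel := fun h => by
      have := congrArg Subtype.val h
      norm_num [midLevel] at this
    have h0 : (0 : I) ≠ midLevel := fun h => by
      have := congrArg Subtype.val h
      norm_num [midLevel] at this
    rintro _ _ (⟨x, t, a, b⟩ | ⟨x, c⟩ | ⟨x, c⟩)
    · simp [neg_mem_lattice_iff]
    · simp [h1]
    · simp [h0])

theorem bridge_mem (s : OnePoint ℚ) (x : PuncturedPlane) :
    (Quot.mk _ (x.1, midLevel) : LinkSphere s) ∉ link s ∧
      (Quot.mk _ (x.1, midLevel) : LinkSphere s) ∉ lowerTunnel s := by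
  have key : onBridge s (Quot.mk _ (x.1, midLevel)) := ⟨rfl, x.2⟩
  constructor
  · rintro ⟨y, t, hy, h⟩
    rw [h] at key
    exact key.2 hy
  · rintro ⟨y, h⟩
    rw [h] at key
    have := congrArg Subtype.val key.1
    norm_num [midLevel] at this

/-- The projection of the punctured plane onto the 4-punctured bridge sphere. -/
def bridge (s : OnePoint ℚ) : C(PuncturedPlane, TunnelComplement s) where
  toFun x := ⟨Quot.mk _ (x.1, midLevel), bridge_mem s x⟩
  continuous_toFun := by
    refine Continuous.subtype_mk (continuous_quot_mk.comp ?_) _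
    fun_prop

theorem bridge_rotate (s : OnePoint ℚ) (x y : PuncturedPlane) (a b : ℤ)
    (h : y.1 = (2 * (a : ℝ) - x.1.1, 2 * (b : ℝ) - x.1.2)) : bridge s y = bridge s x := by
  apply Subtype.ext
  change Quot.mk _ (y.1, midLevel) = Quot.mk _ (x.1, midLevel)
  rw [h]
  exact (Quot.sound (GlueRel.rotate x.1 midLevel a b)).symm

/-- Points of the punctured plane which differ by `2ℤ²` are identified. -/
theorem bridge_translate (s : OnePoint ℚ) (x y : PuncturedPlane) (a b : ℤ)
    (h : y.1 = x.1 + 2 • ((a : ℝ), (b : ℝ))) : bridge s y = bridge s x := by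
  have hx : (2 * ((0 : ℤ) : ℝ) - x.1.1, 2 * ((0 : ℤ) : ℝ) - x.1.2) ∉ lattice :=
    fun h => x.2 ((neg_mem_lattice_iff x.1 0 0).1 h)
  rw [← bridge_rotate s x ⟨_, hx⟩ 0 0 rfl]
  refine bridge_rotate s _ y a b ?_
  rw [h]
  ext <;> simp <;> ring

/-! ### The upper meridian pair -/

theorem circle_not_mem (e : ℤ) (f : ℝ) (hf : f ^ 2 = 1) (θ : ℝ) :
    ((e : ℝ) + f * (Real.cos θ / 2), Real.sin θ / 2) ∉ lattice := by
  rintro ⟨a, b, h⟩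
  rw [Prod.ext_iff] at h
  obtain ⟨h1, h2⟩ := h
  simp only at h1 h2
  have hc : Real.cos θ ^ 2 = (2 * ((a : ℝ) - e)) ^ 2 := by
    have : f * (Real.cos θ / 2) = a - e := by linarith
    calc Real.cos θ ^ 2 = 4 * (f * (Real.cos θ / 2)) ^ 2 := by rw [mul_pow, hf]; ring
      _ = _ := by rw [this]; ring
  have hs : Real.sin θ ^ 2 = (2 * (b : ℝ)) ^ 2 := by rw [← h2]; ring
  have key : (4 * ((a - e) ^ 2 + b ^ 2) : ℤ) = 1 := by
    have := Real.sin_sq_add_cos_sq θ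
    have h3 : (4 * (((a : ℝ) - e) ^ 2 + (b : ℝ) ^ 2)) = 1 := by rw [← this, hc, hs]; ring
    exact_mod_cast h3
  omega

/-- The half circle of radius `1/2` above the lattice point `(e,0)`, from `(e + f/2, 0)` to
`(e - f/2, 0)`, where `f = ±1`. -/
def halfCircle (e : ℤ) (f : ℝ) (hf : f ^ 2 = 1) :
    Path (⟨_, circle_not_mem e f hf 0⟩ : PuncturedPlane) ⟨_, circle_not_mem e f hf Real.pi⟩ where
  toFun t := ⟨_, circle_not_mem e f hf (Real.pi * (t : ℝ))⟩
  continuous_toFun := by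
    refine Continuous.subtype_mk ?_ _
    fun_prop
  source' := by simp
  target' := by simp

/-- The base point `(1/2, 0)` of the punctured plane. -/
def planeBase : PuncturedPlane := ⟨_, circle_not_mem 0 1 (by norm_num) 0⟩

/-- The base point, on the bridge sphere. -/
def base (s : OnePoint ℚ) : TunnelComplement s := bridge s planeBase

theorem base_eq_left (s : OnePoint ℚ) :
    base s = bridge s ⟨_, circle_not_mem 0 1 (by norm_num) Real.pi⟩ := by
  refine bridge_rotate s _ _ 0 0 ?_
  simp only [planeBase, Real.cos_pi, Real.sin_pi, Real.cos_zero, Real.sin_zero]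
  ext <;> norm_num

theorem base_eq_start (s : OnePoint ℚ) :
    base s = bridge s ⟨_, circle_not_mem 1 (-1) (by norm_num) 0⟩ := by
  refine congrArg (bridge s) (Subtype.ext ?_)
  simp only [planeBase, Real.cos_zero, Real.sin_zero]
  ext <;> norm_num

theorem base_eq_right (s : OnePoint ℚ) :
    base s = bridge s ⟨_, circle_not_mem 1 (-1) (by norm_num) Real.pi⟩ := by
  refine bridge_rotate s _ _ 1 0 ?_
  simp only [planeBase, Real.cos_pi, Real.sin_pi, Real.cos_zero, Real.sin_zero]
  ext <;> norm_num

/-- The meridian around the string through `(0,0)`, based at the base point. The two meridians are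
the ones at the endpoints of the core tunnel of the rational tangle of slope `∞`, which is the image
of the segment `[0,1] × {0}` on the level `1`, with the base point joined to the point of this tunnel
over it. -/
def meridianA (s : OnePoint ℚ) : FundamentalGroup (TunnelComplement s) (base s) :=
  FundamentalGroup.fromPath (Path.Homotopic.Quotient.mk
    (((halfCircle 0 1 (by norm_num)).map (bridge s).continuous).cast rfl (base_eq_left s)))

/-- The meridian around the string through `(1,0)`, based at the base point. -/
def meridianB (s : OnePoint ℚ) : FundamentalGroup (TunnelComplement s) (base s) :=
  FundamentalGroup.fromPath (Path.Homotopic.Quotient.mk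
    (((halfCircle 1 (-1) (by norm_num)).map (bridge s).continuous).cast
      (base_eq_start s) (base_eq_right s)))

/-- Two pairs of elements of a group agree up to the order of the pair, replacing either of its
members by the inverse, and simultaneous conjugation. -/
def SamePair {G : Type*} [Group G] (a b c d : G) : Prop :=
  ∃ g : G, ∃ a' ∈ ({a, a⁻¹} : Set G), ∃ b' ∈ ({b, b⁻¹} : Set G),
    (c = g * a' * g⁻¹ ∧ d = g * b' * g⁻¹) ∨ (c = g * b' * g⁻¹ ∧ d = g * a' * g⁻¹)

/-! ### The link group -/

/-- The inclusion of the complement of link and tunnel into the link complement. -/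
def fillTunnel (s : OnePoint ℚ) : C(TunnelComplement s, LinkComplement s) where
  toFun z := ⟨z.1, z.2.1⟩
  continuous_toFun := by fun_prop

/-- The link group `G(K(s))`. -/
abbrev LinkGroup (s : OnePoint ℚ) : Type :=
  FundamentalGroup (LinkComplement s) (fillTunnel s (base s))

/-- The homomorphism to the link group induced by the inclusion. -/
def toLinkGroup (s : OnePoint ℚ) :
    FundamentalGroup (TunnelComplement s) (base s) →* LinkGroup s :=
  FundamentalGroup.map (fillTunnel s) (base s)

/-! ### Simple loops on the bridge sphere and even Heckoid groups -/

/-- The path `τ ↦ y + τ v`, in the punctured plane, for a line missing the lattice. -/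
def linePath (y v : ℝ × ℝ) (h : ∀ c : ℝ, y + c • v ∉ lattice) :
    Path (⟨y + (0 : ℝ) • v, h 0⟩ : PuncturedPlane) ⟨y + (1 : ℝ) • v, h 1⟩ where
  toFun t := ⟨y + (t : ℝ) • v, h t⟩
  continuous_toFun := by
    refine Continuous.subtype_mk ?_ _
    fun_prop
  source' := by simp
  target' := by simp

theorem slopeDir_integral (s : OnePoint ℚ) :
    ∃ a b : ℤ, slopeDir s = ((a : ℝ), (b : ℝ)) := by
  induction s using OnePoint.rec with
  | infty => exact ⟨0, 1, by simp [slopeDir, fareyVec]⟩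
  | coe q => exact ⟨q.den, q.num, by simp [slopeDir, fareyVec]⟩

/-- The simple loop of slope `s` on the bridge sphere of `K(s)`, obtained from a line of slope `s`
which passes through `y` and misses the lattice: the line closes up after the translation by twice
the primitive vector. -/
def slopeLoop (s : OnePoint ℚ) (y : ℝ × ℝ) (h : ∀ c : ℝ, y + c • ((2 : ℝ) • slopeDir s) ∉ lattice) :
    Path (bridge s ⟨_, h 0⟩) (bridge s ⟨_, h 0⟩) :=
  ((linePath y ((2 : ℝ) • slopeDir s) h).map (bridge s).continuous).cast rfl (by
    obtain ⟨a, b, hab⟩ := slopeDir_integral s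
    refine (bridge_translate s _ _ a b ?_).symm
    simp only [hab]
    ext <;> simp)

/-- The conjugacy class (up to inversion) `α_s` in the fundamental group of the complement of `K(s)`
and its lower tunnel; it is represented by the meridional loop of the lower tunnel. -/
def alphaClass (s : OnePoint ℚ) : Set (FundamentalGroup (TunnelComplement s) (base s)) :=
  {g | ∃ (y : ℝ × ℝ) (h : ∀ c : ℝ, y + c • ((2 : ℝ) • slopeDir s) ∉ lattice)
    (δ : Path (base s) (bridge s ⟨_, h 0⟩)),
    g = FundamentalGroup.fromPath
      (Path.Homotopic.Quotient.mk (δ.trans ((slopeLoop s y h).trans δ.symm)))}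

/-- The even Heckoid group of integral index `n` for `K(r)`: the orbifold fundamental group of the
orbifold with underlying space the complement (or exterior) of `K(r)` and with singular set the
lower tunnel, of index `n`. It is the fundamental group of the complement of the singular set,
divided by the normal closure of the `n`-th powers of the meridians of the singular set. -/
abbrev EvenHeckoidGroup (r : ℚ) (n : ℕ) : Type :=
  FundamentalGroup (TunnelComplement (r : OnePoint ℚ)) (base r) ⧸
    Subgroup.normalClosure {g | ∃ α ∈ alphaClass (r : OnePoint ℚ), g = α ^ n}

/-- The projection onto the even Heckoid group. -/
def toEven (r : ℚ) (n : ℕ) :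
    FundamentalGroup (TunnelComplement (r : OnePoint ℚ)) (base r) →* EvenHeckoidGroup r n :=
  QuotientGroup.mk' _

/-! ### Orbifold fundamental groups of global quotients -/

/-- The orbifold fundamental group of the quotient of a space by a group `Γ` of homeomorphisms:
its elements are the pairs of an element `g` of `Γ` and a homotopy class of paths between `g x₀`
and `x₀`. -/
@[ext]
structure OrbifoldGroup {X : Type*} [TopologicalSpace X] (Γ : Subgroup (X ≃ₜ X)) (x₀ : X) where
  elt : Γ
  path : Path.Homotopic.Quotient (elt.1 x₀) x₀

namespace OrbifoldGroup

variable {X : Type*} [TopologicalSpace X] {Γ : Subgroup (X ≃ₜ X)} {x₀ : X}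

theorem ext_cast {p q : OrbifoldGroup Γ x₀} (h : p.elt = q.elt)
    (hp : p.path = q.path.cast (by rw [h]) rfl) : p = q := by
  obtain ⟨g, γ⟩ := p
  obtain ⟨g', γ'⟩ := q
  obtain rfl : g = g' := h
  simp only [Path.Homotopic.Quotient.cast_rfl_rfl] at hp
  rw [hp]

theorem trans_symm_cast {u v w : X} (η : Path.Homotopic.Quotient u v) (h : w = u) :
    η.trans (η.symm.cast rfl h) = (Path.Homotopic.Quotient.refl w).cast h.symm rfl := by
  subst h
  simp

instance : Mul (OrbifoldGroup Γ x₀) where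
  mul p q := ⟨p.elt * q.elt, (q.path.map (p.elt.1 : C(X, X))).trans p.path⟩

instance : One (OrbifoldGroup Γ x₀) where
  one := ⟨1, Path.Homotopic.Quotient.refl x₀⟩

instance : Inv (OrbifoldGroup Γ x₀) where
  inv p := ⟨p.elt⁻¹, (p.path.symm.map ((p.elt⁻¹).1 : C(X, X))).cast rfl
    (p.elt.1.symm_apply_apply x₀).symm⟩

instance : Group (OrbifoldGroup Γ x₀) :=
  Group.ofLeftAxioms
    (by
      rintro ⟨g, γ⟩ ⟨h, δ⟩ ⟨k, ε⟩
      induction γ using Path.Homotopic.Quotient.ind with | mk γ =>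
      induction δ using Path.Homotopic.Quotient.ind with | mk δ =>
      induction ε using Path.Homotopic.Quotient.ind with | mk ε =>
      refine ext_cast (mul_assoc g h k) ?_
      refine (Path.Homotopic.Quotient.trans_assoc
        (Path.Homotopic.Quotient.mk (ε.map (g.1 * h.1).continuous))
        (Path.Homotopic.Quotient.mk (δ.map g.1.continuous))
        (Path.Homotopic.Quotient.mk γ)).symm.trans ?_
      exact congrArg Path.Homotopic.Quotient.mk (congrArg (fun η => Path.trans η γ)
        (Path.map_trans (ε.map h.1.continuous) δ g.1.continuous).symm))
    (by
      rintro ⟨g, γ⟩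
      induction γ using Path.Homotopic.Quotient.ind with | mk γ =>
      refine ext_cast (one_mul g) ?_
      exact Path.Homotopic.Quotient.trans_refl (Path.Homotopic.Quotient.mk γ))
    (by
      rintro ⟨g, γ⟩
      induction γ using Path.Homotopic.Quotient.ind with | mk γ =>
      refine ext_cast (inv_mul_cancel g) ?_
      exact trans_symm_cast (Path.Homotopic.Quotient.mk (γ.map (g⁻¹).1.continuous))
        (g.1.symm_apply_apply x₀).symm)

/-- The fundamental group of the space inside the orbifold fundamental group of the quotient. -/
def ofFundamentalGroup (Γ : Subgroup (X ≃ₜ X)) (x₀ : X) :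
    FundamentalGroup X x₀ →* OrbifoldGroup Γ x₀ where
  toFun γ := ⟨1, FundamentalGroup.toPath γ⟩
  map_one' := rfl
  map_mul' γ δ := by
    refine ext_cast (mul_one 1).symm ?_
    induction γ using Path.Homotopic.Quotient.ind with | mk γ =>
    induction δ using Path.Homotopic.Quotient.ind with | mk δ =>
    rfl

end OrbifoldGroup

/-! ### Odd Heckoid groups -/

/-- The symmetry of the sphere of `K(s)` induced by the translation by an integral vector. -/
def translate (s : OnePoint ℚ) (a b : ℤ) : LinkSphere s → LinkSphere s :=
  Quot.map (fun p => (p.1 + ((a : ℝ), (b : ℝ)), p.2)) (by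
    rintro _ _ (⟨x, t, c, d⟩ | ⟨x, c⟩ | ⟨x, c⟩)
    · convert GlueRel.rotate (s := s) (x + ((a : ℝ), (b : ℝ))) t (c + a) (d + b) using 2
      ext <;> simp <;> ring
    · rw [add_right_comm]
      exact GlueRel.upper _ _
    · rw [add_right_comm]
      exact GlueRel.lower _ _)

theorem translate_translate (s : OnePoint ℚ) (a b c d : ℤ) (z : LinkSphere s) :
    translate s a b (translate s c d z) = translate s (a + c) (b + d) z := by
  induction z using Quot.ind with | mk p =>
  refine congrArg (Quot.mk _) ?_
  ext <;> simp <;> ring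

theorem translate_zero (s : OnePoint ℚ) (z : LinkSphere s) : translate s 0 0 z = z := by
  induction z using Quot.ind with | mk p =>
  refine congrArg (Quot.mk _) ?_
  ext <;> simp

/-- The homeomorphism `φ` of the complement of `K(s)` and its lower tunnel is induced by the
translation by `(a, b)`. -/
def IsTranslation (s : OnePoint ℚ) (φ : TunnelComplement s ≃ₜ TunnelComplement s) (a b : ℤ) :
    Prop :=
  ∀ z, (φ z).1 = translate s a b z.1

/-- The natural group of symmetries `(ℤ/2)²` of `K(s)`, acting on the complement of `K(s)` and its
lower tunnel: it is induced by the translations of the plane by integral vectors, where those in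
`2ℤ²` act trivially. -/
def symmetryGroup (s : OnePoint ℚ) : Subgroup (TunnelComplement s ≃ₜ TunnelComplement s) where
  carrier := {φ | ∃ a b, IsTranslation s φ a b}
  one_mem' := ⟨0, 0, fun z => (translate_zero s z.1).symm⟩
  mul_mem' := by
    rintro φ ψ ⟨a, b, hφ⟩ ⟨c, d, hψ⟩
    refine ⟨a + c, b + d, fun z => ?_⟩
    change (φ (ψ z)).1 = _
    rw [hφ, hψ, translate_translate]
  inv_mem' := by
    rintro φ ⟨a, b, hφ⟩
    refine ⟨-a, -b, fun z => ?_⟩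
    change (φ.symm z).1 = _
    have h := hφ (φ.symm z)
    rw [φ.apply_symm_apply] at h
    rw [h, translate_translate, neg_add_cancel, neg_add_cancel, translate_zero]

/-- The orbifold fundamental group of the quotient, by the natural symmetries, of the complement of
`K(s)` and its lower tunnel. -/
abbrev SymmetricGroup (s : OnePoint ℚ) : Type := OrbifoldGroup (symmetryGroup s) (base s)

/-- The conjugacy class (up to inversion) `β_s` of a line of slope `s` in the quotient by the natural
symmetries; such a line closes up there after the translation by the primitive vector, so that
`β_s ^ 2 = α_s`. It is represented by the meridional loop of the image of the lower tunnel. -/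
def betaClass (s : OnePoint ℚ) : Set (SymmetricGroup s) :=
  {g | ∃ (a b : ℤ) (_ : slopeDir s = ((a : ℝ), (b : ℝ))) (_ : IsTranslation s g.elt.1 a b)
    (y : ℝ × ℝ) (h : ∀ c : ℝ, y + c • slopeDir s ∉ lattice)
    (δ : Path (base s) (bridge s ⟨_, h 0⟩))
    (e : g.elt.1 (bridge s ⟨_, h 0⟩) = bridge s ⟨_, h 1⟩),
    g.path = Path.Homotopic.Quotient.mk
      (((δ.map g.elt.1.continuous).cast rfl e.symm).trans
        ((((linePath y (slopeDir s) h).map (bridge s).continuous).symm).trans δ.symm))}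

/-- The orbifold fundamental group of the quotient of `K(r)` by its natural symmetries, where the
image of the lower tunnel is a singular edge of index `m`. -/
abbrev QuotientOrbifoldGroup (r : ℚ) (m : ℕ) : Type :=
  SymmetricGroup (r : OnePoint ℚ) ⧸
    Subgroup.normalClosure {g | ∃ β ∈ betaClass (r : OnePoint ℚ), g = β ^ m}

/-- The natural homomorphism from the fundamental group of the complement of `K(r)` and its lower
tunnel. -/
def toQuotientOrbifoldGroup (r : ℚ) (m : ℕ) :
    FundamentalGroup (TunnelComplement (r : OnePoint ℚ)) (base r) →* QuotientOrbifoldGroup r m :=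
  (QuotientGroup.mk' _).comp (OrbifoldGroup.ofFundamentalGroup _ _)

/-- For odd `m`, the odd Heckoid group of index `m/2` for `K(r)`: the fundamental group of the double
covering of the quotient orbifold that belongs to the image of the natural homomorphism. -/
abbrev OddHeckoidGroup (r : ℚ) (m : ℕ) : Type := (toQuotientOrbifoldGroup r m).range

/-- The projection onto the odd Heckoid group. -/
def toOdd (r : ℚ) (m : ℕ) :
    FundamentalGroup (TunnelComplement (r : OnePoint ℚ)) (base r) →* OddHeckoidGroup r m :=
  (toQuotientOrbifoldGroup r m).rangeRestrict

end Heckoid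

end

/-! ### Transports: group-valued representations of the fundamental groupoid -/

open scoped unitInterval

noncomputable section

namespace Heckoid

/-! The complement of `K(s)` and its lower tunnel does not depend on `s` as a space: it is the
exterior of the trivial tangle of slope `∞`, and the link group is obtained from its fundamental
group by killing the loop `α_s`. So the whole matter is to show that `α_s`, read in the complement
belonging to `K(r)`, becomes trivial in the Heckoid group. The identity map of the tangle exterior
then induces the epimorphism, and it respects the upper meridians. If instead `s + 1` lies in the
orbit, the identity is replaced by the shear `(x, y) ↦ (x, y + x)`, which carries slope `s` to slope
`s + 1` and the upper meridian pair `{a, b}` to a simultaneous conjugate of `{a, b⁻¹}`.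

To see that `α_s` dies one passes to the quotient by the symmetries, where `α_s = β_s ^ 2`. A
homomorphism from its orbifold group gives a transport on the plane punctured at `ℤ²` which is
invariant under all integral translations, in other words a representation of the free group of rank
two of the once-punctured torus. Such a transport is determined, up to a periodic gauge and a
conjugation, by its values `X`, `Y` on a vertical and a horizontal unit edge
(`PathHom.exists_gauge`). In a suitable lattice basis the generators of `Γ(r; m/2)` act by
elementary maps. A Farey reflection at a vertex sends `(X, Y)` to `(X⁻¹, Y)`, where `X` is the value
along that vertex; this changes nothing if `X ^ 2 = 1`. The parabolic by `m` units inserts the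
factor `X ^ m` into `Y`, which changes nothing if `X ^ m = 1`. At the vertex `∞` the first relation
holds, because `α_∞` bounds a disc in the tangle exterior; at `r` the second one holds by the
definition of the orbifold. Hence the order of the transport along lines is constant on `Γ(r;
m/2)`-orbits of slopes, and every `s` in the orbit of `∞` satisfies `β_s ^ 2 = 1`
(`PathHom.lineTorsion_of_inOrbit`).

Two points connect this with the statement. A representation that kills `α_s` has to be extended
over the link complement: near the lower tunnel the space retracts to an annulus with core `α_s`, so
the transport is a coboundary there (`exists_gauge_lowerRegion`), and after a change of gauge it can
be continued by `1` (`exists_extension`). For integral `n` the relation has to be brought back from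
the quotient orbifold of index `2n` to the even Heckoid group. This works because conjugation in the
larger group permutes the class of `α_r`, so that no further relations arise (`toEven_eq_one`). For
odd `m` the Heckoid group is by definition an image in the orbifold group. -/

/-- A homotopy invariant parallel transport with values in a group. -/
structure PathHom (X : Type*) [TopologicalSpace X] (G : Type*) [Group G] where
  val : ∀ {x y : X}, Path x y → G
  val_homotopic : ∀ {x y : X} {γ γ' : Path x y}, γ.Homotopic γ' → val γ = val γ'
  val_trans : ∀ {x y z : X} (γ : Path x y) (δ : Path y z), val (γ.trans δ) = val δ * val γ

namespace PathHom

variable {X Y : Type*} [TopologicalSpace X] [TopologicalSpace Y] {G H : Type*} [Group G] [Group H]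
  (c c' : PathHom X G)

/-- Endpoints of mapped, cast or concatenated paths often agree only propositionally. Comparing
paths pointwise avoids transporting along these equalities. -/
theorem val_congr {x y x' y' : X} (γ : Path x y) (γ' : Path x' y') (h : ∀ t, γ t = γ' t) :
    c.val γ = c.val γ' := by
  obtain rfl : x = x' := by simpa using h 0
  obtain rfl : y = y' := by simpa using h 1
  rw [show γ = γ' from Path.ext (funext h)]

@[simp]
theorem val_refl (x : X) : c.val (Path.refl x) = 1 := by
  have h := c.val_trans (Path.refl x) (Path.refl x)
  rw [c.val_homotopic ⟨Path.Homotopy.transRefl (Path.refl x)⟩] at h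
  simpa using h

@[simp]
theorem val_symm {x y : X} (γ : Path x y) : c.val γ.symm = (c.val γ)⁻¹ := by
  have h := c.val_trans γ γ.symm
  rw [← c.val_homotopic ⟨Path.Homotopy.reflTransSymm γ⟩, val_refl] at h
  exact eq_inv_of_mul_eq_one_left h.symm

theorem val_const {x y : X} (γ : Path x y) (h : ∀ t, γ t = x) : c.val γ = 1 := by
  rw [c.val_congr γ (Path.refl x) h, val_refl]

theorem val_subpath {x y : X} (γ : Path x y) (a b d : I) :
    c.val (γ.subpath a d) = c.val (γ.subpath b d) * c.val (γ.subpath a b) := by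
  rw [← c.val_trans]
  exact (c.val_homotopic ⟨Path.Homotopy.subpathTransSubpath γ a b d⟩).symm

theorem val_subpath_zero_one {x y : X} (γ : Path x y) : c.val (γ.subpath 0 1) = c.val γ :=
  c.val_congr _ _ fun t => by simp [Path.subpath]

/-- Pull back along a continuous map. -/
def pullback (f : C(Y, X)) : PathHom Y G where
  val γ := c.val (γ.map f.continuous)
  val_homotopic h := c.val_homotopic (h.map f)
  val_trans γ δ := by rw [Path.map_trans, c.val_trans]

/-- Push forward along a homomorphism. -/
def mapHom (φ : G →* H) : PathHom X H where
  val γ := φ (c.val γ)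
  val_homotopic h := by rw [c.val_homotopic h]
  val_trans γ δ := by rw [c.val_trans, map_mul]

/-- Change of gauge. -/
def gauge (u : X → G) : PathHom X G where
  val {x y} γ := u y * c.val γ * (u x)⁻¹
  val_homotopic h := by rw [c.val_homotopic h]
  val_trans γ δ := by rw [c.val_trans]; group

theorem pullback_val (f : C(Y, X)) {x y : Y} (γ : Path x y) :
    (c.pullback f).val γ = c.val (γ.map f.continuous) := rfl

theorem gauge_val (u : X → G) {x y : X} (γ : Path x y) :
    (c.gauge u).val γ = u y * c.val γ * (u x)⁻¹ := rfl

theorem subpath_mem_Icc (a b : I) (h : a ≤ b) (t : I) :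
    Set.Icc.convexComb a b t ∈ Set.Icc a b :=
  ⟨Set.Icc.le_convexComb h t, Set.Icc.convexComb_le h t⟩

/-- Two transports which agree on the paths in the members of an open cover are equal. -/
theorem val_eq_of_cover {ι : Type*} (U : ι → Set X) (hU : ∀ i, IsOpen (U i))
    (hcov : ∀ x, ∃ i, x ∈ U i)
    (h : ∀ i {x y : X} (γ : Path x y), (∀ t, γ t ∈ U i) → c.val γ = c'.val γ)
    {x y : X} (γ : Path x y) : c.val γ = c'.val γ := by
  obtain ⟨t, h0, hmono, ⟨n, hn⟩, ht⟩ :=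
    exists_monotone_Icc_subset_open_cover_unitInterval (c := fun i => γ ⁻¹' (U i))
      (fun i => (hU i).preimage γ.continuous) (fun s _ => by
        obtain ⟨i, hi⟩ := hcov (γ s)
        exact Set.mem_iUnion.2 ⟨i, hi⟩)
  have key : ∀ k, c.val (γ.subpath 0 (t k)) = c'.val (γ.subpath 0 (t k)) := by
    intro k
    induction k with
    | zero =>
      rw [c.val_const _ fun s => by simp [Path.subpath, h0],
        c'.val_const _ fun s => by simp [Path.subpath, h0]]
    | succ k ih =>
      rw [c.val_subpath γ 0 (t k), c'.val_subpath γ 0 (t k), ih]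
      obtain ⟨i, hi⟩ := ht k
      rw [h i (γ.subpath (t k) (t (k + 1))) fun s =>
        hi (subpath_mem_Icc _ _ (hmono (Nat.le_succ k)) s)]
  have := key n
  rwa [hn n le_rfl, val_subpath_zero_one, val_subpath_zero_one] at this

theorem val_eq_of_simplyConnected [SimplyConnectedSpace X] {x y : X} (γ γ' : Path x y) :
    c.val γ = c.val γ' :=
  c.val_homotopic (SimplyConnectedSpace.paths_homotopic γ γ')

/-- The transport between two points of a simply connected space. -/
def endVal [SimplyConnectedSpace X] (x y : X) : G := c.val (PathConnectedSpace.somePath x y)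

theorem val_eq_endVal [SimplyConnectedSpace X] {x y : X} (γ : Path x y) :
    c.val γ = c.endVal x y :=
  c.val_eq_of_simplyConnected _ _

theorem endVal_mul [SimplyConnectedSpace X] (x y z : X) :
    c.endVal y z * c.endVal x y = c.endVal x z := by
  rw [endVal, endVal, ← c.val_trans, val_eq_endVal]

/-- The homomorphism from the fundamental group. -/
def toHom (x₀ : X) : FundamentalGroup X x₀ →* G where
  toFun := Quotient.lift c.val fun _ _ h => c.val_homotopic h
  map_one' := c.val_refl x₀
  map_mul' p q := by
    induction p using Path.Homotopic.Quotient.ind with | mk p =>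
    induction q using Path.Homotopic.Quotient.ind with | mk q =>
    -- A product in the fundamental group traverses its right factor first, which matches the
    -- reversed order in `val_trans`.
    exact c.val_trans q p

theorem toHom_mk {x₀ : X} (γ : Path x₀ x₀) :
    c.toHom x₀ (FundamentalGroup.fromPath (Path.Homotopic.Quotient.mk γ)) = c.val γ := rfl

open Classical in
/-- Paths from the base point to all points, which are constant at the base point. -/
def framePath [PathConnectedSpace X] (x₀ x : X) : Path x₀ x :=
  if h : x = x₀ then (Path.refl x₀).cast rfl h else PathConnectedSpace.somePath x₀ x

theorem framePath_self [PathConnectedSpace X] (x₀ : X) : framePath x₀ x₀ = Path.refl x₀ := by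
  simp [framePath]

/-- A homomorphism from the fundamental group extends to a transport. -/
def ofHom [PathConnectedSpace X] (x₀ : X) (φ : FundamentalGroup X x₀ →* G) : PathHom X G where
  val {x y} γ := φ (FundamentalGroup.fromPath (Path.Homotopic.Quotient.mk
    ((framePath x₀ x).trans (γ.trans (framePath x₀ y).symm))))
  val_homotopic h := by
    congr 1
    exact Path.Homotopic.Quotient.eq.2 ((Path.Homotopic.refl _).hcomp (h.hcomp (.refl _)))
  val_trans {x y z} γ δ := by
    rw [← map_mul]
    congr 1
    rw [FundamentalGroup.mul_def]
    simp only [Path.Homotopic.Quotient.mk_trans, Path.Homotopic.Quotient.mk_symm,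
      Path.Homotopic.Quotient.trans_assoc]
    congr 2
    rw [← Path.Homotopic.Quotient.trans_assoc (Path.Homotopic.Quotient.symm _)]
    simp

/-- The frame at the base point is constant, so loops there keep their value exactly and not merely
up to conjugation. -/
theorem ofHom_val_loop [PathConnectedSpace X] {x₀ : X} (φ : FundamentalGroup X x₀ →* G)
    (γ : Path x₀ x₀) :
    (ofHom x₀ φ).val γ = φ (FundamentalGroup.fromPath (Path.Homotopic.Quotient.mk γ)) := by
  change φ _ = φ _
  rw [framePath_self]
  congr 1
  simp [Path.Homotopic.Quotient.mk_trans]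

end PathHom

end Heckoid

end

open scoped unitInterval

noncomputable section

namespace Heckoid

open Filter Topology

/-! ### Extension of a transport from an open subspace -/

section Extension

variable {X Y : Type*} [TopologicalSpace X] [TopologicalSpace Y] {G : Type*} [Group G]

/-- The continuous path along a segment. -/
def segMap {E : Type*} [AddCommGroup E] [Module ℝ E] [TopologicalSpace E]
    [ContinuousSMul ℝ E] [IsTopologicalAddGroup E] (F : C(E, X)) (p q : E) :
    Path (F p) (F q) :=
  (Path.segment p q).map F.continuous

open Classical in
/-- The transport along those paths of `X` which lift to `Y`, and `1` for all other paths. -/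
def partialVal (j : C(Y, X)) (c : PathHom Y G) {x y : X} (γ : Path x y) : G :=
  if h : ∃ (a b : Y) (γ' : Path a b), ∀ t, j (γ' t) = γ t then
    c.val h.choose_spec.choose_spec.choose else 1

variable {j : C(Y, X)} (hj : IsOpenEmbedding j) {V : Set X} (c : PathHom Y G)

include hj in
-- Injectivity of `j` makes the lift unique, so the chosen one may be replaced by any other.
theorem partialVal_of_lift {x y : X} (γ : Path x y) {a b : Y} (γ' : Path a b)
    (h : ∀ t, j (γ' t) = γ t) : partialVal j c γ = c.val γ' := by
  have hex : ∃ (a b : Y) (γ' : Path a b), ∀ t, j (γ' t) = γ t := ⟨a, b, γ', h⟩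
  rw [partialVal, dif_pos hex]
  refine c.val_congr _ _ fun t => hj.injective ?_
  rw [h, hex.choose_spec.choose_spec.choose_spec]

theorem partialVal_congr {x y x' y' : X} (γ : Path x y) (γ' : Path x' y')
    (h : ∀ t, γ t = γ' t) : partialVal j c γ = partialVal j c γ' := by
  obtain rfl : x = x' := by simpa using h 0
  obtain rfl : y = y' := by simpa using h 1
  rw [show γ = γ' from Path.ext (funext h)]

include hj in
theorem partialVal_const {x y : X} (γ : Path x y) (h : ∀ t, γ t = x) : partialVal j c γ = 1 := by
  by_cases hex : ∃ (a b : Y) (γ' : Path a b), ∀ t, j (γ' t) = γ t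
  · rw [partialVal, dif_pos hex]
    refine c.val_const _ fun t => hj.injective ?_
    have h0 := hex.choose_spec.choose_spec.choose_spec 0
    rw [Path.source, h] at h0
    rw [hex.choose_spec.choose_spec.choose_spec, h, h0]
  · rw [partialVal, dif_neg hex]

/-- The image of `K` lies in the open subspace, or in `V`. -/
def IsSmall {E : Type*} (j : C(Y, X)) (V : Set X) (F : E → X) (K : Set E) : Prop :=
  (∀ x ∈ K, F x ∈ Set.range j) ∨ ∀ x ∈ K, F x ∈ V

variable (hc : ∀ {a b : Y} (γ : Path a b), (∀ t, j (γ t) ∈ V) → c.val γ = 1)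

include hc in
-- Here the default value `1` matters: a path in `V` either lifts, and is trivial by hypothesis, or
-- does not lift and takes the default.
theorem partialVal_of_mem {x y : X} (γ : Path x y) (h : ∀ t, γ t ∈ V) : partialVal j c γ = 1 := by
  by_cases hex : ∃ (a b : Y) (γ' : Path a b), ∀ t, j (γ' t) = γ t
  · rw [partialVal, dif_pos hex]
    refine hc _ fun t => ?_
    rw [hex.choose_spec.choose_spec.choose_spec]
    exact h t
  · rw [partialVal, dif_neg hex]

include hj hc in
-- On a small set `partialVal` is an honest transport: the pullback of `c` if the set maps into the
-- open subspace, the trivial transport if it maps into `V`.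
theorem exists_pathHom_of_isSmall {E : Type*} [TopologicalSpace E] {F : C(E, X)} {K : Set E} (h : IsSmall j V F K) :
    ∃ d : PathHom K G, ∀ {p q : K} (γ : Path p q),
      partialVal j c (γ.map (F.continuous.comp continuous_subtype_val)) = d.val γ := by
  rcases h with h | h
  · choose f hf using fun x : K => h x x.2
    have hfc : Continuous f := by
      rw [hj.isInducing.continuous_iff]
      have : (j : Y → X) ∘ f = F ∘ Subtype.val := funext hf
      rw [this]
      exact F.continuous.comp continuous_subtype_val
    exact ⟨c.pullback ⟨f, hfc⟩, fun γ => partialVal_of_lift hj c _ _ fun t => hf (γ t)⟩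
  · exact ⟨⟨fun _ => 1, fun _ => rfl, fun _ _ => (one_mul 1).symm⟩, fun γ =>
      partialVal_of_mem c hc _ fun t => h _ (γ t).2⟩

variable {E : Type*} [NormedAddCommGroup E] [NormedSpace ℝ E]

include hj hc in
-- A convex set is contractible, so a transport on it depends only on the endpoints; this gives the
-- cocycle law for segments.
theorem partialVal_triangle {F : C(E, X)} {K : Set E} (hK : Convex ℝ K) (h : IsSmall j V F K)
    {p q r : E} (hp : p ∈ K) (hq : q ∈ K) (hr : r ∈ K) :
    partialVal j c (segMap F p r) =
      partialVal j c (segMap F q r) * partialVal j c (segMap F p q) := by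
  obtain ⟨d, hd⟩ := exists_pathHom_of_isSmall hj c hc h
  have : ContractibleSpace K := hK.contractibleSpace ⟨p, hp⟩
  have seg : ∀ a b : K, ∃ γ : Path a b, ∀ t, (γ t : E) = Path.segment a.1 b.1 t := fun a b =>
    ⟨{ toFun := fun t => ⟨Path.segment a.1 b.1 t, by
          rw [Path.segment_apply]
          exact hK.lineMap_mem a.2 b.2 t.2⟩
       continuous_toFun := by fun_prop
       source' := by simp
       target' := by simp }, fun t => rfl⟩
  obtain ⟨γ₁, h₁⟩ := seg ⟨p, hp⟩ ⟨q, hq⟩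
  obtain ⟨γ₂, h₂⟩ := seg ⟨q, hq⟩ ⟨r, hr⟩
  obtain ⟨γ₃, h₃⟩ := seg ⟨p, hp⟩ ⟨r, hr⟩
  rw [partialVal_congr c (segMap F p r) (γ₃.map (F.continuous.comp continuous_subtype_val))
      (fun t => congrArg F (h₃ t).symm),
    partialVal_congr c (segMap F p q) (γ₁.map (F.continuous.comp continuous_subtype_val))
      (fun t => congrArg F (h₁ t).symm),
    partialVal_congr c (segMap F q r) (γ₂.map (F.continuous.comp continuous_subtype_val))
      (fun t => congrArg F (h₂ t).symm), hd, hd, hd, ← d.val_trans]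
  exact d.val_eq_of_simplyConnected _ _

/-- A function on the unit interval which is transported along `F`, locally. -/
def IsPrimitive (j : C(Y, X)) (c : PathHom Y G) (F : C(ℝ, X)) (g : ℝ → G) : Prop :=
  ∀ t₀ ∈ I, ∀ᶠ t in 𝓝[I] t₀, g t = partialVal j c (segMap F t₀ t) * g t₀

include hj hc in
-- The primitive is continued to the right in steps of `δ / 2`, each time by transport inside one
-- small ball. Constancy of `F` on the negative half-line lets the induction start from a constant
-- function.
theorem exists_isPrimitive {F : C(ℝ, X)} {δ : ℝ} (hδ : 0 < δ)
    (h : ∀ t, IsSmall j V F (Metric.ball t δ)) (h0 : ∀ t ≤ 0, F t = F 0) :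
    ∃ g, IsPrimitive j c F g := by
  have key : ∀ n : ℕ, ∃ g : ℝ → G, ∀ t₀ ∈ Set.Iio (n * (δ / 2)),
      ∀ᶠ t in 𝓝 t₀, g t = partialVal j c (segMap F t₀ t) * g t₀ := by
    intro n
    induction n with
    | zero =>
      refine ⟨fun _ => 1, fun t₀ ht₀ => ?_⟩
      simp only [Nat.cast_zero, zero_mul, Set.mem_Iio] at ht₀
      filter_upwards [eventually_lt_nhds ht₀] with t ht
      rw [partialVal_const hj, one_mul]
      intro s
      have hs : AffineMap.lineMap t₀ t (s : ℝ) ≤ (0 : ℝ) :=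
        (convex_Iic (0 : ℝ)).lineMap_mem ht₀.le ht.le s.2
      exact (h0 _ hs).trans (h0 _ ht₀.le).symm
    | succ n ih =>
      obtain ⟨g, hg⟩ := ih
      set T : ℝ := n * (δ / 2) with hT
      -- The gluing point lies strictly inside the range already covered, and the new bound `T + δ /
      -- 2 = a + 3 * δ / 4` still lies in the ball of radius `δ` about `a`.
      set a : ℝ := T - δ / 4 with ha
      have hK := h a
      refine ⟨fun t => if t < a then g t else partialVal j c (segMap F a t) * g a, ?_⟩
      intro t₀ ht₀
      have ht₀' : t₀ < T + δ / 2 := by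
        rw [Set.mem_Iio] at ht₀
        push_cast at ht₀
        linarith
      rcases lt_trichotomy t₀ a with hlt | rfl | hgt
      · filter_upwards [eventually_lt_nhds hlt, hg t₀ (show t₀ < T by linarith)] with t ht ht'
        simp only [if_pos hlt, if_pos ht, ht']
      · filter_upwards [hg a (show a < T by linarith)] with t ht
        have h1 : partialVal j c (segMap F a a) = 1 := partialVal_const hj c _ fun s => by
          simp [segMap]
        simp only [lt_irrefl, if_false, h1, one_mul]
        split_ifs
        · exact ht
        · rfl
      · have hb : t₀ < a + δ := by linarith
        filter_upwards [eventually_gt_nhds hgt, eventually_lt_nhds hb] with t ht ht'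
        have mem : ∀ x, a ≤ x → x < a + δ → x ∈ Metric.ball a δ := fun x h1 h2 => by
          rw [Metric.mem_ball, Real.dist_eq, abs_lt]; constructor <;> linarith
        rw [if_neg ht.not_gt, if_neg hgt.not_gt, ← mul_assoc,
          ← partialVal_triangle hj c hc (convex_ball a δ) hK (mem a le_rfl (by linarith))
            (mem _ hgt.le hb) (mem _ ht.le ht')]
  obtain ⟨n, hn⟩ := exists_nat_gt (1 / (δ / 2))
  obtain ⟨g, hg⟩ := key n
  refine ⟨g, fun t ht => (hg t ?_).filter_mono nhdsWithin_le_nhds⟩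
  have : (1 : ℝ) < n * (δ / 2) := by rwa [div_lt_iff₀ (by positivity)] at hn
  exact lt_of_le_of_lt ht.2 this

/-- Two primitives differ by a locally constant right factor, hence by a constant one, which cancels
in `g t * (g s)⁻¹`. -/
theorem IsPrimitive.unique {F : C(ℝ, X)} {g g' : ℝ → G} (hg : IsPrimitive j c F g)
    (hg' : IsPrimitive j c F g') {s t : ℝ} (hs : s ∈ I) (ht : t ∈ I) :
    g t * (g s)⁻¹ = g' t * (g' s)⁻¹ := by
  have hl : IsLocallyConstant fun x : I => (g' x)⁻¹ * g x := by
    rw [IsLocallyConstant.iff_eventually_eq]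
    intro x
    have ht : Tendsto (Subtype.val : I → ℝ) (𝓝 x) (𝓝[I] (x : ℝ)) := by
      rw [nhds_subtype_eq_comap_nhdsWithin]
      exact tendsto_comap
    filter_upwards [ht.eventually (hg x x.2), ht.eventually (hg' x x.2)] with y h1 h2
    rw [h1, h2]
    group
  have h := hl.apply_eq_of_preconnectedSpace ⟨s, hs⟩ ⟨t, ht⟩
  have h' : g s = g' s * ((g' t)⁻¹ * g t) := by rw [← h]; group
  rw [h']
  group

/-- A homotopy, extended to the plane. -/
def planeExtend (H : C(I × I, X)) : C(ℝ × ℝ, X) :=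
  ⟨fun p => H (Set.projIcc 0 1 zero_le_one p.1, Set.projIcc 0 1 zero_le_one p.2), by fun_prop⟩

variable (hV : IsOpen V) (hcov : ∀ x, x ∈ Set.range j ∨ x ∈ V)

include hj hV hcov in
-- A Lebesgue number of the square also works in the plane, because the projection to the unit
-- interval does not increase distances.
theorem exists_isSmall_ball (H : C(I × I, X)) :
    ∃ δ > 0, ∀ p, IsSmall j V (planeExtend H) (Metric.ball p δ) := by
  obtain ⟨δ, hδ, h⟩ := lebesgue_number_lemma_of_metric (s := (Set.univ : Set (I × I)))
    (c := fun b : Bool => H ⁻¹' (if b then Set.range j else V)) isCompact_univ (by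
      rintro (_ | _)
      · exact hV.preimage H.continuous
      · exact hj.isOpen_range.preimage H.continuous) (fun p _ => by
      rcases hcov (H p) with h | h
      · exact Set.mem_iUnion.2 ⟨true, h⟩
      · exact Set.mem_iUnion.2 ⟨false, h⟩)
  refine ⟨δ, hδ, fun p => ?_⟩
  obtain ⟨b, hb⟩ := h (Set.projIcc 0 1 zero_le_one p.1, Set.projIcc 0 1 zero_le_one p.2) trivial
  have : ∀ q ∈ Metric.ball p δ, planeExtend H q ∈ if b then Set.range j else V := by
    intro q hq
    refine hb ?_
    rw [Metric.mem_ball, Prod.dist_eq, max_lt_iff] at hq ⊢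
    have hl : ∀ x y : ℝ, dist (Set.projIcc (0 : ℝ) 1 zero_le_one x)
        (Set.projIcc 0 1 zero_le_one y) ≤ dist x y := fun x y => by
      simpa using (LipschitzWith.projIcc (zero_le_one (α := ℝ))).dist_le_mul x y
    exact ⟨(hl _ _).trans_lt hq.1, (hl _ _).trans_lt hq.2⟩
  cases b
  · exact Or.inr this
  · exact Or.inl this

include hj hc hV hcov in
-- The path is regarded as a homotopy which is constant in the first variable, so the Lebesgue
-- number of a square can be used.
theorem Path.exists_isPrimitive {x y : X} (γ : Path x y) :
    ∃ g, IsPrimitive j c γ.extend g := by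
  obtain ⟨δ, hδ, h⟩ := exists_isSmall_ball hj hV hcov
    (⟨fun p => γ p.2, by fun_prop⟩ : C(I × I, X))
  refine Heckoid.exists_isPrimitive hj c hc hδ (fun t => ?_) (fun t ht => ?_)
  · have hm : ∀ s ∈ Metric.ball t δ, ((0 : ℝ), s) ∈ Metric.ball ((0 : ℝ), t) δ := fun s hs => by
      rw [Metric.mem_ball, Prod.dist_eq, max_lt_iff]
      exact ⟨by simpa using hδ, hs⟩
    rcases h (0, t) with h | h
    · exact Or.inl fun s hs => h _ (hm s hs)
    · exact Or.inr fun s hs => h _ (hm s hs)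
  · rw [γ.extend_of_le_zero ht, γ.extend_zero]

open Classical in
/-- The transport along a path of `X`. -/
def extendVal (j : C(Y, X)) (c : PathHom Y G) {x y : X} (γ : Path x y) : G :=
  if h : ∃ g, IsPrimitive j c γ.extend g then h.choose 1 * (h.choose 0)⁻¹ else 1

theorem extendVal_eq {x y : X} (γ : Path x y) {g : ℝ → G}
    (hg : IsPrimitive j c γ.extend g) : extendVal j c γ = g 1 * (g 0)⁻¹ := by
  have h : ∃ g, IsPrimitive j c γ.extend g := ⟨g, hg⟩
  rw [extendVal, dif_pos h]
  exact h.choose_spec.unique c hg unitInterval.zero_mem unitInterval.one_mem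

/-- Needed to cut a primitive along a concatenation into primitives along its two halves. -/
theorem IsPrimitive.comp_affine {F F' : C(ℝ, X)} {g : ℝ → G} (hg : IsPrimitive j c F g) (φ : ℝ →ᵃ[ℝ] ℝ)
    (hφc : Continuous φ) (hφ : ∀ t ∈ I, φ t ∈ I) (h : ∀ t ∈ I, F' t = F (φ t)) :
    IsPrimitive j c F' (g ∘ φ) := by
  intro t₀ ht₀
  have ht : Tendsto φ (𝓝[I] t₀) (𝓝[I] (φ t₀)) :=
    hφc.continuousWithinAt.tendsto_nhdsWithin hφ
  filter_upwards [ht.eventually (hg _ (hφ _ ht₀)), self_mem_nhdsWithin] with t h1 h2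
  rw [Function.comp_apply, Function.comp_apply, h1]
  congr 1
  refine partialVal_congr c _ _ fun s => ?_
  change F _ = F' _
  rw [Path.segment_apply, Path.segment_apply,
    h _ ((convex_Icc (0 : ℝ) 1).lineMap_mem ht₀ h2 s.2), AffineMap.apply_lineMap]

include hj hc hV hcov in
theorem extendVal_trans {x y z : X} (γ : Path x y) (δ : Path y z) :
    extendVal j c (γ.trans δ) = extendVal j c δ * extendVal j c γ := by
  obtain ⟨g, hg⟩ := Path.exists_isPrimitive hj c hc hV hcov (γ.trans δ)
  have h1 := hg.comp_affine (F' := γ.extend) c (AffineMap.lineMap 0 (1 / 2)) (by fun_prop)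
    (fun t ht => by
      simp only [AffineMap.lineMap_apply, vsub_eq_sub, smul_eq_mul, vadd_eq_add, Set.mem_Icc] at *
      constructor <;> linarith) (fun t ht => by
      have : AffineMap.lineMap (0 : ℝ) (1 / 2) t = t / 2 := by
        simp [AffineMap.lineMap_apply, div_eq_mul_inv]
      rw [this, Path.extend_trans_of_le_half _ _ (by linarith [ht.2])]
      congr 1; ring)
  have h2 := hg.comp_affine (F' := δ.extend) c (AffineMap.lineMap (1 / 2) 1) (by fun_prop)
    (fun t ht => by
      simp only [AffineMap.lineMap_apply, vsub_eq_sub, smul_eq_mul, vadd_eq_add, Set.mem_Icc] at *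
      constructor <;> linarith) (fun t ht => by
      have : AffineMap.lineMap (1 / 2 : ℝ) 1 t = (t + 1) / 2 := by
        simp [AffineMap.lineMap_apply]; ring
      rw [this, Path.extend_trans_of_half_le _ _ (by linarith [ht.1])]
      congr 1; ring)
  rw [extendVal_eq c _ hg, extendVal_eq c _ h1, extendVal_eq c _ h2]
  simp

include hj hc in
theorem extendVal_of_lift {x y : X} (γ : Path x y) {a b : Y} (γ' : Path a b)
    (h : ∀ t, j (γ' t) = γ t) : extendVal j c γ = c.val γ' := by
  have hs : IsSmall j V γ.extend Set.univ := Or.inl fun t _ =>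
    ⟨γ' (Set.projIcc 0 1 zero_le_one t), h _⟩
  have hg : IsPrimitive j c γ.extend fun t => partialVal j c (segMap γ.extend 0 t) := by
    intro t₀ _
    exact Eventually.of_forall fun t =>
      partialVal_triangle hj c hc convex_univ hs trivial trivial trivial
  rw [extendVal_eq c _ hg, partialVal_const hj c (segMap _ 0 0) fun s => by simp [segMap],
    inv_one, mul_one]
  refine partialVal_of_lift hj c _ _ fun t => ?_
  rw [h]
  simp [segMap, AffineMap.lineMap_apply]

include hj hc hV hcov in
-- The value is locally constant in the homotopy parameter. For neighbouring stages, a primitive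
-- along one becomes a primitive along the other after multiplication by the transport across the
-- gap; since the endpoints stay fixed, this factor is `1` at both ends.
theorem extendVal_homotopic {x y : X} {γ γ' : Path x y} (h : γ.Homotopic γ') :
    extendVal j c γ = extendVal j c γ' := by
  obtain ⟨H⟩ := h
  obtain ⟨δ, hδ, hs⟩ := exists_isSmall_ball hj hV hcov H.toContinuousMap
  set F := planeExtend H.toContinuousMap with hF
  have hFe : ∀ (s : I) (t : ℝ), (H.eval s).extend t = F (s, t) := fun s t => by
    change H _ = H _
    simp
  have key : ∀ s s' : I, dist s' s < δ → extendVal j c (H.eval s') = extendVal j c (H.eval s) := by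
    intro s s' hss
    obtain ⟨g, hg⟩ := Path.exists_isPrimitive hj c hc hV hcov (H.eval s)
    have hg' : IsPrimitive j c (H.eval s').extend fun t =>
        partialVal j c (segMap F ((s : ℝ), t) ((s' : ℝ), t)) * g t := by
      intro t₀ ht₀
      have hb : ∀ᶠ t in 𝓝[I] t₀, t ∈ Metric.ball t₀ δ :=
        nhdsWithin_le_nhds (Metric.ball_mem_nhds t₀ hδ)
      filter_upwards [hg t₀ ht₀, hb] with t h1 h2
      have mem : ∀ (a : I) (b : ℝ), dist a s < δ → dist b t₀ < δ →
          ((a : ℝ), b) ∈ Metric.ball ((s : ℝ), t₀) δ := fun a b h1 h2 => by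
        rw [Metric.mem_ball, Prod.dist_eq, max_lt_iff]
        exact ⟨h1, h2⟩
      have hh : ∀ a : I, partialVal j c (segMap (H.eval a).extend t₀ t) =
          partialVal j c (segMap F ((a : ℝ), t₀) ((a : ℝ), t)) := fun a =>
        partialVal_congr c _ _ fun r => by
          simp [segMap, hFe, AffineMap.lineMap_apply]
      have tri := fun p q r => partialVal_triangle hj c hc (convex_ball ((s : ℝ), t₀) δ)
        (hs ((s : ℝ), t₀)) (p := p) (q := q) (r := r)
      have h00 := mem s t₀ (by simpa) (by simpa)
      have h01 := mem s t (by simpa) h2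
      have h10 := mem s' t₀ hss (by simpa)
      have h11 := mem s' t hss h2
      -- Both ways around the small rectangle equal the transport along its diagonal.
      rw [h1, hh, hh, ← mul_assoc, ← mul_assoc, ← tri _ _ _ h00 h01 h11, ← tri _ _ _ h00 h10 h11]
    rw [extendVal_eq c _ hg, extendVal_eq c _ hg',
      partialVal_const hj c (segMap F ((s : ℝ), (1 : ℝ)) ((s' : ℝ), (1 : ℝ))),
      partialVal_const hj c (segMap F ((s : ℝ), (0 : ℝ)) ((s' : ℝ), (0 : ℝ))), one_mul, one_mul]
    · intro r
      change H _ = H _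
      simp [AffineMap.lineMap_apply]
    · intro r
      change H _ = H _
      simp [AffineMap.lineMap_apply]
  have hl : IsLocallyConstant fun s : I => extendVal j c (H.eval s) := by
    rw [IsLocallyConstant.iff_eventually_eq]
    intro s
    filter_upwards [Metric.ball_mem_nhds s hδ] with s' hs'
    exact key s s' hs'
  have := hl.apply_eq_of_preconnectedSpace 0 1
  simpa using this

include hj hc hV hcov in
/-- A transport on an open subspace which is trivial in `V` extends to the union. -/
theorem exists_extension :
    ∃ d : PathHom X G, ∀ {a b : Y} (γ : Path a b), d.val (γ.map j.continuous) = c.val γ :=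
  ⟨⟨extendVal j c, extendVal_homotopic hj c hc hV hcov, extendVal_trans hj c hc hV hcov⟩,
    fun γ => extendVal_of_lift hj c hc _ γ fun _ => rfl⟩

end Extension

end Heckoid

end

open scoped unitInterval

noncomputable section

namespace Heckoid

open Filter Topology

/-! ### The complement of link and tunnel -/

theorem fst_ne_of_vert {x : ℝ × ℝ} (h : ∀ a : ℤ, x.1 ≠ a) : x ∉ lattice := by
  rintro ⟨a, b, rfl⟩
  exact h a rfl

/-- The points of `ℝ² × [0,1]` over the complement of link and tunnel. -/
def OverTunnelComplement (p : (ℝ × ℝ) × I) : Prop :=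
  p.1 ∉ lattice ∧ p.2 ≠ 0 ∧ (p.2 = 1 → ∀ a : ℤ, p.1.1 ≠ a)

theorem slopeDir_infty : slopeDir OnePoint.infty = (0, 1) := by
  simp [slopeDir, fareyVec]

theorem overTunnelComplement_congr (s : OnePoint ℚ) {p q : (ℝ × ℝ) × I} (h : GlueRel s p q) :
    OverTunnelComplement p ↔ OverTunnelComplement q := by
  rcases h with ⟨x, t, a, b⟩ | ⟨x, c⟩ | ⟨x, c⟩
  · have h1 : (∀ k : ℤ, x.1 ≠ k) ↔ ∀ k : ℤ, 2 * (a : ℝ) - x.1 ≠ k := by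
      constructor
      · intro h k hk
        exact h (2 * a - k) (by push_cast; linarith)
      · intro h k hk
        exact h (2 * a - k) (by push_cast; linarith)
    simp only [OverTunnelComplement, neg_mem_lattice_iff, h1]
  · simp only [OverTunnelComplement, slopeDir_infty]
    constructor
    · rintro ⟨-, h1, h2⟩
      have := h2 trivial
      refine ⟨fst_ne_of_vert fun a => ?_, h1, fun _ a => ?_⟩ <;> simpa using this a
    · rintro ⟨-, h1, h2⟩
      have := h2 trivial
      refine ⟨fst_ne_of_vert fun a => ?_, h1, fun _ a => ?_⟩ <;> simpa using this a
  · simp [OverTunnelComplement]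

/-- The level of a point. -/
def level (s : OnePoint ℚ) : LinkSphere s → I :=
  Quot.lift Prod.snd (by rintro _ _ (_ | _ | _) <;> rfl)

theorem continuous_level (s : OnePoint ℚ) : Continuous (level s) :=
  continuous_quot_lift _ continuous_snd

theorem mem_lowerTunnel_iff (s : OnePoint ℚ) (p : (ℝ × ℝ) × I) :
    (Quot.mk _ p : LinkSphere s) ∈ lowerTunnel s ↔ p.2 = 0 := by
  constructor
  · rintro ⟨x, h⟩
    exact congrArg (level s) h
  · intro h
    exact ⟨p.1, by rw [← h]⟩

theorem mk_mem_iff (s : OnePoint ℚ) (p : (ℝ × ℝ) × I) :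
    ((Quot.mk _ p : LinkSphere s) ∉ link s ∧ (Quot.mk _ p : LinkSphere s) ∉ lowerTunnel s) ↔
      OverTunnelComplement p := by
  constructor
  · rintro ⟨h1, h2⟩
    rw [mem_lowerTunnel_iff] at h2
    -- A point of the upper level with integral first coordinate `a` slides along its collapsed
    -- vertical line to the lattice point `(a, 0)`, so it lies on the link.
    refine ⟨fun h => h1 ⟨p.1, p.2, h, rfl⟩, h2, fun ht a ha => h1 ⟨(a, 0), 1, ⟨a, 0, by simp⟩, ?_⟩⟩
    have := Quot.sound (GlueRel.upper (s := s) p.1 (-p.1.2))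
    rw [slopeDir_infty, ← ht] at this
    rw [← ht, this]
    congr 1
    ext <;> simp [ha]
  · intro h
    refine ⟨?_, by rw [mem_lowerTunnel_iff]; exact h.2.1⟩
    rintro ⟨x, t, hx, hq⟩
    have : Quot.lift OverTunnelComplement
        (fun _ _ h => propext (overTunnelComplement_congr s h)) (Quot.mk (GlueRel s) p) := h
    rw [hq] at this
    exact this.1 hx

/-- The point of the complement of link and tunnel below a point of `ℝ² × [0,1]`. -/
def tcMk (s : OnePoint ℚ) (p : (ℝ × ℝ) × I) (h : OverTunnelComplement p) : TunnelComplement s :=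
  ⟨Quot.mk _ p, (mk_mem_iff s p).2 h⟩

theorem exists_tcMk (s : OnePoint ℚ) (z : TunnelComplement s) : ∃ p h, z = tcMk s p h := by
  obtain ⟨z, hz⟩ := z
  induction z using Quot.ind with | mk p =>
  exact ⟨p, (mk_mem_iff s p).1 hz, rfl⟩

theorem isClosed_lattice : IsClosed lattice := by
  have : lattice = Set.range (Prod.map ((↑) : ℤ → ℝ) ((↑) : ℤ → ℝ)) := by
    ext x
    constructor
    · rintro ⟨a, b, rfl⟩
      exact ⟨(a, b), rfl⟩
    · rintro ⟨⟨a, b⟩, rfl⟩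
      exact ⟨a, b, rfl⟩
  rw [this]
  exact (Int.isClosedEmbedding_coe_real.prodMap Int.isClosedEmbedding_coe_real).isClosed_range

theorem isOpen_not_int : IsOpen {x : ℝ | ∀ a : ℤ, x ≠ a} := by
  have : {x : ℝ | ∀ a : ℤ, x ≠ a} = (Set.range ((↑) : ℤ → ℝ))ᶜ := by
    ext x
    simp [eq_comm]
  rw [this]
  exact Int.isClosedEmbedding_coe_real.isClosed_range.isOpen_compl

theorem isOpen_overTunnelComplement : IsOpen {p | OverTunnelComplement p} := by
  have h : {p | OverTunnelComplement p} = {p : (ℝ × ℝ) × I | p.1 ∈ latticeᶜ} ∩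
      ({p | p.2 ∈ ({0} : Set I)ᶜ} ∩ ({p | p.2 ∈ ({1} : Set I)ᶜ} ∪
        {p | p.1.1 ∈ {x : ℝ | ∀ a : ℤ, x ≠ a}})) := by
    ext p
    simp only [OverTunnelComplement, Set.mem_ofPred_eq, Set.mem_inter_iff, Set.mem_union,
      Set.mem_compl_iff, Set.mem_singleton_iff, imp_iff_not_or]
  rw [h]
  refine IsOpen.inter (isClosed_lattice.isOpen_compl.preimage continuous_fst) (IsOpen.inter
    (isClosed_singleton.isOpen_compl.preimage continuous_snd) (IsOpen.union
      (isClosed_singleton.isOpen_compl.preimage continuous_snd) (isOpen_not_int.preimage ?_)))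
  fun_prop

theorem isOpen_tunnelComplement (s : OnePoint ℚ) :
    IsOpen {z : LinkSphere s | z ∉ link s ∧ z ∉ lowerTunnel s} := by
  rw [← isQuotientMap_quot_mk.isOpen_preimage]
  convert isOpen_overTunnelComplement
  ext p
  exact mk_mem_iff s p

/-- Continuity on an open part of the sphere can be checked on `ℝ² × [0,1]`. -/
theorem continuousOn_of_comp_mk {s : OnePoint ℚ} {Z : Type*} [TopologicalSpace Z]
    {f : LinkSphere s → Z} {O : Set (LinkSphere s)} (hO : IsOpen O)
    (h : ContinuousOn (fun p => f (Quot.mk _ p)) {p | Quot.mk _ p ∈ O}) : ContinuousOn f O :=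
  (isQuotientMap_quot_mk.continuousOn_isOpen_iff hO).2 h

/-! ### Maps induced by affine maps which preserve the vertical direction -/

/-- The affine map `(x, y) ↦ (x + a, y + e x + b)`. -/
def shear (e a b : ℤ) (x : ℝ × ℝ) : ℝ × ℝ := (x.1 + a, x.2 + e * x.1 + b)

theorem continuous_shear (e a b : ℤ) : Continuous (shear e a b) := by
  unfold shear
  fun_prop

theorem shear_mem_lattice_iff (e a b : ℤ) (x : ℝ × ℝ) : shear e a b x ∈ lattice ↔ x ∈ lattice := by
  constructor
  · rintro ⟨c, d, h⟩
    simp only [shear, Prod.mk.injEq] at h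
    have h1 : x.1 = ((c - a : ℤ) : ℝ) := by push_cast; linarith [h.1]
    refine ⟨c - a, d - e * (c - a) - b, Prod.ext h1 ?_⟩
    have h2 := h.2
    rw [h1] at h2
    push_cast at h2 ⊢
    linarith
  · rintro ⟨c, d, rfl⟩
    exact ⟨c + a, d + e * c + b, by simp [shear]⟩

theorem OverTunnelComplement.shear {p : (ℝ × ℝ) × I} (h : OverTunnelComplement p) (e a b : ℤ) :
    OverTunnelComplement (Heckoid.shear e a b p.1, p.2) := by
  refine ⟨fun h' => h.1 ((shear_mem_lattice_iff e a b p.1).1 h'), h.2.1, fun ht k hk => ?_⟩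
  refine h.2.2 ht (k - a) ?_
  simp only [Heckoid.shear] at hk
  push_cast
  linarith

open Classical in
/-- The map of spheres induced by an affine map; the level `0` is mapped to a point. -/
def shearSphere (s r : OnePoint ℚ) (e a b : ℤ) : LinkSphere s → LinkSphere r :=
  -- On level `0` lines of slope `s` are collapsed in the source and lines of slope `r` in the
  -- target, so the affine map does not descend there in general. The value chosen is irrelevant,
  -- since the tunnel is removed.
  Quot.lift (fun p => if p.2 = 0 then Quot.mk _ ((0, 0), 0) else
    Quot.mk _ (shear e a b p.1, p.2)) (by
    rintro _ _ (⟨x, t, c, d⟩ | ⟨x, c⟩ | ⟨x, c⟩)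
    · simp only
      congr 1
      have := Quot.sound (GlueRel.rotate (s := r) (shear e a b x) t (c + a) (d + e * c + b))
      rw [this]
      congr 1
      ext <;> simp [shear] <;> ring
    · simp only
      congr 1
      have := Quot.sound (GlueRel.upper (s := r) (shear e a b x) c)
      rw [this]
      congr 1
      rw [slopeDir_infty]
      ext <;> (simp [shear]; try ring)
    · simp)

theorem shearSphere_mk (s r : OnePoint ℚ) (e a b : ℤ) {p : (ℝ × ℝ) × I}
    (h : OverTunnelComplement p) :
    shearSphere s r e a b (Quot.mk _ p) = Quot.mk _ (shear e a b p.1, p.2) := by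
  change (if p.2 = 0 then _ else _) = _
  rw [if_neg h.2.1]

theorem continuousOn_shearSphere (s r : OnePoint ℚ) (e a b : ℤ) :
    ContinuousOn (shearSphere s r e a b) {z | z ∉ link s ∧ z ∉ lowerTunnel s} := by
  refine continuousOn_of_comp_mk (isOpen_tunnelComplement s) ?_
  have : Continuous fun p : (ℝ × ℝ) × I =>
      (Quot.mk _ (shear e a b p.1, p.2) : LinkSphere r) :=
    continuous_quot_mk.comp
      (((continuous_shear e a b).comp continuous_fst).prodMk continuous_snd)
  exact this.continuousOn.congr fun p hp => shearSphere_mk s r e a b ((mk_mem_iff s p).1 hp)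

/-- The map of complements induced by the affine map `(x, y) ↦ (x + a, y + e x + b)`. -/
def tunnelMap (s r : OnePoint ℚ) (e a b : ℤ) : C(TunnelComplement s, TunnelComplement r) where
  toFun z := ⟨shearSphere s r e a b z.1, by
    obtain ⟨p, h, rfl⟩ := exists_tcMk s z
    rw [tcMk, shearSphere_mk _ _ _ _ _ h]
    exact (mk_mem_iff r _).2 (h.shear e a b)⟩
  continuous_toFun := by
    refine Continuous.subtype_mk ?_ _
    exact (continuousOn_shearSphere s r e a b).comp_continuous continuous_subtype_val fun z => z.2

theorem tunnelMap_tcMk (s r : OnePoint ℚ) (e a b : ℤ) (p : (ℝ × ℝ) × I)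
    (h : OverTunnelComplement p) :
    tunnelMap s r e a b (tcMk s p h) = tcMk r (shear e a b p.1, p.2) (h.shear e a b) :=
  Subtype.ext (shearSphere_mk s r e a b h)

theorem tunnelMap_tunnelMap (s r q : OnePoint ℚ) (e a b e' a' b' : ℤ) (z : TunnelComplement s) :
    tunnelMap r q e' a' b' (tunnelMap s r e a b z) =
      tunnelMap s q (e + e') (a + a') (b + e' * a + b') z := by
  obtain ⟨p, h, rfl⟩ := exists_tcMk s z
  simp only [tunnelMap_tcMk]
  refine Subtype.ext (congrArg (Quot.mk _) ?_)
  ext <;> simp [shear] <;> ring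

theorem tunnelMap_zero (s : OnePoint ℚ) (z : TunnelComplement s) :
    tunnelMap s s 0 0 0 z = z := by
  obtain ⟨p, h, rfl⟩ := exists_tcMk s z
  rw [tunnelMap_tcMk]
  refine Subtype.ext (congrArg (Quot.mk _) ?_)
  ext <;> simp [shear]

theorem overTunnelComplement_mid (x : PuncturedPlane) : OverTunnelComplement (x.1, midLevel) := by
  refine ⟨x.2, fun h => ?_, fun h => ?_⟩
  · have := congrArg Subtype.val h
    norm_num [midLevel] at this
  · have := congrArg Subtype.val h
    norm_num [midLevel] at this

theorem bridge_eq_tcMk (s : OnePoint ℚ) (x : PuncturedPlane) :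
    bridge s x = tcMk s (x.1, midLevel) (overTunnelComplement_mid x) := rfl

/-- The affine map on the punctured plane. -/
def planeShear (e a b : ℤ) : C(PuncturedPlane, PuncturedPlane) where
  toFun x := ⟨shear e a b x.1, fun h => x.2 ((shear_mem_lattice_iff e a b x.1).1 h)⟩
  continuous_toFun := ((continuous_shear e a b).comp continuous_subtype_val).subtype_mk _

theorem tunnelMap_bridge (s r : OnePoint ℚ) (e a b : ℤ) (x : PuncturedPlane) :
    tunnelMap s r e a b (bridge s x) = bridge r (planeShear e a b x) := by
  rw [bridge_eq_tcMk, tunnelMap_tcMk]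
  rfl

/-- The symmetry induced by the translation by `(a, b)`. -/
def translation (s : OnePoint ℚ) (a b : ℤ) : TunnelComplement s ≃ₜ TunnelComplement s where
  toFun := tunnelMap s s 0 a b
  invFun := tunnelMap s s 0 (-a) (-b)
  left_inv z := by rw [tunnelMap_tunnelMap]; simp [tunnelMap_zero]
  right_inv z := by rw [tunnelMap_tunnelMap]; simp [tunnelMap_zero]
  continuous_toFun := (tunnelMap s s 0 a b).continuous
  continuous_invFun := (tunnelMap s s 0 (-a) (-b)).continuous

theorem translation_apply (s : OnePoint ℚ) (a b : ℤ) (z : TunnelComplement s) :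
    translation s a b z = tunnelMap s s 0 a b z := rfl

theorem isTranslation_translation (s : OnePoint ℚ) (a b : ℤ) :
    IsTranslation s (translation s a b) a b := by
  intro z
  obtain ⟨p, h, rfl⟩ := exists_tcMk s z
  rw [translation_apply, tunnelMap_tcMk]
  refine congrArg (Quot.mk _) ?_
  ext <;> simp [shear]

theorem IsTranslation.eq_translation {s : OnePoint ℚ} {φ : TunnelComplement s ≃ₜ TunnelComplement s}
    {a b : ℤ} (h : IsTranslation s φ a b) : φ = translation s a b := by
  ext z
  rw [h z, isTranslation_translation s a b z]

theorem translation_mul (s : OnePoint ℚ) (a b c d : ℤ) :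
    translation s a b * translation s c d = translation s (a + c) (b + d) := by
  ext z
  change (tunnelMap s s 0 a b (tunnelMap s s 0 c d z)).1 = (tunnelMap s s 0 _ _ z).1
  rw [tunnelMap_tunnelMap]
  simp [add_comm]

/-- A translation by an even vector is the composition of two `π`-rotations, about the origin and
about `(a, b)`. -/
theorem translation_two (s : OnePoint ℚ) (a b : ℤ) : translation s (2 * a) (2 * b) = 1 := by
  ext z
  obtain ⟨p, h, rfl⟩ := exists_tcMk s z
  rw [translation_apply, tunnelMap_tcMk]
  change (Quot.mk _ _ : LinkSphere s) = Quot.mk _ p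
  rw [Quot.sound (GlueRel.rotate (s := s) p.1 p.2 0 0),
    Quot.sound (GlueRel.rotate (s := s) (_, _) p.2 a b)]
  congr 1
  ext <;> simp [shear]

/-! ### Connectedness -/

instance : PathConnectedSpace PuncturedPlane := by
  have hc : lattice.Countable := by
    have : lattice = Set.range fun p : ℤ × ℤ => (((p.1 : ℝ), (p.2 : ℝ)) : ℝ × ℝ) := by
      ext x
      constructor
      · rintro ⟨a, b, rfl⟩
        exact ⟨(a, b), rfl⟩
      · rintro ⟨⟨a, b⟩, rfl⟩
        exact ⟨a, b, rfl⟩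
    rw [this]
    exact Set.countable_range _
  have := hc.isPathConnected_compl_of_one_lt_rank (E := ℝ × ℝ) (by
    rw [rank_prod', Module.rank_self]
    exact_mod_cast (by norm_num : (1 : ℕ) < 1 + 1))
  exact isPathConnected_iff_pathConnectedSpace.1 this

/-- Each point is joined to the middle level by a segment in the interval direction. That segment
avoids level `0`, and it meets level `1` only if the point itself lies there. -/
instance (s : OnePoint ℚ) : PathConnectedSpace (TunnelComplement s) := by
  have key : ∀ z, Joined (base s) z := by
    intro z
    obtain ⟨p, h, rfl⟩ := exists_tcMk s z
    have h1 : Joined (base s) (bridge s ⟨p.1, h.1⟩) :=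
      (PathConnectedSpace.joined planeBase ⟨p.1, h.1⟩).map (bridge s).continuous
    refine h1.trans ?_
    have hv : ∀ t : I, OverTunnelComplement (p.1, Set.Icc.convexComb midLevel p.2 t) := by
      intro t
      have h0 : (0 : ℝ) < p.2 := unitInterval.pos_iff_ne_zero.2 h.2.1
      refine ⟨h.1, fun ht => ?_, fun ht => h.2.2 ?_⟩
      · have := congrArg Subtype.val ht
        simp only [Set.Icc.coe_convexComb, midLevel, Set.Icc.coe_zero] at this
        rcases eq_or_ne t 0 with rfl | h3
        · norm_num at this
        · have h4 : (0 : ℝ) < t := unitInterval.pos_iff_ne_zero.2 h3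
          nlinarith [t.2.2, mul_pos h4 h0]
      · have := congrArg Subtype.val ht
        simp only [Set.Icc.coe_convexComb, midLevel, Set.Icc.coe_one] at this
        refine Subtype.ext ?_
        simp only [Set.Icc.coe_one]
        nlinarith [t.2.1, t.2.2, p.2.2.1, p.2.2.2]
    exact ⟨{ toFun := fun t => tcMk s (p.1, Set.Icc.convexComb midLevel p.2 t) (hv t)
             continuous_toFun := by
               refine Continuous.subtype_mk (continuous_quot_mk.comp ?_) _
               exact continuous_const.prodMk (Set.Icc.continuous_convexComb _ _)
             source' := by
               simp [bridge_eq_tcMk]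
             target' := by simp }⟩
  exact ⟨⟨base s⟩, fun x y => (key x).symm.trans (key y)⟩

end Heckoid

end

open scoped unitInterval

noncomputable section

namespace Heckoid

open Filter Topology

variable {G : Type*} [Group G]

/-! ### Vertical paths -/

/-- The region between the middle level and the upper level, over a vertical line. -/
abbrev upperStrip : Set (ℝ × ℝ) := {q | q.2 ∈ Set.Icc (1 / 2 : ℝ) 1}

theorem convex_upperStrip : Convex ℝ upperStrip :=
  (convex_Icc (1 / 2 : ℝ) 1).is_linear_preimage (IsLinearMap.mk (fun _ _ => rfl) fun _ _ => rfl)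

instance : ContractibleSpace upperStrip :=
  convex_upperStrip.contractibleSpace ⟨(0, 1), by norm_num⟩

/-- The map of the upper strip to the complement of link and tunnel. -/
def upperMap (s : OnePoint ℚ) (x : ℝ) (hx : ∀ a : ℤ, x ≠ a) : C(upperStrip, TunnelComplement s) where
  toFun q := tcMk s ((x, q.1.1), ⟨q.1.2, by linarith [q.2.1], q.2.2⟩)
    ⟨fst_ne_of_vert hx, fun h => by
      have := congrArg Subtype.val h
      have h2 := q.2.1
      simp only [Set.Icc.coe_zero] at this
      linarith, fun _ => hx⟩
  continuous_toFun := by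
    refine Continuous.subtype_mk (continuous_quot_mk.comp ?_) _
    fun_prop

/-- The transport is trivial along vertical loops. -/
theorem val_vertical_loop (s : OnePoint ℚ) (c : PathHom (TunnelComplement s) G) {p q : PuncturedPlane}
    (γ : Path p q) (hx : ∀ a : ℤ, p.1.1 ≠ a) (h : ∀ t, (γ t).1.1 = p.1.1)
    (k : ℤ) (hk : q.1.2 = p.1.2 + 2 * k) : c.val (γ.map (bridge s).continuous) = 1 := by
  set d := c.pullback (upperMap s p.1.1 hx) with hd
  have half : (1 / 2 : ℝ) ∈ Set.Icc (1 / 2 : ℝ) 1 := by norm_num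
  have one : (1 : ℝ) ∈ Set.Icc (1 / 2 : ℝ) 1 := by norm_num
  let γ' : Path (⟨(p.1.2, 1 / 2), half⟩ : upperStrip) ⟨(q.1.2, 1 / 2), half⟩ :=
    { toFun := fun t => ⟨((γ t).1.2, 1 / 2), half⟩
      continuous_toFun := by fun_prop
      source' := by simp
      target' := by simp }
  have h1 : c.val (γ.map (bridge s).continuous) = d.val γ' := by
    refine c.val_congr _ _ fun t => Subtype.ext (congrArg (Quot.mk _) ?_)
    exact Prod.ext (Prod.ext (h t) rfl) rfl
  -- The loop is pushed up to level `1`, where vertical lines are collapsed and it becomes constant.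
  -- The two sides of the resulting rectangle differ by the translation by `(0, 2k)` and are
  -- therefore the same path in the quotient.
  let up : ∀ y : ℝ, Path (⟨(y, 1 / 2), half⟩ : upperStrip) ⟨(y, 1), one⟩ := fun y =>
    { toFun := fun t => ⟨(y, 1 / 2 + t * (1 / 2)), by
        constructor <;> linarith [t.2.1, t.2.2]⟩
      continuous_toFun := by fun_prop
      source' := by simp
      target' := by norm_num }
  let across : Path (⟨(p.1.2, 1), one⟩ : upperStrip) ⟨(q.1.2, 1), one⟩ :=
    { toFun := fun t => ⟨((γ t).1.2, 1), one⟩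
      continuous_toFun := by fun_prop
      source' := by simp
      target' := by simp }
  have h2 : d.val across = 1 := by
    refine c.val_const _ fun t => Subtype.ext ?_
    have := Quot.sound (GlueRel.upper (s := s) (p.1.1, p.1.2) ((γ t).1.2 - p.1.2))
    change (Quot.mk _ _ : LinkSphere s) = Quot.mk _ _
    refine Eq.trans (congrArg (Quot.mk _) ?_) this.symm
    rw [slopeDir_infty]
    have e : p.1.2 + ((γ t).1.2 - p.1.2) * 1 = (γ t).1.2 := by ring
    exact Prod.ext (Prod.ext (by simp) e.symm) rfl
  have h3 : d.val (up p.1.2) = d.val (up q.1.2) := by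
    refine c.val_congr _ _ fun t => Subtype.ext ?_
    change (Quot.mk _ _ : LinkSphere s) = Quot.mk _ _
    rw [Quot.sound (GlueRel.rotate (s := s) (_, _) _ 0 0),
      Quot.sound (GlueRel.rotate (s := s) (_, _) _ 0 k)]
    congr 1
    ext
    · simp
    · simp [up, hk, add_comm]
    · simp [up]
  have h4 : d.val ((up p.1.2).trans across) = d.val (γ'.trans (up q.1.2)) := by
    rw [d.val_eq_endVal, d.val_eq_endVal]
  rw [d.val_trans, d.val_trans, h2, one_mul, h3] at h4
  rw [h1]
  exact (mul_eq_left.1 h4.symm)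

/-! ### The region near the lower tunnel -/

theorem exists_basis (s : OnePoint ℚ) : ∃ v₁ v₂ w₁ w₂ : ℤ,
    slopeDir s = ((w₁ : ℝ), (w₂ : ℝ)) ∧ v₁ * w₂ - v₂ * w₁ = 1 := by
  induction s using OnePoint.rec with
  | infty => exact ⟨1, 0, 0, 1, by simp [slopeDir_infty], by norm_num⟩
  | coe q =>
    have h := Rat.isCoprime_num_den q
    obtain ⟨a, b, hab⟩ := h
    exact ⟨a, -b, q.den, q.num, by simp [slopeDir, fareyVec], by linarith⟩

/-- The linear form which is constant on the lines of slope `s`. -/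
def slopeForm (s : OnePoint ℚ) (x : ℝ × ℝ) : ℝ := x.1 * (slopeDir s).2 - x.2 * (slopeDir s).1

theorem continuous_slopeForm (s : OnePoint ℚ) : Continuous (slopeForm s) := by
  unfold slopeForm
  fun_prop

theorem slopeForm_add (s : OnePoint ℚ) (x : ℝ × ℝ) (c : ℝ) :
    slopeForm s (x + c • slopeDir s) = slopeForm s x := by
  simp [slopeForm]; ring

theorem slopeForm_int (s : OnePoint ℚ) (a b : ℤ) :
    ∃ k : ℤ, slopeForm s ((a : ℝ), (b : ℝ)) = k := by
  obtain ⟨v₁, v₂, w₁, w₂, hw, -⟩ := exists_basis s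
  exact ⟨a * w₂ - b * w₁, by simp [slopeForm, hw]⟩

theorem slopeForm_rotate (s : OnePoint ℚ) (x : ℝ × ℝ) (a b : ℝ) :
    slopeForm s (2 * a - x.1, 2 * b - x.2) = 2 * slopeForm s (a, b) - slopeForm s x := by
  simp [slopeForm]; ring

theorem ne_int_rotate {x : ℝ} (k : ℤ) : (∀ a : ℤ, 2 * (k : ℝ) - x ≠ a) ↔ ∀ a : ℤ, x ≠ a := by
  constructor
  · intro h a ha
    exact h (2 * k - a) (by push_cast; linarith)
  · intro h a ha
    exact h (2 * k - a) (by push_cast; linarith)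

/-- The points of `ℝ² × [0,1]` below the upper level whose line of slope `s` misses the lattice. -/
def OverLowerRegion (s : OnePoint ℚ) (p : (ℝ × ℝ) × I) : Prop :=
  p.2 ≠ 1 ∧ ∀ k : ℤ, slopeForm s p.1 ≠ k

theorem overLowerRegion_congr (s : OnePoint ℚ) {p q : (ℝ × ℝ) × I} (h : GlueRel s p q) :
    OverLowerRegion s p ↔ OverLowerRegion s q := by
  rcases h with ⟨x, t, a, b⟩ | ⟨x, c⟩ | ⟨x, c⟩
  · obtain ⟨k, hk⟩ := slopeForm_int s a b
    simp only [OverLowerRegion, slopeForm_rotate, hk, ne_int_rotate]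
  · simp [OverLowerRegion]
  · simp only [OverLowerRegion, slopeForm_add]

/-- The part of the sphere below the upper level formed by the lines which miss the link. -/
def lowerRegion (s : OnePoint ℚ) : Set (LinkSphere s) :=
  {z | Quot.lift (OverLowerRegion s) (fun _ _ h => propext (overLowerRegion_congr s h)) z}

theorem isOpen_lowerRegion (s : OnePoint ℚ) : IsOpen (lowerRegion s) := by
  rw [← isQuotientMap_quot_mk.isOpen_preimage]
  change IsOpen ({p : (ℝ × ℝ) × I | p.2 ∈ ({1} : Set I)ᶜ} ∩
    {p : (ℝ × ℝ) × I | slopeForm s p.1 ∈ {x : ℝ | ∀ k : ℤ, x ≠ k}})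
  exact (isClosed_singleton.isOpen_compl.preimage continuous_snd).inter
    (isOpen_not_int.preimage ((continuous_slopeForm s).comp continuous_fst))

theorem not_mem_lattice_of_slopeForm {s : OnePoint ℚ} {x : ℝ × ℝ}
    (h : ∀ k : ℤ, slopeForm s x ≠ k) : x ∉ lattice := by
  rintro ⟨a, b, rfl⟩
  obtain ⟨k, hk⟩ := slopeForm_int s a b
  exact h k hk

/-- If the form takes the integral value `k` on a line of slope `s`, the line contains the lattice
point `k • v`, so on level `0` its collapsed image belongs to the link. -/
theorem mem_lowerRegion_of_mem_lowerTunnel (s : OnePoint ℚ) (z : LinkSphere s) (h1 : z ∉ link s)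
    (h2 : z ∈ lowerTunnel s) : z ∈ lowerRegion s := by
  induction z using Quot.ind with | mk p =>
  rw [mem_lowerTunnel_iff] at h2
  refine ⟨by simp [h2], fun k hk => h1 ?_⟩
  obtain ⟨v₁, v₂, w₁, w₂, hw, hdet⟩ := exists_basis s
  have hdet' : (v₁ : ℝ) * w₂ - v₂ * w₁ = 1 := by exact_mod_cast hdet
  have hk' : p.1.1 * w₂ - p.1.2 * w₁ = k := by simpa [slopeForm, hw] using hk
  -- The coefficient is minus the complementary coordinate of the point, so the slide ends at `k •
  -- v`.
  have := Quot.sound (GlueRel.lower (s := s) p.1 (-(v₁ * p.1.2 - v₂ * p.1.1)))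
  refine ⟨((k * v₁ : ℤ), (k * v₂ : ℤ)), 0, ⟨k * v₁, k * v₂, rfl⟩, ?_⟩
  have hp : p = (p.1, 0) := Prod.ext rfl h2
  rw [hp, this]
  congr 1
  rw [hw]
  refine Prod.ext (Prod.ext ?_ ?_) rfl
  · simp only [Prod.fst_add, Prod.smul_fst, smul_eq_mul]
    push_cast
    linear_combination (v₁ : ℝ) * hk' - p.1.1 * hdet'
  · simp only [Prod.snd_add, Prod.smul_snd, smul_eq_mul]
    push_cast
    linear_combination (v₂ : ℝ) * hk' - p.1.2 * hdet'

end Heckoid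

end

open scoped unitInterval

noncomputable section

namespace Heckoid

open Filter Topology

variable {G : Type*} [Group G]

/-! ### Coordinates near the lower tunnel -/

/-- A family of strip coordinates: the quotient of the plane by the rotations, off the lines of slope
`s` through the lattice, is an annulus. -/
structure SlopeBasis (s : OnePoint ℚ) where
  v₁ : ℤ
  v₂ : ℤ
  w₁ : ℤ
  w₂ : ℤ
  hw : slopeDir s = ((w₁ : ℝ), (w₂ : ℝ))
  det : v₁ * w₂ - v₂ * w₁ = 1

namespace SlopeBasis

variable {s : OnePoint ℚ} (B : SlopeBasis s)

/-- The complementary linear form. -/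
def coForm (x : ℝ × ℝ) : ℝ := B.v₁ * x.2 - B.v₂ * x.1

/-- The point with given coordinates. -/
def point (f g : ℝ) : ℝ × ℝ := (f * B.v₁ + g * B.w₁, f * B.v₂ + g * B.w₂)

theorem detR : (B.v₁ : ℝ) * B.w₂ - B.v₂ * B.w₁ = 1 := by exact_mod_cast B.det

theorem slopeForm_eq (x : ℝ × ℝ) : slopeForm s x = x.1 * B.w₂ - x.2 * B.w₁ := by
  simp [slopeForm, B.hw]

theorem slopeForm_point (f g : ℝ) : slopeForm s (B.point f g) = f := by
  rw [slopeForm_eq]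
  simp only [point]
  linear_combination f * B.detR

theorem point_forms (x : ℝ × ℝ) : B.point (slopeForm s x) (B.coForm x) = x := by
  rw [slopeForm_eq]
  ext
  · simp only [point, coForm]
    linear_combination x.1 * B.detR
  · simp only [point, coForm]
    linear_combination x.2 * B.detR

theorem mk_point_rotate (f g : ℝ) (k l : ℤ) (t : I) :
    (Quot.mk _ (B.point f g, t) : LinkSphere s) =
      Quot.mk _ (B.point (2 * k - f) (2 * l - g), t) := by
  rw [Quot.sound (GlueRel.rotate (s := s) (B.point f g) t (k * B.v₁ + l * B.w₁)
    (k * B.v₂ + l * B.w₂))]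
  congr 1
  refine Prod.ext (Prod.ext ?_ ?_) rfl
  · simp only [point]; push_cast; ring
  · simp only [point]; push_cast; ring

theorem mk_point_translate (f g : ℝ) (k l : ℤ) (t : I) :
    (Quot.mk _ (B.point f g, t) : LinkSphere s) =
      Quot.mk _ (B.point (f + 2 * k) (g + 2 * l), t) := by
  rw [B.mk_point_rotate f g 0 0, B.mk_point_rotate _ _ k l]
  congr 3 <;> push_cast <;> ring

/-- The region `0 < f < 1`, `0 < t < 1`. -/
abbrev strip : Set (ℝ × ℝ × ℝ) := {q | q.1 ∈ Set.Ioo (0 : ℝ) 1 ∧ q.2.2 ∈ Set.Ioo (0 : ℝ) 1}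

theorem convex_strip : Convex ℝ strip := by
  refine Convex.inter (s := {q : ℝ × ℝ × ℝ | q.1 ∈ Set.Ioo (0 : ℝ) 1})
    (t := {q : ℝ × ℝ × ℝ | q.2.2 ∈ Set.Ioo (0 : ℝ) 1}) ?_ ?_
  · exact (convex_Ioo (0 : ℝ) 1).is_linear_preimage
      (IsLinearMap.mk (fun _ _ => rfl) fun _ _ => rfl)
  · exact (convex_Ioo (0 : ℝ) 1).is_linear_preimage
      (IsLinearMap.mk (fun _ _ => rfl) fun _ _ => rfl)

instance : ContractibleSpace strip :=
  convex_strip.contractibleSpace ⟨(1 / 2, 0, 1 / 2), by norm_num, by norm_num⟩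

theorem ne_int_of_mem_Ioo {x : ℝ} (h : x ∈ Set.Ioo (0 : ℝ) 1) (k : ℤ) : x ≠ k := by
  rintro rfl
  have h1 : 0 < k := by exact_mod_cast h.1
  have h2 : k < 1 := by exact_mod_cast h.2
  omega

/-- The covering map from the strip. -/
def stripMap : C(strip, TunnelComplement s) where
  toFun q := tcMk s (B.point q.1.1 q.1.2.1, ⟨q.1.2.2, q.2.2.1.le, q.2.2.2.le⟩)
    ⟨not_mem_lattice_of_slopeForm (s := s) fun k => by
        rw [slopeForm_point]; exact ne_int_of_mem_Ioo q.2.1 k,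
      fun h => q.2.2.1.ne' (congrArg Subtype.val h),
      fun h => absurd (congrArg Subtype.val h) q.2.2.2.ne⟩
  continuous_toFun := by
    refine Continuous.subtype_mk (continuous_quot_mk.comp ?_) _
    unfold point
    fun_prop

open Classical in
/-- The first coordinate in the annulus. -/
def foldF (x : ℝ × ℝ) : ℝ :=
  if Even ⌊slopeForm s x⌋ then Int.fract (slopeForm s x) else 1 - Int.fract (slopeForm s x)

open Classical in
/-- The second coordinate in the annulus. -/
def foldG (x : ℝ × ℝ) : AddCircle (2 : ℝ) :=
  if Even ⌊slopeForm s x⌋ then (B.coForm x : AddCircle (2 : ℝ)) else -(B.coForm x : AddCircle (2 : ℝ))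

/-- The extra `-1`, due to `x` not being integral, makes a rotation exchange the strips of even and
of odd index. This is why the folding distinguishes parities. -/
theorem floor_rotate {x : ℝ} (h : ∀ k : ℤ, x ≠ k) (k : ℤ) : ⌊2 * (k : ℝ) - x⌋ = 2 * k - ⌊x⌋ - 1 := by
  rw [Int.floor_eq_iff]
  have h1 := Int.floor_le x
  have h2 := Int.lt_floor_add_one x
  have h3 : (⌊x⌋ : ℝ) < x := lt_of_le_of_ne h1 (h _).symm
  push_cast
  constructor <;> linarith

theorem coe_two_mul (k : ℤ) (g : ℝ) : ((2 * (k : ℝ) - g : ℝ) : AddCircle (2 : ℝ)) = -(g : AddCircle (2 : ℝ)) := by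
  have : ((2 * (k : ℝ) : ℝ) : AddCircle (2 : ℝ)) = 0 := by
    rw [AddCircle.coe_eq_zero_iff]
    exact ⟨k, by simp [mul_comm]⟩
  rw [AddCircle.coe_sub, this, zero_sub]

theorem coForm_rotate (x : ℝ × ℝ) (a b : ℤ) :
    B.coForm (2 * (a : ℝ) - x.1, 2 * (b : ℝ) - x.2) = 2 * ((B.v₁ * b - B.v₂ * a : ℤ) : ℝ) - B.coForm x := by
  simp only [coForm]; push_cast; ring

theorem even_rotate (n k : ℤ) : Even (2 * k - n - 1) ↔ ¬ Even n := by
  rw [Int.even_sub_one, Int.even_sub]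
  simp

theorem foldF_rotate (x : ℝ × ℝ) (h : ∀ k : ℤ, slopeForm s x ≠ k) (a b : ℤ) :
    foldF (s := s) (2 * (a : ℝ) - x.1, 2 * (b : ℝ) - x.2) = foldF (s := s) x := by
  obtain ⟨k, hk⟩ := slopeForm_int s a b
  rw [foldF, foldF, slopeForm_rotate, hk, Int.fract, floor_rotate h, Int.fract]
  simp only [even_rotate]
  split_ifs <;> first | contradiction | (push_cast; ring)

theorem foldG_rotate (x : ℝ × ℝ) (h : ∀ k : ℤ, slopeForm s x ≠ k) (a b : ℤ) :
    B.foldG (2 * (a : ℝ) - x.1, 2 * (b : ℝ) - x.2) = B.foldG x := by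
  obtain ⟨k, hk⟩ := slopeForm_int s a b
  rw [foldG, foldG, slopeForm_rotate, hk, floor_rotate h, coForm_rotate, coe_two_mul]
  simp only [even_rotate]
  split_ifs <;> first | contradiction | simp

theorem eventually_floor_eq {x : ℝ} (h : ∀ k : ℤ, x ≠ k) : ∀ᶠ y in 𝓝 x, ⌊y⌋ = ⌊x⌋ := by
  have h3 : (⌊x⌋ : ℝ) < x := lt_of_le_of_ne (Int.floor_le x) (h _).symm
  filter_upwards [Ioo_mem_nhds h3 (Int.lt_floor_add_one x)] with y hy
  exact Int.floor_eq_iff.2 ⟨hy.1.le, hy.2⟩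

theorem continuousAt_fold (x : ℝ × ℝ) (h : ∀ k : ℤ, slopeForm s x ≠ k) :
    ContinuousAt (fun x => (foldF (s := s) x, B.foldG x)) x := by
  have hev := (continuous_slopeForm s).continuousAt.eventually (eventually_floor_eq h)
  have hc : Continuous fun y => (B.coForm y : AddCircle (2 : ℝ)) :=
    (AddCircle.continuous_mk' 2).comp (by unfold coForm; fun_prop)
  have hf := continuous_slopeForm s
  by_cases he : Even ⌊slopeForm s x⌋
  · have : ContinuousAt (fun y => (slopeForm s y - ⌊slopeForm s x⌋, (B.coForm y : AddCircle (2 : ℝ)))) x := by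
      fun_prop
    refine this.congr ?_
    filter_upwards [hev] with y hy
    simp [foldF, foldG, hy, he, Int.fract]
  · have : ContinuousAt (fun y => (1 - (slopeForm s y - ⌊slopeForm s x⌋), -(B.coForm y : AddCircle (2 : ℝ)))) x := by
      fun_prop
    refine this.congr ?_
    filter_upwards [hev] with y hy
    simp only [foldF, foldG, hy, he, Int.fract, if_false]

theorem foldF_mem (x : ℝ × ℝ) (h : ∀ k : ℤ, slopeForm s x ≠ k) :
    foldF (s := s) x ∈ Set.Ioo (0 : ℝ) 1 := by
  have h1 := Int.fract_lt_one (slopeForm s x)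
  have h2 : 0 < Int.fract (slopeForm s x) := Int.fract_pos.2 (h _)
  rw [foldF]
  split_ifs <;> constructor <;> linarith

theorem exists_of_coe_eq {g g' : ℝ} (h : (g : AddCircle (2 : ℝ)) = g') : ∃ l : ℤ, g = g' + 2 * l := by
  rw [← sub_eq_zero, ← AddCircle.coe_sub, AddCircle.coe_eq_zero_iff] at h
  obtain ⟨l, hl⟩ := h
  exact ⟨l, by rw [zsmul_eq_mul] at hl; linarith⟩

/-- Folding does not change the point of the sphere: a strip of even index is brought to the
standard strip by an even translation, one of odd index by a rotation. -/
theorem mk_fold (x : ℝ × ℝ) (t : I) (g : ℝ) (hg : (g : AddCircle (2 : ℝ)) = B.foldG x) :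
    (Quot.mk _ (B.point (foldF (s := s) x) g, t) : LinkSphere s) = Quot.mk _ (x, t) := by
  conv_rhs => rw [← B.point_forms x]
  rw [foldG] at hg
  rw [foldF]
  split_ifs at hg ⊢ with h
  · obtain ⟨l, rfl⟩ := exists_of_coe_eq hg
    obtain ⟨k, hk⟩ := h
    rw [B.mk_point_translate (slopeForm s x) _ (-k) l, Int.fract, hk]
    congr 3
    push_cast; ring
  · rw [← AddCircle.coe_neg] at hg
    obtain ⟨l, rfl⟩ := exists_of_coe_eq hg
    obtain ⟨k, hk⟩ := Int.not_even_iff_odd.1 h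
    rw [B.mk_point_rotate (slopeForm s x) _ (k + 1) l, Int.fract, hk]
    congr 3 <;> push_cast <;> ring

/-- The points of `ℝ² × [0,1]` strictly between the lower and the upper level whose line of slope `s`
misses the lattice. -/
def OverAnnulus (s : OnePoint ℚ) (p : (ℝ × ℝ) × I) : Prop :=
  p.2 ≠ 0 ∧ OverLowerRegion s p

open Classical in
/-- The coordinates in the annulus, on the sphere. -/
def foldMap : LinkSphere s → ℝ × AddCircle (2 : ℝ) :=
  Quot.lift (fun p => if OverAnnulus s p then (foldF (s := s) p.1, B.foldG p.1) else (0, 0)) (by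
    rintro _ _ (⟨x, t, a, b⟩ | ⟨x, c⟩ | ⟨x, c⟩)
    · have h := overLowerRegion_congr s (GlueRel.rotate x t a b)
      by_cases h1 : OverAnnulus s (x, t)
      · rw [if_pos h1, if_pos ⟨h1.1, h.1 h1.2⟩, foldF_rotate x h1.2.2, foldG_rotate B x h1.2.2]
      · rw [if_neg h1, if_neg fun h2 => h1 ⟨h2.1, h.2 h2.2⟩]
    · simp [OverAnnulus, OverLowerRegion]
    · simp [OverAnnulus])

theorem foldMap_mk {p : (ℝ × ℝ) × I} (h : OverAnnulus s p) :
    B.foldMap (Quot.mk _ p) = (foldF (s := s) p.1, B.foldG p.1) :=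
  if_pos h

theorem continuousOn_foldMap :
    ContinuousOn B.foldMap ({z | level s z ∈ ({0} : Set I)ᶜ} ∩ lowerRegion s) := by
  refine continuousOn_of_comp_mk ((isClosed_singleton.isOpen_compl.preimage
    (continuous_level s)).inter (isOpen_lowerRegion s)) ?_
  have : ContinuousOn (fun p : (ℝ × ℝ) × I => (foldF (s := s) p.1, B.foldG p.1))
      {p | (Quot.mk _ p : LinkSphere s) ∈ {z | level s z ∈ ({0} : Set I)ᶜ} ∩ lowerRegion s} := by
    intro p hp
    exact ((B.continuousAt_fold p.1 hp.2.2).comp continuous_fst.continuousAt).continuousWithinAt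
  exact this.congr fun p hp => B.foldMap_mk hp

end SlopeBasis

open SlopeBasis in
/-- A transport which is trivial along the loops of slope `s` is a coboundary on the part of the
complement which is near the lower tunnel. -/
theorem exists_gauge_lowerRegion (s : OnePoint ℚ) (c : PathHom (TunnelComplement s) G)
    (hc : ∀ (y : ℝ × ℝ) (h : ∀ a : ℝ, y + a • ((2 : ℝ) • slopeDir s) ∉ lattice),
      c.val (slopeLoop s y h) = 1) :
    ∃ u : TunnelComplement s → G, ∀ {x y : TunnelComplement s} (γ : Path x y),
      (∀ t, (γ t).1 ∈ lowerRegion s) → c.val γ = u y * (u x)⁻¹ := by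
  obtain ⟨v₁, v₂, w₁, w₂, hw, hdet⟩ := exists_basis s
  let B : SlopeBasis s := ⟨v₁, v₂, w₁, w₂, hw, hdet⟩
  set d := c.pullback B.stripMap with hd
  have half : (1 / 2 : ℝ) ∈ Set.Ioo (0 : ℝ) 1 := by norm_num
  -- the transport is invariant under the deck transformation
  have hper : ∀ (f t : ℝ) (hf : f ∈ Set.Ioo (0 : ℝ) 1) (ht : t ∈ Set.Ioo (0 : ℝ) 1) (g : ℝ),
      d.endVal (⟨(f, g, t), hf, ht⟩ : strip) ⟨(f, g + 2, t), hf, ht⟩ = 1 := by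
    intro f t hf ht g
    -- The hypothesis speaks of loops on the middle level only, so the loop on level `t` is first
    -- moved there.
    let up : ∀ g : ℝ, Path (⟨(f, g, t), hf, ht⟩ : strip) ⟨(f, g, 1 / 2), hf, half⟩ := fun g =>
      { toFun := fun r => ⟨(f, g, AffineMap.lineMap t (1 / 2) (r : ℝ)), hf,
          (convex_Ioo (0 : ℝ) 1).lineMap_mem ht half r.2⟩
        continuous_toFun := by
          simp only [AffineMap.lineMap_apply]
          fun_prop
        source' := by simp
        target' := by simp }
    let loop : Path (⟨(f, g, 1 / 2), hf, half⟩ : strip) ⟨(f, g + 2, 1 / 2), hf, half⟩ :=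
      { toFun := fun r => ⟨(f, g + r * 2, 1 / 2), hf, half⟩
        continuous_toFun := by fun_prop
        source' := by simp
        target' := by simp }
    have h1 : d.val (up g) = d.val (up (g + 2)) := by
      refine c.val_congr _ _ fun r => Subtype.ext ?_
      have := B.mk_point_translate f g 0 1
        ⟨AffineMap.lineMap t (1 / 2) (r : ℝ), ((up g r).2.2.1).le, ((up g r).2.2.2).le⟩
      refine Eq.trans this (congrArg (Quot.mk _) (Prod.ext ?_ rfl))
      change B.point _ _ = B.point f (g + 2)
      congr 1 <;> simp
    have h2 : d.val loop = 1 := by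
      have hl : ∀ a : ℝ, B.point f g + a • ((2 : ℝ) • slopeDir s) ∉ lattice := by
        intro a
        refine not_mem_lattice_of_slopeForm (s := s) fun k => ?_
        rw [smul_smul, slopeForm_add, slopeForm_point]
        exact ne_int_of_mem_Ioo hf k
      rw [← hc (B.point f g) hl]
      refine c.val_congr _ _ fun r => Subtype.ext ?_
      change (Quot.mk _ _ : LinkSphere s) = Quot.mk _ _
      congr 1
      refine Prod.ext ?_ rfl
      change B.point f (g + r * 2) = B.point f g + (r : ℝ) • ((2 : ℝ) • slopeDir s)
      rw [B.hw]
      ext <;> simp [point] <;> ring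
    have h3 : d.val ((up g).trans loop) = 
        d.endVal ⟨(f, g + 2, t), hf, ht⟩ ⟨(f, g + 2, 1 / 2), hf, half⟩ * 
          d.endVal (⟨(f, g, t), hf, ht⟩ : strip) ⟨(f, g + 2, t), hf, ht⟩ := by
      rw [d.endVal_mul, d.val_eq_endVal]
    rw [d.val_trans, h2, one_mul, ← d.val_eq_endVal (up (g + 2)), h1] at h3
    exact (mul_eq_left.1 h3.symm)
  -- The gauge is the transport from this fixed point of the strip. It descends to the annulus
  -- because it is periodic in the angular coordinate.
  let ref : strip := ⟨(1 / 2, 0, 1 / 2), half, half⟩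
  have hper' : ∀ (f t : ℝ) (hf : f ∈ Set.Ioo (0 : ℝ) 1) (ht : t ∈ Set.Ioo (0 : ℝ) 1) (g g' : ℝ),
      (g : AddCircle (2 : ℝ)) = g' →
      d.endVal ref ⟨(f, g, t), hf, ht⟩ = d.endVal ref ⟨(f, g', t), hf, ht⟩ := by
    intro f t hf ht g g' hg
    obtain ⟨l, rfl⟩ := exists_of_coe_eq hg
    have hp : Function.Periodic (fun g : ℝ => d.endVal ref ⟨(f, g, t), hf, ht⟩) 2 := by
      intro g
      simp only
      rw [← d.endVal_mul ref ⟨(f, g, t), hf, ht⟩, hper f t hf ht, one_mul]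
    have := hp.int_mul l g'
    rw [mul_comm]
    exact this
  have hmem : ∀ z : TunnelComplement s, z.1 ∈ lowerRegion s →
      z.1 ∈ {z | level s z ∈ ({0} : Set I)ᶜ} ∩ lowerRegion s ∧ 
      (B.foldMap z.1).1 ∈ Set.Ioo (0 : ℝ) 1 ∧ (level s z.1 : ℝ) ∈ Set.Ioo (0 : ℝ) 1 := by
    intro z hz
    obtain ⟨p, h, rfl⟩ := exists_tcMk s z
    have ha : OverAnnulus s p := ⟨h.2.1, hz⟩
    refine ⟨⟨h.2.1, hz⟩, ?_, ?_, ?_⟩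
    · rw [tcMk, B.foldMap_mk ha]
      exact foldF_mem p.1 hz.2
    · exact unitInterval.pos_iff_ne_zero.2 h.2.1
    · exact unitInterval.lt_one_iff_ne_one.2 hz.1
  have hpt : ∀ (z : TunnelComplement s) (hz : z.1 ∈ lowerRegion s) (g : ℝ),
      (g : AddCircle (2 : ℝ)) = (B.foldMap z.1).2 →
      B.stripMap ⟨((B.foldMap z.1).1, g, (level s z.1 : ℝ)), (hmem z hz).2⟩ = z := by
    intro z hz g hg
    obtain ⟨p, h, rfl⟩ := exists_tcMk s z
    have ha : OverAnnulus s p := ⟨h.2.1, hz⟩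
    refine Subtype.ext ?_
    have e := B.foldMap_mk ha
    have := B.mk_fold p.1 p.2 g (by rw [hg, tcMk, e])
    change Quot.mk _ (B.point (B.foldMap (Quot.mk _ p)).1 g, _) = Quot.mk _ p
    rw [e]
    exact this
  -- This section of the circle need not be continuous: by `hper'` the gauge does not depend on the
  -- lift.
  choose lift hlift using fun q : AddCircle (2 : ℝ) => QuotientAddGroup.mk_surjective q
  classical
  refine ⟨fun z => if hz : z.1 ∈ lowerRegion s then
    d.endVal ref ⟨((B.foldMap z.1).1, lift (B.foldMap z.1).2, (level s z.1 : ℝ)), (hmem z hz).2⟩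
    else 1, ?_⟩
  intro x y γ hγ
  have hcont : Continuous fun t => B.foldMap (γ t).1 :=
    B.continuousOn_foldMap.comp_continuous (by fun_prop) fun t => (hmem _ (hγ t)).1
  -- Lifting the angle along the path gives a path in the contractible strip that projects to `γ`.
  have cov := AddCircle.isCoveringMap_coe (2 : ℝ)
  obtain ⟨Γ, hΓ, -⟩ := cov.exists_path_lifts ⟨fun t => (B.foldMap (γ t).1).2, by fun_prop⟩
    (lift (B.foldMap (γ 0).1).2) (hlift _).symm
  have hΓ' : ∀ t, (Γ t : AddCircle (2 : ℝ)) = (B.foldMap (γ t).1).2 := fun t => congrFun hΓ t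
  have hlc := continuous_level s
  let pt : I → strip := fun t =>
    ⟨((B.foldMap (γ t).1).1, Γ t, (level s (γ t).1 : ℝ)), (hmem _ (hγ t)).2⟩
  let γ' : Path (pt 0) (pt 1) := ⟨⟨pt, by fun_prop⟩, rfl, rfl⟩
  have hv : c.val γ = d.val γ' :=
    c.val_congr _ _ fun t => (hpt (γ t) (hγ t) (Γ t) (hΓ' t)).symm
  have hu : ∀ t, d.endVal ref ⟨((B.foldMap (γ t).1).1, lift (B.foldMap (γ t).1).2,
      (level s (γ t).1 : ℝ)), (hmem (γ t) (hγ t)).2⟩ = d.endVal ref (pt t) := fun t =>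
    hper' _ _ (hmem _ (hγ t)).2.1 (hmem _ (hγ t)).2.2 _ _ ((hlift _).trans (hΓ' t).symm)
  have h0 := hu 0
  have h1 := hu 1
  have hx : x.1 ∈ lowerRegion s := by simpa using hγ 0
  have hy : y.1 ∈ lowerRegion s := by simpa using hγ 1
  simp only [Path.source] at h0
  simp only [Path.target] at h1
  beta_reduce
  rw [dif_pos hx, dif_pos hy, h0, h1, hv, d.val_eq_endVal, ← d.endVal_mul ref (pt 0) (pt 1)]
  group

end Heckoid

end

open scoped unitInterval

noncomputable section

namespace Heckoid

open Filter Topology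

variable {G : Type*} [Group G]

/-! ### Transports on the link complement -/

theorem isOpenEmbedding_fillTunnel (s : OnePoint ℚ) : IsOpenEmbedding (fillTunnel s) := by
  have h1 : IsOpenEmbedding (Subtype.val : TunnelComplement s → LinkSphere s) :=
    (isOpen_tunnelComplement s).isOpenEmbedding_subtypeVal
  have h2 : IsEmbedding (Subtype.val : LinkComplement s → LinkSphere s) := .subtypeVal
  have h3 : IsEmbedding (fillTunnel s) := by
    refine IsEmbedding.of_comp (fillTunnel s).continuous h2.continuous ?_
    exact h1.isEmbedding
  refine ⟨h3, ?_⟩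
  have : Set.range (fillTunnel s) = Subtype.val ⁻¹'
      Set.range (Subtype.val : TunnelComplement s → LinkSphere s) := by
    ext z
    constructor
    · rintro ⟨y, rfl⟩
      exact ⟨y, rfl⟩
    · rintro ⟨y, hy⟩
      exact ⟨y, Subtype.ext hy⟩
  rw [this]
  exact h1.isOpen_range.preimage continuous_subtype_val

/-- A transport on the complement of link and tunnel which is trivial along the loops of slope `s`
extends to the link complement. -/
theorem exists_extension_linkComplement (s : OnePoint ℚ) (c : PathHom (TunnelComplement s) G)
    (hc : ∀ (y : ℝ × ℝ) (h : ∀ a : ℝ, y + a • ((2 : ℝ) • slopeDir s) ∉ lattice),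
      c.val (slopeLoop s y h) = 1) :
    ∃ d : PathHom (LinkComplement s) G, ∀ {x y : TunnelComplement s} (γ : Path x y),
      d.val (γ.map (fillTunnel s).continuous) = c.val γ := by
  obtain ⟨u, hu⟩ := exists_gauge_lowerRegion s c hc
  -- The extension lemma needs a transport that is literally trivial near the tunnel, not just a
  -- coboundary. Hence the gauge by `u⁻¹`, which is undone at the end with the value `1` on the
  -- tunnel, where `u` is not defined.
  obtain ⟨d, hd⟩ := exists_extension (isOpenEmbedding_fillTunnel s)
    (V := Subtype.val ⁻¹' lowerRegion s) (c.gauge fun x => (u x)⁻¹) (fun γ hγ => by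
      rw [PathHom.gauge_val, hu γ hγ]
      group) ((isOpen_lowerRegion s).preimage continuous_subtype_val) (fun x => by
      by_cases hx : x.1 ∈ lowerTunnel s
      · exact Or.inr (mem_lowerRegion_of_mem_lowerTunnel s x.1 x.2 hx)
      · exact Or.inl ⟨⟨x.1, x.2, hx⟩, rfl⟩)
  classical
  refine ⟨d.gauge fun z => if h : z.1 ∈ lowerTunnel s then 1 else u ⟨z.1, z.2, h⟩, ?_⟩
  intro x y γ
  rw [PathHom.gauge_val, hd, PathHom.gauge_val, dif_neg (show (fillTunnel s x).1 ∉ _ from x.2.2),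
    dif_neg (show (fillTunnel s y).1 ∉ _ from y.2.2)]
  change u y * ((u y)⁻¹ * c.val γ * (u x)⁻¹⁻¹) * (u x)⁻¹ = c.val γ
  group

end Heckoid

end

/-! ### Frames and transports with values in orbifold fundamental groups -/

open scoped unitInterval

noncomputable section

namespace Heckoid

theorem apply_trans {X Y : Type*} [TopologicalSpace X] [TopologicalSpace Y] (φ : X → Y) {a b c : X}
    {a' b' c' : Y} (p : Path a b) (q : Path b c) (p' : Path a' b') (q' : Path b' c')
    (hp : ∀ t, φ (p t) = p' t) (hq : ∀ t, φ (q t) = q' t) (t : I) :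
    φ (p.trans q t) = p'.trans q' t := by
  rw [Path.trans_apply, Path.trans_apply]
  split_ifs
  · exact hp _
  · exact hq _

namespace OrbifoldGroup

variable {X : Type*} [TopologicalSpace X] {Γ : Subgroup (X ≃ₜ X)} {x₀ : X}

/-- The type of the path depends on the group element, so the comparison goes through an auxiliary
path with the endpoints of the first and the values of the second. -/
theorem ext_mk {g : Γ} {γ : Path (g.1 x₀) x₀} {g' : Γ}
    {γ' : Path (g'.1 x₀) x₀} (hg : g = g') (δ : Path (g.1 x₀) x₀) (hδ : ∀ t, δ t = γ' t)
    (h : γ.Homotopic δ) :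
    (⟨g, Path.Homotopic.Quotient.mk γ⟩ : OrbifoldGroup Γ x₀) =
      ⟨g', Path.Homotopic.Quotient.mk γ'⟩ := by
  subst hg
  rw [Path.Homotopic.Quotient.eq.2 h, show δ = γ' from Path.ext (funext hδ)]

end OrbifoldGroup

/-- A path which joins a translate of the base point to `x`. -/
structure Frame {X : Type*} [TopologicalSpace X] (Γ : Subgroup (X ≃ₜ X)) (x₀ x : X) where
  elt : Γ
  path : Path (elt.1 x₀) x

namespace Frame

variable {X : Type*} [TopologicalSpace X] {Γ : Subgroup (X ≃ₜ X)} {x₀ x y z : X}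

theorem ext_path {F F' : Frame Γ x₀ x} (h : F.elt = F'.elt) (hp : ∀ t, F.path t = F'.path t) :
    F = F' := by
  obtain ⟨g, γ⟩ := F
  obtain ⟨g', γ'⟩ := F'
  obtain rfl : g = g' := h
  rw [show γ = γ' from Path.ext (funext hp)]

/-- The element of the orbifold fundamental group given by a path between framed points. -/
def val (F : Frame Γ x₀ x) (F' : Frame Γ x₀ y) (γ : Path x y) : OrbifoldGroup Γ x₀ :=
  ⟨F'.elt⁻¹ * F.elt, Path.Homotopic.Quotient.mk
    (((F.path.trans (γ.trans F'.path.symm)).map (F'.elt⁻¹).1.continuous).cast rfl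
      (F'.elt.1.symm_apply_apply x₀).symm)⟩

theorem val_homotopic (F : Frame Γ x₀ x) (F' : Frame Γ x₀ y) {γ γ' : Path x y}
    (h : γ.Homotopic γ') : F.val F' γ = F.val F' γ' := by
  refine OrbifoldGroup.ext_mk rfl _ (fun _ => rfl) (Path.Homotopic.pathCast ?_ _ _)
  exact ((Path.Homotopic.refl _).hcomp (h.hcomp (.refl _))).map ⟨_, (F'.elt⁻¹).1.continuous⟩

theorem homotopic_middle {a b c d e f : X} (p : Path a b) (q : Path b c) (r : Path d c)
    (s : Path c e) (t : Path f e) :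
    ((p.trans (q.trans r.symm)).trans (r.trans (s.trans t.symm))).Homotopic
      (p.trans ((q.trans s).trans t.symm)) := by
  rw [← Path.Homotopic.Quotient.eq]
  simp only [Path.Homotopic.Quotient.mk_trans, Path.Homotopic.Quotient.mk_symm,
    Path.Homotopic.Quotient.trans_assoc]
  congr 2
  rw [← Path.Homotopic.Quotient.trans_assoc (Path.Homotopic.Quotient.symm _)]
  simp

/-- After translating back by the last frame, the frame at the middle point is traversed in both
directions and cancels. -/
theorem val_mul (F : Frame Γ x₀ x) (F' : Frame Γ x₀ y) (F'' : Frame Γ x₀ z) (γ : Path x y)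
    (δ : Path y z) : F'.val F'' δ * F.val F' γ = F.val F'' (γ.trans δ) := by
  have hg : F''.elt⁻¹ * F'.elt * (F'.elt⁻¹ * F.elt) = F''.elt⁻¹ * F.elt := by group
  refine (OrbifoldGroup.ext_mk hg.symm
    ((((F.path.trans (γ.trans F'.path.symm)).trans (F'.path.trans (δ.trans F''.path.symm))).map
      (F''.elt⁻¹).1.continuous).cast rfl (F''.elt.1.symm_apply_apply x₀).symm) (fun t => ?_)
    (Path.Homotopic.pathCast ?_ _ _)).symm
  · have key : ∀ w, (F''.elt⁻¹ * F'.elt).1 ((F'.elt⁻¹).1 w) = (F''.elt⁻¹).1 w := fun w =>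
      congrArg (F''.elt⁻¹).1 (F'.elt.1.apply_symm_apply w)
    exact apply_trans (F''.elt⁻¹).1 _ _ _ _ (fun t => (key _).symm) (fun _ => rfl) t
  · exact (homotopic_middle _ _ _ _ _).symm.map ⟨_, (F''.elt⁻¹).1.continuous⟩

@[simp]
theorem val_refl (F : Frame Γ x₀ x) : F.val F (Path.refl x) = 1 := by
  have h := F.val_mul F F (Path.refl x) (Path.refl x)
  rw [val_homotopic F F ⟨Path.Homotopy.transRefl (Path.refl x)⟩] at h
  simpa using h

/-- The translate of a framed point. -/
def smul (f : Γ) (F : Frame Γ x₀ x) : Frame Γ x₀ (f.1 x) :=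
  ⟨f * F.elt, F.path.map f.1.continuous⟩

/-- The value is pulled back to the base point by the inverse of the last frame element, which
absorbs a common translation of path and frames. -/
theorem val_smul (f : Γ) (F : Frame Γ x₀ x) (F' : Frame Γ x₀ y) (γ : Path x y) :
    (F.smul f).val (F'.smul f) (γ.map f.1.continuous) = F.val F' γ := by
  have hg : (f * F'.elt)⁻¹ * (f * F.elt) = F'.elt⁻¹ * F.elt := by group
  refine OrbifoldGroup.ext_mk hg _ (fun t => ?_) (.refl _)
  have key : ∀ w, ((f * F'.elt)⁻¹).1 (f.1 w) = (F'.elt⁻¹).1 w := fun w => by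
    rw [mul_inv_rev]
    exact congrArg (F'.elt⁻¹).1 (f.1.symm_apply_apply w)
  refine Eq.trans ?_ (key _)
  refine congrArg ((f * F'.elt)⁻¹).1 (apply_trans f.1 _ _ _ _ (fun _ => rfl) (fun t => ?_) t).symm
  exact apply_trans f.1 _ _ _ _ (fun _ => rfl) (fun _ => rfl) t

/-- Transport of a frame along an equality of points. -/
def castTo (F : Frame Γ x₀ x) (h : x = y) : Frame Γ x₀ y := ⟨F.elt, F.path.cast rfl h.symm⟩

theorem val_castTo {x' y' : X} (F : Frame Γ x₀ x) (F' : Frame Γ x₀ y) (h : x = x') (h' : y = y')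
    (γ : Path x' y') (δ : Path x y) (hγ : ∀ t, γ t = δ t) :
    (F.castTo h).val (F'.castTo h') γ = F.val F' δ := by
  subst h h'
  rw [show γ = δ from Path.ext (funext hγ)]
  rfl

/-- The frame given by a path from the base point. -/
def ofPath (Γ : Subgroup (X ≃ₜ X)) (δ : Path x₀ x) : Frame Γ x₀ x := ⟨1, δ⟩

theorem val_ofPath (δ : Path x₀ x) (δ' : Path x₀ y) (γ : Path x y) :
    (ofPath Γ δ).val (ofPath Γ δ') γ = OrbifoldGroup.ofFundamentalGroup Γ x₀
      (FundamentalGroup.fromPath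
        (Path.Homotopic.Quotient.mk (δ.trans (γ.trans δ'.symm)))) := by
  refine OrbifoldGroup.ext_mk (g' := 1) (by simp [ofPath]) _ (fun t => ?_) (.refl _)
  rfl

end Frame

/-- The transport given by frames along a map. -/
def framePathHom {X Y : Type*} [TopologicalSpace X] [TopologicalSpace Y] {Γ : Subgroup (X ≃ₜ X)}
    {x₀ : X} (f : C(Y, X)) (F : ∀ y, Frame Γ x₀ (f y)) : PathHom Y (OrbifoldGroup Γ x₀) where
  val {x y} γ := (F x).val (F y) (γ.map f.continuous)
  val_homotopic h := (F _).val_homotopic (F _) (h.map f)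
  val_trans γ δ := by rw [Path.map_trans, Frame.val_mul]

end Heckoid

end

open scoped unitInterval

noncomputable section

namespace Heckoid

variable {G : Type*} [Group G]

/-! ### Transport along segments in the punctured plane -/

/-- Invariance under the integral translations. -/
def PathHom.IsPeriodic (c : PathHom PuncturedPlane G) : Prop :=
  ∀ (a b : ℤ) {p q : PuncturedPlane} (γ : Path p q),
    c.val (γ.map (planeShear 0 a b).continuous) = c.val γ

/-- The segment between two points, in the punctured plane. -/
def segPath (p q : ℝ × ℝ) (h : ∀ t : I, Path.segment p q t ∉ lattice) :
    Path (⟨_, h 0⟩ : PuncturedPlane) ⟨_, h 1⟩ where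
  toFun t := ⟨_, h t⟩
  continuous_toFun := by fun_prop
  source' := rfl
  target' := rfl

open Classical in
/-- The transport along a segment (`1` if the segment meets the lattice). -/
def PathHom.segVal (c : PathHom PuncturedPlane G) (p q : ℝ × ℝ) : G :=
  if h : ∀ t : I, Path.segment p q t ∉ lattice then c.val (segPath p q h) else 1

/-- A convex set which misses the lattice. -/
structure ConvexFree (K : Set (ℝ × ℝ)) : Prop where
  convex : Convex ℝ K
  free : ∀ x ∈ K, x ∉ lattice

namespace PathHom

variable (c c' : PathHom PuncturedPlane G)

theorem val_eq_segVal {K : Set (ℝ × ℝ)} (hK : ConvexFree K) {p q : PuncturedPlane} (γ : Path p q)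
    (h : ∀ t, (γ t).1 ∈ K) : c.val γ = c.segVal p.1 q.1 := by
  have hp : p.1 ∈ K := by simpa using h 0
  have hq : q.1 ∈ K := by simpa using h 1
  have hs : ∀ t : I, Path.segment p.1 q.1 t ∈ K := fun t => by
    rw [Path.segment_apply]
    exact hK.convex.lineMap_mem hp hq t.2
  have hf : ∀ t : I, Path.segment p.1 q.1 t ∉ lattice := fun t => hK.free _ (hs t)
  rw [segVal, dif_pos hf]
  have : ContractibleSpace K := hK.convex.contractibleSpace ⟨_, hp⟩
  let d := c.pullback (⟨fun x => ⟨x.1, hK.free x.1 x.2⟩, by fun_prop⟩ : C(K, PuncturedPlane))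
  let γ₁ : Path (⟨p.1, hp⟩ : K) ⟨q.1, hq⟩ :=
    { toFun := fun t => ⟨(γ t).1, h t⟩
      continuous_toFun := by fun_prop
      source' := by simp
      target' := by simp }
  let γ₂ : Path (⟨p.1, hp⟩ : K) ⟨q.1, hq⟩ :=
    { toFun := fun t => ⟨Path.segment p.1 q.1 t, hs t⟩
      continuous_toFun := by fun_prop
      source' := by simp
      target' := by simp }
  calc c.val γ = d.val γ₁ := c.val_congr _ _ fun t => rfl
    _ = d.val γ₂ := d.val_eq_of_simplyConnected _ _
    _ = c.val (segPath p.1 q.1 hf) := c.val_congr _ _ fun t => rfl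

theorem segVal_mul {K : Set (ℝ × ℝ)} (hK : ConvexFree K) {p q r : ℝ × ℝ} (hp : p ∈ K) (hq : q ∈ K)
    (hr : r ∈ K) : c.segVal q r * c.segVal p q = c.segVal p r := by
  have hs : ∀ {p q : ℝ × ℝ}, p ∈ K → q ∈ K → ∀ t : I, Path.segment p q t ∈ K :=
    fun hp hq t => by
      rw [Path.segment_apply]
      exact hK.convex.lineMap_mem hp hq t.2
  let γ₁ : Path (⟨p, hK.free p hp⟩ : PuncturedPlane) ⟨q, hK.free q hq⟩ :=
    (segPath p q fun t => hK.free _ (hs hp hq t)).cast (by simp) (by simp)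
  let γ₂ : Path (⟨q, hK.free q hq⟩ : PuncturedPlane) ⟨r, hK.free r hr⟩ :=
    (segPath q r fun t => hK.free _ (hs hq hr t)).cast (by simp) (by simp)
  rw [← c.val_eq_segVal hK γ₁ (hs hp hq), ← c.val_eq_segVal hK γ₂ (hs hq hr), ← c.val_trans]
  refine c.val_eq_segVal hK _ fun t => ?_
  rw [Path.trans_apply]
  split_ifs
  · exact hs hp hq _
  · exact hs hq hr _

theorem segVal_self (p : ℝ × ℝ) : c.segVal p p = 1 := by
  rw [segVal]
  split_ifs with h
  · exact c.val_const _ fun t => Subtype.ext (by simp [segPath])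
  · rfl

theorem segVal_symm {K : Set (ℝ × ℝ)} (hK : ConvexFree K) {p q : ℝ × ℝ} (hp : p ∈ K) (hq : q ∈ K) :
    c.segVal q p = (c.segVal p q)⁻¹ := by
  rw [eq_inv_iff_mul_eq_one, c.segVal_mul hK hp hq hp, segVal_self]

variable {c c'}

theorem IsPeriodic.segVal (hc : c.IsPeriodic) (a b : ℤ) (p q : ℝ × ℝ) :
    c.segVal (p + ((a : ℝ), (b : ℝ))) (q + ((a : ℝ), (b : ℝ))) = c.segVal p q := by
  have e : ∀ t : I, Path.segment (p + ((a : ℝ), (b : ℝ))) (q + ((a : ℝ), (b : ℝ))) t =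
      shear 0 a b (Path.segment p q t) := fun t => by
    simp only [Path.segment_apply, AffineMap.lineMap_apply, shear]
    ext
    · simp; ring
    · simp; ring
  have hl : (∀ t : I, Path.segment (p + ((a : ℝ), (b : ℝ))) (q + ((a : ℝ), (b : ℝ))) t ∉ lattice) ↔
      ∀ t : I, Path.segment p q t ∉ lattice := by
    simp only [e, shear_mem_lattice_iff]
  rw [PathHom.segVal, PathHom.segVal]
  by_cases h : ∀ t : I, Path.segment p q t ∉ lattice
  · rw [dif_pos h, dif_pos (hl.2 h), ← hc a b (segPath p q h)]
    exact c.val_congr _ _ fun t => Subtype.ext (e t)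
  · rw [dif_neg h, dif_neg (mt hl.1 h)]

theorem IsPeriodic.mapHom {H : Type*} [Group H] (hc : c.IsPeriodic) (φ : G →* H) :
    (c.mapHom φ).IsPeriodic := fun a b _ _ γ => congrArg φ (hc a b γ)

/-! ### Comparison of periodic transports -/

/-- The centers of the unit squares. -/
def center (a b : ℤ) : ℝ × ℝ := (a + 1 / 2, b + 1 / 2)

theorem center_add (a b k l : ℤ) : center a b + ((k : ℝ), (l : ℝ)) = center (a + k) (b + l) := by
  ext <;> simp [center] <;> ring

/-- The vertical strips of width `1`. -/
def vStrip (a : ℤ) : Set (ℝ × ℝ) := {x | x.1 ∈ Set.Ioo (a : ℝ) (a + 1)}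

/-- The horizontal strips of width `1`. -/
def hStrip (b : ℤ) : Set (ℝ × ℝ) := {x | x.2 ∈ Set.Ioo (b : ℝ) (b + 1)}

theorem ne_int_of_mem_Ioo_int {x : ℝ} {a : ℤ} (h : x ∈ Set.Ioo (a : ℝ) (a + 1)) (k : ℤ) : x ≠ k := by
  rintro rfl
  have h1 : a < k := by exact_mod_cast h.1
  have h2 : k < a + 1 := by exact_mod_cast h.2
  omega

theorem convexFree_vStrip (a : ℤ) : ConvexFree (vStrip a) where
  convex := (convex_Ioo (a : ℝ) (a + 1)).is_linear_preimage
    (IsLinearMap.mk (fun _ _ => rfl) fun _ _ => rfl)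
  free := by
    rintro _ h ⟨k, l, rfl⟩
    exact ne_int_of_mem_Ioo_int h k rfl

theorem convexFree_hStrip (b : ℤ) : ConvexFree (hStrip b) where
  convex := (convex_Ioo (b : ℝ) (b + 1)).is_linear_preimage
    (IsLinearMap.mk (fun _ _ => rfl) fun _ _ => rfl)
  free := by
    rintro _ h ⟨k, l, rfl⟩
    exact ne_int_of_mem_Ioo_int h l rfl

theorem center_mem_vStrip (a b : ℤ) : center a b ∈ vStrip a := by
  constructor <;> norm_num [center]

theorem center_mem_hStrip (a b : ℤ) : center a b ∈ hStrip b := by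
  constructor <;> norm_num [center]

/-- Conjugacy on consecutive segments telescopes, because all of them lie in one convex set that
misses the lattice. -/
theorem segVal_chain {K : Set (ℝ × ℝ)} (hK : ConvexFree K) (w : ℤ → ℝ × ℝ) (hw : ∀ n, w n ∈ K)
    (k : G) (h : ∀ n, c'.segVal (w n) (w (n + 1)) = k * c.segVal (w n) (w (n + 1)) * k⁻¹) (m n : ℤ) :
    c'.segVal (w m) (w n) = k * c.segVal (w m) (w n) * k⁻¹ := by
  have key : ∀ n, c'.segVal (w 0) (w n) = k * c.segVal (w 0) (w n) * k⁻¹ := by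
    intro n
    induction n using Int.induction_on with
    | zero => simp [segVal_self]
    | succ n ih =>
      rw [← c'.segVal_mul hK (hw 0) (hw n) (hw _), ← c.segVal_mul hK (hw 0) (hw n) (hw _), h, ih]
      group
    | pred n ih =>
      have e := h (-n - 1)
      rw [sub_add_cancel] at e
      rw [← c'.segVal_mul hK (hw 0) (hw (-n)) (hw _), ← c.segVal_mul hK (hw 0) (hw (-n)) (hw _), ih,
        c'.segVal_symm hK (hw (-n - 1)) (hw _), c.segVal_symm hK (hw (-n - 1)) (hw _), e]
      group
  have e' := c'.segVal_mul hK (hw 0) (hw m) (hw n)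
  have e := c.segVal_mul hK (hw 0) (hw m) (hw n)
  rw [key, key, ← e] at e'
  have := eq_mul_inv_of_mul_eq e'
  rw [this]
  group

/-- Two periodic transports with conjugate values on the two unit edges differ by a periodic change
of gauge. -/
theorem exists_gauge (hc : c.IsPeriodic) (hc' : c'.IsPeriodic) (k : G)
    (hv : c'.segVal (center 0 0) (center 0 1) = k * c.segVal (center 0 0) (center 0 1) * k⁻¹)
    (hh : c'.segVal (center 0 0) (center 1 0) = k * c.segVal (center 0 0) (center 1 0) * k⁻¹) :
    ∃ u : PuncturedPlane → G, (∀ a b p, u (planeShear 0 a b p) = u p) ∧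
      ∀ {p q : PuncturedPlane} (γ : Path p q), c'.val γ = u q * c.val γ * (u p)⁻¹ := by
  have hV : ∀ a m n, c'.segVal (center a m) (center a n) =
      k * c.segVal (center a m) (center a n) * k⁻¹ := fun a m n => by
    refine segVal_chain (convexFree_vStrip a) (center a) (center_mem_vStrip a) k (fun n => ?_) m n
    have e := hc.segVal a n (center 0 0) (center 0 1)
    have e' := hc'.segVal a n (center 0 0) (center 0 1)
    simp only [center_add, zero_add] at e e'
    rw [add_comm n, e, e', hv]
  have hH : ∀ b m n, c'.segVal (center m b) (center n b) =
      k * c.segVal (center m b) (center n b) * k⁻¹ := fun b m n => by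
    refine segVal_chain (convexFree_hStrip b) (fun a => center a b) (fun a => center_mem_hStrip a b) k
      (fun n => ?_) m n
    have e := hc.segVal n b (center 0 0) (center 1 0)
    have e' := hc'.segVal n b (center 0 0) (center 1 0)
    simp only [center_add, zero_add] at e e'
    rw [add_comm n, e, e', hh]
  -- The gauge at `x` compares the two transports from a nearby center. Inside a vertical strip the
  -- height of the center is immaterial by `hV`, inside a horizontal strip its abscissa by `hH`.
  let U : ℤ → ℤ → ℝ × ℝ → G := fun a b x =>
    c'.segVal (center a b) x * k * (c.segVal (center a b) x)⁻¹
  let u : PuncturedPlane → G := fun p => U ⌊p.1.1⌋ ⌊p.1.2⌋ p.1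
  have hUV : ∀ a b b' x, x ∈ vStrip a → U a b x = U a b' x := by
    intro a b b' x hx
    have e := c.segVal_mul (convexFree_vStrip a) (center_mem_vStrip a b) (center_mem_vStrip a b') hx
    have e' := c'.segVal_mul (convexFree_vStrip a) (center_mem_vStrip a b)
      (center_mem_vStrip a b') hx
    simp only [U]
    rw [← e, ← e', hV]
    group
  have hUH : ∀ a a' b x, x ∈ hStrip b → U a b x = U a' b x := by
    intro a a' b x hx
    have e := c.segVal_mul (convexFree_hStrip b) (center_mem_hStrip a b) (center_mem_hStrip a' b) hx
    have e' := c'.segVal_mul (convexFree_hStrip b) (center_mem_hStrip a b)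
      (center_mem_hStrip a' b) hx
    simp only [U]
    rw [← e, ← e', hH]
    group
  have main : ∀ {K : Set (ℝ × ℝ)} (_ : ConvexFree K) (a b : ℤ) (_ : center a b ∈ K)
      (_ : ∀ x : PuncturedPlane, x.1 ∈ K → u x = U a b x.1) {p q : PuncturedPlane} (γ : Path p q),
      (∀ t, (γ t).1 ∈ K) → c'.val γ = u q * c.val γ * (u p)⁻¹ := by
    intro K hK a b hab hu p q γ hγ
    have hp : p.1 ∈ K := by simpa using hγ 0
    have hq : q.1 ∈ K := by simpa using hγ 1
    rw [hu p hp, hu q hq, c.val_eq_segVal hK γ hγ, c'.val_eq_segVal hK γ hγ]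
    simp only [U]
    rw [← c.segVal_mul hK hab hp hq, ← c'.segVal_mul hK hab hp hq]
    group
  refine ⟨u, fun a b p => ?_, fun {p q} γ => ?_⟩
  · have e := hc.segVal a b (center ⌊p.1.1⌋ ⌊p.1.2⌋) p.1
    have e' := hc'.segVal a b (center ⌊p.1.1⌋ ⌊p.1.2⌋) p.1
    have e1 : (planeShear 0 a b p).1 = p.1 + ((a : ℝ), (b : ℝ)) := by
      ext <;> simp [planeShear, shear]
    simp only [u, U]
    rw [e1]
    simp only [Prod.fst_add, Prod.snd_add, Int.floor_add_intCast, ← center_add]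
    rw [e, e']
  -- The vertical and horizontal open strips cover the punctured plane: one coordinate of a point
  -- off the lattice is not an integer.
  · refine PathHom.val_eq_of_cover c' (c.gauge u)
      (fun i : ℤ ⊕ ℤ => Subtype.val ⁻¹' (i.elim vStrip hStrip)) ?_ ?_ ?_ γ
    · rintro (a | b)
      · exact isOpen_Ioo.preimage (continuous_fst.comp continuous_subtype_val)
      · exact isOpen_Ioo.preimage (continuous_snd.comp continuous_subtype_val)
    · intro x
      have aux : ∀ y : ℝ, (∀ k : ℤ, y ≠ k) → y ∈ Set.Ioo (⌊y⌋ : ℝ) (⌊y⌋ + 1) := fun y hy =>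
        ⟨lt_of_le_of_ne (Int.floor_le y) (hy _).symm, Int.lt_floor_add_one y⟩
      by_cases h1 : ∀ k : ℤ, x.1.1 ≠ k
      · exact ⟨.inl ⌊x.1.1⌋, aux _ h1⟩
      · push Not at h1
        obtain ⟨k, hk⟩ := h1
        refine ⟨.inr ⌊x.1.2⌋, aux _ fun l hl => x.2 ⟨k, l, Prod.ext hk hl⟩⟩
    · rintro (a | b) p q γ hγ
      · refine main (convexFree_vStrip a) a 0 (center_mem_vStrip a 0) (fun x hx => ?_) γ hγ
        have : ⌊x.1.1⌋ = a := Int.floor_eq_iff.2 ⟨hx.1.le, hx.2⟩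
        simp only [u]
        rw [this]
        exact hUV _ _ _ _ hx
      · refine main (convexFree_hStrip b) 0 b (center_mem_hStrip 0 b) (fun x hx => ?_) γ hγ
        have : ⌊x.1.2⌋ = b := Int.floor_eq_iff.2 ⟨hx.1.le, hx.2⟩
        simp only [u]
        rw [this]
        exact hUH _ _ _ _ hx

end PathHom

end Heckoid

end

open scoped unitInterval

noncomputable section

namespace Heckoid

variable {G : Type*} [Group G]

/-! ### Linear maps of the punctured plane -/

/-- An integral basis of the lattice. -/
structure LatticeBasis where
  v₁ : ℤ
  v₂ : ℤ
  w₁ : ℤ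
  w₂ : ℤ
  det : (v₁ * w₂ - v₂ * w₁) ^ 2 = 1

namespace LatticeBasis

variable (N : LatticeBasis)

/-- The linear map with the given columns. -/
def lin : (ℝ × ℝ) →ₗ[ℝ] (ℝ × ℝ) where
  toFun x := (x.1 * N.v₁ + x.2 * N.w₁, x.1 * N.v₂ + x.2 * N.w₂)
  map_add' x y := by ext <;> simp <;> ring
  map_smul' a x := by ext <;> simp <;> ring

theorem lin_apply (x : ℝ × ℝ) : N.lin x = (x.1 * N.v₁ + x.2 * N.w₁, x.1 * N.v₂ + x.2 * N.w₂) := rfl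

/-- The determinant, as a real number. -/
def detR : ℝ := N.v₁ * N.w₂ - N.v₂ * N.w₁

theorem detR_sq : N.detR ^ 2 = 1 := by
  have := N.det
  rw [detR]
  exact_mod_cast this

/-- The inverse of the linear map. -/
def inv (x : ℝ × ℝ) : ℝ × ℝ :=
  (N.detR * (x.1 * N.w₂ - x.2 * N.w₁), N.detR * (x.2 * N.v₁ - x.1 * N.v₂))

theorem lin_inv (x : ℝ × ℝ) : N.lin (N.inv x) = x := by
  have h := N.detR_sq
  simp only [detR] at h
  ext
  · simp only [lin_apply, inv, detR]
    linear_combination x.1 * h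
  · simp only [lin_apply, inv, detR]
    linear_combination x.2 * h

theorem inv_lin (x : ℝ × ℝ) : N.inv (N.lin x) = x := by
  have h := N.detR_sq
  simp only [detR] at h
  ext
  · simp only [lin_apply, inv, detR]
    linear_combination x.1 * h
  · simp only [lin_apply, inv, detR]
    linear_combination x.2 * h

theorem lin_mem_lattice_iff (x : ℝ × ℝ) : N.lin x ∈ lattice ↔ x ∈ lattice := by
  constructor
  · rintro ⟨a, b, h⟩
    rw [← N.inv_lin x, h]
    exact ⟨(N.v₁ * N.w₂ - N.v₂ * N.w₁) * (a * N.w₂ - b * N.w₁),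
      (N.v₁ * N.w₂ - N.v₂ * N.w₁) * (b * N.v₁ - a * N.v₂), by simp [inv, detR]⟩
  · rintro ⟨a, b, rfl⟩
    exact ⟨a * N.v₁ + b * N.w₁, a * N.v₂ + b * N.w₂, by simp [lin_apply]⟩

/-- The linear map, on the punctured plane. -/
def planeLin : C(PuncturedPlane, PuncturedPlane) where
  toFun x := ⟨N.lin x.1, fun h => x.2 ((N.lin_mem_lattice_iff x.1).1 h)⟩
  continuous_toFun := by
    refine Continuous.subtype_mk ?_ _
    simp only [lin_apply]
    fun_prop

end LatticeBasis

namespace PathHom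

variable {c : PathHom PuncturedPlane G} (N : LatticeBasis)

theorem IsPeriodic.pullback_lin (hc : c.IsPeriodic) : (c.pullback N.planeLin).IsPeriodic := by
  intro a b p q γ
  rw [pullback_val, pullback_val, ← hc (a * N.v₁ + b * N.w₁) (a * N.v₂ + b * N.w₂)
    (γ.map N.planeLin.continuous)]
  refine c.val_congr _ _ fun t => Subtype.ext ?_
  change N.lin (shear 0 a b (γ t).1) = shear 0 _ _ (N.lin (γ t).1)
  simp only [LatticeBasis.lin_apply, shear]
  ext
  · push_cast; ring
  · push_cast; ring

theorem pullback_lin_segVal (p q : ℝ × ℝ) :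
    (c.pullback N.planeLin).segVal p q = c.segVal (N.lin p) (N.lin q) := by
  have e : ∀ t : I, Path.segment (N.lin p) (N.lin q) t = N.lin (Path.segment p q t) := fun t => by
    simp only [Path.segment_apply, AffineMap.lineMap_apply, vsub_eq_sub, vadd_eq_add, map_add,
      map_smul, map_sub]
  have hl : (∀ t : I, Path.segment (N.lin p) (N.lin q) t ∉ lattice) ↔
      ∀ t : I, Path.segment p q t ∉ lattice := by
    simp only [e, N.lin_mem_lattice_iff]
  rw [segVal, segVal]
  by_cases h : ∀ t : I, Path.segment p q t ∉ lattice
  · rw [dif_pos h, dif_pos (hl.2 h)]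
    exact c.val_congr _ _ fun t => Subtype.ext (e t).symm
  · rw [dif_neg h, dif_neg (mt hl.1 h)]

/-! ### Orders of the transport along lines, under reflections and transvections -/

/-- The transport along the lines with a given direction has finite order. -/
def LineTorsion (c : PathHom PuncturedPlane G) (k : ℕ) (v : ℝ × ℝ) : Prop :=
  ∀ (y : ℝ × ℝ) (h : ∀ a : ℝ, y + a • v ∉ lattice), c.val (linePath y v h) ^ k = 1

theorem lineTorsion_pullback_lin (k : ℕ) (v : ℝ × ℝ) :
    (c.pullback N.planeLin).LineTorsion k v ↔ c.LineTorsion k (N.lin v) := by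
  have e : ∀ (y : ℝ × ℝ) (a : ℝ), N.lin y + a • N.lin v = N.lin (y + a • v) := fun y a => by
    rw [map_add, map_smul]
  have hval : ∀ y h h', (c.pullback N.planeLin).val (linePath y v h) =
      c.val (linePath (N.lin y) (N.lin v) h') := fun y h h' => by
    rw [pullback_val]
    exact c.val_congr _ _ fun t => Subtype.ext (e y t).symm
  constructor
  · intro H y h
    have h' : ∀ a : ℝ, N.inv y + a • v ∉ lattice := fun a ha => by
      refine h a ?_
      rw [← N.lin_mem_lattice_iff, ← e, N.lin_inv] at ha
      exact ha
    have := H (N.inv y) h'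
    rw [hval _ _ (by simpa only [N.lin_inv] using h)] at this
    rw [← this]
    congr 1
    exact c.val_congr _ _ fun t => Subtype.ext (by simp [linePath, N.lin_inv])
  · intro H y h
    have h' : ∀ a : ℝ, N.lin y + a • N.lin v ∉ lattice := fun a => by
      rw [e, N.lin_mem_lattice_iff]
      exact h a
    rw [hval y h h']
    exact H _ _

theorem LineTorsion.neg {k : ℕ} {v : ℝ × ℝ} (H : c.LineTorsion k v) : c.LineTorsion k (-v) := by
  intro y h
  -- The line from `y` in direction `-v` ends at `y - v`; reversed, it starts there.
  have h' : ∀ a : ℝ, (y - v) + a • v ∉ lattice := fun a => by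
    have := h (1 - a)
    convert this using 1
    rw [smul_neg, sub_smul, one_smul]
    abel_nf
  have e : c.val (linePath y (-v) h) = (c.val (linePath (y - v) v h'))⁻¹ := by
    rw [← c.val_symm]
    refine c.val_congr _ _ fun t => Subtype.ext ?_
    change y + (t : ℝ) • (-v) = (y - v) + ((unitInterval.symm t : I) : ℝ) • v
    rw [unitInterval.coe_symm_eq, smul_neg, sub_smul, one_smul]
    abel
  rw [e, inv_pow, H, inv_one]

theorem lineTorsion_neg_iff (k : ℕ) (v : ℝ × ℝ) : c.LineTorsion k (-v) ↔ c.LineTorsion k v :=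
  ⟨fun h => by simpa using h.neg, fun h => h.neg⟩

/-- The ends of a line with integral direction differ by an integral translation, so a periodic
gauge has the same value at both and acts by conjugation. -/
theorem lineTorsion_gauge {c' : PathHom PuncturedPlane G} (u : PuncturedPlane → G)
    (hu : ∀ a b p, u (planeShear 0 a b p) = u p)
    (h : ∀ {p q : PuncturedPlane} (γ : Path p q), c'.val γ = u q * c.val γ * (u p)⁻¹)
    (k : ℕ) (a b : ℤ) :
    c'.LineTorsion k ((a : ℝ), (b : ℝ)) ↔ c.LineTorsion k ((a : ℝ), (b : ℝ)) := by
  refine forall_congr' fun y => forall_congr' fun hy => ?_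
  have e : (⟨y + (1 : ℝ) • ((a : ℝ), (b : ℝ)), hy 1⟩ : PuncturedPlane) =
      planeShear 0 a b ⟨y + (0 : ℝ) • ((a : ℝ), (b : ℝ)), hy 0⟩ := by
    refine Subtype.ext ?_
    ext <;> simp [planeShear, shear]
  rw [h, (congrArg u e).trans (hu a b _), conj_pow, conj_eq_one_iff]

theorem linePath_vertical (k : ℕ) (h : c.LineTorsion k (0, 1)) :
    c.segVal (center 0 0) (center 0 1) ^ k = 1 := by
  have hl : ∀ a : ℝ, center 0 0 + a • ((0 : ℝ), (1 : ℝ)) ∉ lattice := fun a =>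
    (convexFree_vStrip 0).free _ (by constructor <;> simp [center]; norm_num)
  have hs : ∀ t : I, (linePath (center 0 0) (0, 1) hl t).1 ∈ vStrip 0 := fun t => by
    have h0 := (center_mem_vStrip 0 0)
    have e : (linePath (center 0 0) (0, 1) hl t).1.1 = (center 0 0).1 := by simp [linePath]
    exact ⟨e ▸ h0.1, e ▸ h0.2⟩
  have := h (center 0 0) hl
  rw [c.val_eq_segVal (convexFree_vStrip 0) _ hs] at this
  convert this using 2
  congr 1
  · simp
  · ext <;> simp [center]; ring

/-- The reflection `(x, y) ↦ (x, -y)`. -/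
def reflection : LatticeBasis := ⟨1, 0, 0, -1, by norm_num⟩

/-- The transvection `(x, y) ↦ (x, y + m x)`. -/
def transvection (m : ℕ) : LatticeBasis := ⟨1, m, 0, 1, by norm_num⟩

/-- The pullback by the reflection inverts the vertical edge value and keeps the horizontal one. The
vertical value has order dividing two, so both transports agree on the two edges and are gauge
equivalent. -/
theorem lineTorsion_reflection (hc : c.IsPeriodic) (h : c.LineTorsion 2 (0, 1)) (k : ℕ) (a b : ℤ) :
    c.LineTorsion k (reflection.lin ((a : ℝ), (b : ℝ))) ↔ c.LineTorsion k ((a : ℝ), (b : ℝ)) := by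
  rw [← lineTorsion_pullback_lin]
  have e : ∀ a b : ℤ, reflection.lin (center a b) = center a (-b - 1) := fun a b => by
    ext <;> simp [reflection, center, LatticeBasis.lin_apply]
    ring
  obtain ⟨u, hu, hu'⟩ := exists_gauge hc (hc.pullback_lin reflection) 1 (by
    rw [pullback_lin_segVal, e, e, c.segVal_symm (convexFree_vStrip 0) (center_mem_vStrip 0 (-1 - 1))
      (center_mem_vStrip 0 (-0 - 1))]
    have h1 := hc.segVal 0 (-2) (center 0 0) (center 0 1)
    simp only [center_add] at h1
    norm_num at h1 ⊢
    rw [h1, inv_eq_iff_mul_eq_one, ← sq]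
    exact linePath_vertical 2 h) (by
    rw [pullback_lin_segVal, e, e]
    have h1 := hc.segVal 0 (-1) (center 0 0) (center 1 0)
    simp only [center_add] at h1
    norm_num at h1 ⊢
    exact h1)
  exact lineTorsion_gauge u hu hu' k a b

/-- An open vertical strip stays convex and free of lattice points when one boundary point, midway
between two lattice points, is added. Together with `convexFree_right` this allows a path to cross
the line `x = 1` through that gap. -/
theorem convexFree_left (m : ℕ) :
    ConvexFree {x | 0 < x.1 ∧ x.1 ≤ 1 ∧ (x.1 = 1 → x.2 = m + 1 / 2)} where
  convex := by
    rw [convex_iff_forall_pos]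
    rintro x ⟨h1, h2, h3⟩ y ⟨h4, h5, h6⟩ a b ha hb hab
    simp only [Set.mem_ofPred_eq, Prod.fst_add, Prod.smul_fst, smul_eq_mul, Prod.snd_add,
      Prod.smul_snd]
    refine ⟨by positivity, by nlinarith, fun h => ?_⟩
    have hx : x.1 = 1 := by nlinarith
    have hy : y.1 = 1 := by nlinarith
    rw [h3 hx, h6 hy, ← add_mul, hab, one_mul]
  free := by
    rintro _ ⟨h1, h2, h3⟩ ⟨a, b, rfl⟩
    have h1' : 0 < a := by simpa using h1
    have h2' : (a : ℝ) ≤ (1 : ℤ) := by simpa using h2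
    have h2'' : a ≤ 1 := by exact_mod_cast h2'
    have h4 := h3 (by simp only; exact_mod_cast (by omega : a = 1))
    have h5 : 2 * b = 2 * (m : ℤ) + 1 := by
      have : (2 * b : ℝ) = 2 * m + 1 := by simp only at h4; linarith
      exact_mod_cast this
    omega

theorem convexFree_right (m : ℕ) :
    ConvexFree {x | 1 ≤ x.1 ∧ x.1 < 2 ∧ (x.1 = 1 → x.2 = m + 1 / 2)} where
  convex := by
    rw [convex_iff_forall_pos]
    rintro x ⟨h1, h2, h3⟩ y ⟨h4, h5, h6⟩ a b ha hb hab
    simp only [Set.mem_ofPred_eq, Prod.fst_add, Prod.smul_fst, smul_eq_mul, Prod.snd_add,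
      Prod.smul_snd]
    refine ⟨by nlinarith, by nlinarith, fun h => ?_⟩
    have hx : x.1 = 1 := by nlinarith
    have hy : y.1 = 1 := by nlinarith
    rw [h3 hx, h6 hy, ← add_mul, hab, one_mul]
  free := by
    rintro _ ⟨h1, h2, h3⟩ ⟨a, b, rfl⟩
    have h1'' : ((1 : ℤ) : ℝ) ≤ a := by simpa using h1
    have h1' : 1 ≤ a := by exact_mod_cast h1''
    have h2' : (a : ℝ) < (2 : ℤ) := by simpa using h2
    have h2'' : a < 2 := by exact_mod_cast h2'
    have h4 := h3 (by simp only; exact_mod_cast (by omega : a = 1))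
    have h5 : 2 * b = 2 * (m : ℤ) + 1 := by
      have : (2 * b : ℝ) = 2 * m + 1 := by simp only at h4; linarith
      exact_mod_cast this
    omega

theorem convexFree_line (m : ℕ) :
    ConvexFree {x | 0 < x.1 ∧ x.1 < 2 ∧ x.2 = m * x.1 + 1 / 2} where
  convex := by
    rw [convex_iff_forall_pos]
    rintro x ⟨h1, h2, h3⟩ y ⟨h4, h5, h6⟩ a b ha hb hab
    simp only [Set.mem_ofPred_eq, Prod.fst_add, Prod.smul_fst, smul_eq_mul, Prod.snd_add,
      Prod.smul_snd]
    refine ⟨by positivity, by nlinarith, ?_⟩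
    rw [h3, h6]
    linear_combination (1 / 2) * hab
  free := by
    rintro _ ⟨h1, h2, h3⟩ ⟨a, b, rfl⟩
    have h5 : 2 * b = 2 * ((m : ℤ) * a) + 1 := by
      have : (2 * b : ℝ) = 2 * (m * a) + 1 := by simp only at h3; linarith
      exact_mod_cast this
    omega

/-- The sheared horizontal edge crosses `x = 1` between `(1, m)` and `(1, m + 1)`. Up to conjugation
by `k₀` its value is that of the horizontal edge, with a factor `X ^ m` for the climb to height `m`.
This factor is `1`, so the pullback is gauge equivalent to `c`. -/
theorem lineTorsion_transvection (hc : c.IsPeriodic) (m : ℕ) (h : c.LineTorsion m (0, 1)) (k : ℕ)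
    (a b : ℤ) : c.LineTorsion k ((transvection m).lin ((a : ℝ), (b : ℝ))) ↔
      c.LineTorsion k ((a : ℝ), (b : ℝ)) := by
  rw [← lineTorsion_pullback_lin]
  set X := c.segVal (center 0 0) (center 0 1) with hX
  have hXm : X ^ m = 1 := linePath_vertical m h
  have hXn : ∀ n : ℕ, c.segVal (center 0 0) (center 0 n) = X ^ n := by
    intro n
    induction n with
    | zero => simp [segVal_self]
    | succ n ih =>
      rw [← c.segVal_mul (convexFree_vStrip 0) (center_mem_vStrip 0 0) (center_mem_vStrip 0 n)
        (center_mem_vStrip 0 _), ih, pow_succ']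
      congr 1
      have h1 := hc.segVal 0 n (center 0 0) (center 0 1)
      simp only [center_add] at h1
      rw [hX, ← h1]
      congr 1 <;> simp [add_comm]
  set q₀ : ℝ × ℝ := (1 / 2, m / 2 + 1 / 2) with hq₀
  have hq₀V : q₀ ∈ vStrip 0 := by constructor <;> norm_num [hq₀]
  have e0 : (transvection m).lin (center 0 0) = q₀ := by
    ext <;> simp [transvection, center, LatticeBasis.lin_apply, hq₀]
    ring
  have e1 : (transvection m).lin (center 0 1) = q₀ + (((0 : ℤ) : ℝ), ((1 : ℤ) : ℝ)) := by
    ext <;> simp [transvection, center, LatticeBasis.lin_apply, hq₀]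
    ring
  have e2 : (transvection m).lin (center 1 0) = q₀ + (((1 : ℤ) : ℝ), ((m : ℤ) : ℝ)) := by
    ext <;> simp [transvection, center, LatticeBasis.lin_apply, hq₀] <;> ring
  set k₀ := c.segVal (center 0 0) q₀ with hk₀
  obtain ⟨u, hu, hu'⟩ := exists_gauge hc (hc.pullback_lin (transvection m)) k₀ (by
    rw [pullback_lin_segVal, e0, e1]
    have hq₁V : q₀ + (((0 : ℤ) : ℝ), ((1 : ℤ) : ℝ)) ∈ vStrip 0 := by
      constructor <;> norm_num [hq₀]
    have h1 := c.segVal_mul (convexFree_vStrip 0) (center_mem_vStrip 0 0) hq₀V hq₁V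
    have h2 := c.segVal_mul (convexFree_vStrip 0) (center_mem_vStrip 0 0) (center_mem_vStrip 0 1) hq₁V
    have h3 := hc.segVal 0 1 (center 0 0) q₀
    rw [center_add] at h3
    rw [eq_mul_inv_iff_mul_eq, h1, ← h2]
    congr 1) (by
    rw [pullback_lin_segVal, e0, e2]
    set q₁ : ℝ × ℝ := q₀ + (((1 : ℤ) : ℝ), ((m : ℤ) : ℝ)) with hq₁
    -- At this point the sheared edge from `q₀` to `q₁` meets the unsheared edge from `center 0 m`
    -- to `center 1 m`, and so the former can be rerouted along the latter.
    set mid : ℝ × ℝ := (1, m + 1 / 2) with hmid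
    have h1 := c.segVal_mul (convexFree_line m) (p := q₀) (q := mid) (r := q₁)
      (by norm_num [hq₀]; ring) (by norm_num [hmid]) (by norm_num [hq₁, hq₀]; ring)
    have h2 := c.segVal_mul (convexFree_left m) (p := q₀) (q := center 0 m) (r := mid)
      (by norm_num [hq₀]) (by norm_num [center]) (by norm_num [hmid])
    have h3 := c.segVal_mul (convexFree_right m) (p := mid) (q := center 1 m) (r := q₁)
      (by norm_num [hmid]) (by norm_num [center]) (by norm_num [hq₁, hq₀])
    have h4 := c.segVal_mul (convexFree_hStrip m) (p := center 0 m) (q := mid) (r := center 1 m)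
      (center_mem_hStrip 0 m) (by constructor <;> norm_num [hmid]) (center_mem_hStrip 1 m)
    have h5 := c.segVal_mul (convexFree_vStrip 0) (center_mem_vStrip 0 0) hq₀V (center_mem_vStrip 0 m)
    have h6 := hc.segVal 1 m (center 0 0) q₀
    have h7 := hc.segVal 0 m (center 0 0) (center 1 0)
    simp only [center_add, zero_add, add_zero] at h6 h7
    rw [← hq₁] at h6
    rw [hXn, hXm, ← hk₀] at h5
    have h5' := eq_inv_of_mul_eq_one_left h5
    rw [← h1, ← h2, ← h3, h5', ← h7, ← h4, h6, ← hk₀]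
    group)
  exact lineTorsion_gauge u hu hu' k a b

end PathHom

end Heckoid

end

open scoped unitInterval

noncomputable section

namespace Heckoid

variable {G : Type*} [Group G]

/-! ### The action on slopes -/

theorem exists_fareyVec (s : OnePoint ℚ) : ∃ p q a b : ℤ,
    fareyVec s 0 = p ∧ fareyVec s 1 = q ∧ a * p + b * q = 1 := by
  induction s using OnePoint.rec with
  | infty => exact ⟨1, 0, 1, 0, by simp [fareyVec], by simp [fareyVec], by norm_num⟩
  | coe q =>
    obtain ⟨a, b, hab⟩ := Rat.isCoprime_num_den q
    exact ⟨q.num, q.den, a, b, by simp [fareyVec], by simp [fareyVec], hab⟩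

theorem fareyVec_infty : fareyVec OnePoint.infty = ![1, 0] := rfl

theorem fareyVec_coe (q : ℚ) : fareyVec (q : OnePoint ℚ) = ![(q.num : ℚ), (q.den : ℚ)] := rfl

theorem num_eq_mul_den (q : ℚ) : (q.num : ℚ) = q * q.den := (Rat.mul_den_eq_num q).symm

/-- The projective action on slopes agrees with the linear action on representing vectors up to a
scalar; parallelism is all that is needed. -/
theorem cross_fareyVec_smul (g : GL (Fin 2) ℚ) (s : OnePoint ℚ) :
    g.1.mulVec (fareyVec s) 0 * fareyVec (g • s) 1 =
      g.1.mulVec (fareyVec s) 1 * fareyVec (g • s) 0 := by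
  induction s using OnePoint.rec with
  | infty =>
    rw [OnePoint.smul_infty_eq_ite]
    split_ifs with h
    · simp [fareyVec_infty, h]
    · set x := g 0 0 / g 1 0 with hx
      have hx' : x * g 1 0 = g 0 0 := by rw [hx]; field_simp
      simp only [fareyVec_infty, fareyVec_coe, Matrix.mulVec_fin_two, Matrix.cons_val_zero,
        Matrix.cons_val_one, num_eq_mul_den x]
      linear_combination -(x.den : ℚ) * hx'
  | coe k =>
    have hk := num_eq_mul_den k
    rw [OnePoint.smul_some_eq_ite]
    split_ifs with h
    · simp only [fareyVec_infty, fareyVec_coe, Matrix.mulVec_fin_two, Matrix.cons_val_zero,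
        Matrix.cons_val_one, hk]
      linear_combination -(k.den : ℚ) * h
    · set x := (g 0 0 * k + g 0 1) / (g 1 0 * k + g 1 1) with hx
      have hx' : x * (g 1 0 * k + g 1 1) = g 0 0 * k + g 0 1 := div_mul_cancel₀ _ h
      simp only [fareyVec_coe, Matrix.mulVec_fin_two, Matrix.cons_val_zero,
        Matrix.cons_val_one, hk, num_eq_mul_den x]
      linear_combination -(k.den : ℚ) * x.den * hx'

theorem eq_or_eq_neg_of_primitive {p q p' q' a b a' b' : ℤ} (h : a * p + b * q = 1)
    (h' : a' * p' + b' * q' = 1) (hc : p * q' = q * p') :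
    p = p' ∧ q = q' ∨ p = -p' ∧ q = -q' := by
  have h1 : (a' * p + b' * q) * p' = p := by linear_combination p * h' - b' * hc
  have h2 : (a' * p + b' * q) * q' = q := by linear_combination q * h' + a' * hc
  have hu : IsUnit (a' * p + b' * q) :=
    IsUnit.of_mul_eq_one (a * p' + b * q') (by linear_combination h + a * h1 + b * h2)
  rcases Int.isUnit_iff.1 hu with hu | hu <;> rw [hu] at h1 h2
  · exact Or.inl ⟨by linarith, by linarith⟩
  · exact Or.inr ⟨by linarith, by linarith⟩

/-- In the basis formed by the two ends of a Farey edge, Farey reflections (`ε = -1`, `k = 0`) and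
parabolics (`ε = 1`, `k = m`) are triangular matrices. The sign ambiguity reflects that a slope
fixes its primitive vector only up to sign. -/
theorem exists_slopeDir_smul (g : GL (Fin 2) ℚ) (r v s : OnePoint ℚ) (ε k : ℤ) (hε : ε ^ 2 = 1)
    (hv : FareyEdge r v) (hr : g.1.mulVec (fareyVec r) = fareyVec r)
    (hg : g.1.mulVec (fareyVec v) = (ε : ℚ) • fareyVec v + (k : ℚ) • fareyVec r) :
    ∃ (N : LatticeBasis) (f t : ℤ), N.lin (0, 1) = slopeDir r ∧
      slopeDir s = N.lin ((f : ℝ), (t : ℝ)) ∧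
      (slopeDir (g • s) = N.lin (((ε * f : ℤ) : ℝ), ((t + k * f : ℤ) : ℝ)) ∨
        slopeDir (g • s) = -N.lin (((ε * f : ℤ) : ℝ), ((t + k * f : ℤ) : ℝ))) := by
  obtain ⟨r₀, r₁, -, -, hr₀, hr₁, -⟩ := exists_fareyVec r
  obtain ⟨v₀, v₁, -, -, hv₀, hv₁, -⟩ := exists_fareyVec v
  obtain ⟨p, q, a, b, hp, hq, hab⟩ := exists_fareyVec s
  obtain ⟨p', q', a', b', hp', hq', hab'⟩ := exists_fareyVec (g • s)
  have hD : (r₀ * v₁ - r₁ * v₀) ^ 2 = 1 := by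
    have h : |((r₀ * v₁ - r₁ * v₀ : ℤ) : ℚ)| = 1 := by
      rw [FareyEdge, hr₀, hr₁, hv₀, hv₁] at hv
      exact_mod_cast hv
    rw [← sq_abs, show |r₀ * v₁ - r₁ * v₀| = 1 by exact_mod_cast h, one_pow]
  set D := r₀ * v₁ - r₁ * v₀ with hDdef
  -- Cramer's rule; `D = ±1` is its own inverse.
  set f := D * (r₀ * q - r₁ * p) with hf
  set t := D * (p * v₁ - q * v₀) with ht
  have hpf : p = f * v₀ + t * r₀ := by
    linear_combination (-p) * hD + D * p * hDdef + v₀ * hf + r₀ * ht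
  have hqf : q = f * v₁ + t * r₁ := by
    linear_combination (-q) * hD + D * q * hDdef + v₁ * hf + r₁ * ht
  have hs : fareyVec s = (f : ℚ) • fareyVec v + (t : ℚ) • fareyVec r := by
    ext i
    fin_cases i
    · simp [hp, hv₀, hr₀, hpf]
    · simp [hq, hv₁, hr₁, hqf]
  have him : g.1.mulVec (fareyVec s) =
      ((ε * f : ℤ) : ℚ) • fareyVec v + ((t + k * f : ℤ) : ℚ) • fareyVec r := by
    rw [hs, Matrix.mulVec_add, Matrix.mulVec_smul, Matrix.mulVec_smul, hr, hg]
    push_cast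
    module
  set P := ε * f * v₀ + (t + k * f) * r₀ with hP
  set Q := ε * f * v₁ + (t + k * f) * r₁ with hQ
  have hcross : P * q' = Q * p' := by
    have := cross_fareyVec_smul g s
    rw [him] at this
    simp only [Pi.add_apply, Pi.smul_apply, smul_eq_mul, hp', hq', hv₀, hv₁, hr₀, hr₁] at this
    exact_mod_cast this
  have hFT : f * (a * v₀ + b * v₁) + t * (a * r₀ + b * r₁) = 1 := by
    rw [hpf, hqf] at hab
    linear_combination hab
  have hfP : ε * f = D * (r₀ * Q - r₁ * P) := by
    rw [hP, hQ]
    linear_combination (-(ε * f)) * hD + D * ε * f * hDdef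
  have htP : t + k * f = D * (P * v₁ - Q * v₀) := by
    rw [hP, hQ]
    linear_combination (-(t + k * f)) * hD + D * (t + k * f) * hDdef
  set A := a * v₀ + b * v₁
  set B := a * r₀ + b * r₁
  -- A Bézout relation for the image vector, obtained by transporting that of `s` through the
  -- integral inverse of the map; it shows that the image is primitive.
  have hPQ : (-ε * D * r₁ * (A - k * B) + D * v₁ * B) * P +
      (ε * D * r₀ * (A - k * B) - D * v₀ * B) * Q = 1 := by
    linear_combination hFT - ε * (A - k * B) * hfP - B * htP + f * (A - k * B) * hε
  refine ⟨⟨v₁, v₀, r₁, r₀, ?_⟩, f, t, ?_, ?_, ?_⟩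
  · rw [← hD, hDdef]
    ring
  · ext <;> simp [LatticeBasis.lin_apply, slopeDir, hr₀, hr₁]
  · ext
    · simp only [slopeDir, LatticeBasis.lin_apply, hp, hq]
      exact_mod_cast hqf
    · simp only [slopeDir, LatticeBasis.lin_apply, hp, hq]
      exact_mod_cast hpf
  · refine (eq_or_eq_neg_of_primitive hPQ hab' hcross).imp ?_ ?_ <;> rintro ⟨h1, h2⟩
    · ext
      · simp only [slopeDir, LatticeBasis.lin_apply, hp', hq', ← h2]
        exact_mod_cast hQ
      · simp only [slopeDir, LatticeBasis.lin_apply, hp', hq', ← h1]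
        exact_mod_cast hP
    · have h1' : p' = -P := by omega
      have h2' : q' = -Q := by omega
      ext
      · simp only [slopeDir, LatticeBasis.lin_apply, hp', hq', h2', Prod.fst_neg]
        rw [hQ]
        push_cast
        ring
      · simp only [slopeDir, LatticeBasis.lin_apply, hp', hq', h1', Prod.snd_neg]
        rw [hP]
        push_cast
        ring

/-! ### Invariance of the order along lines under the group acting on slopes -/

namespace PathHom

variable {c : PathHom PuncturedPlane G}

theorem lineTorsion_edgeReflection (hc : c.IsPeriodic) {r : OnePoint ℚ}
    (h : c.LineTorsion 2 (slopeDir r)) {g : GL (Fin 2) ℚ} (hg : g ∈ edgeReflections r) (k : ℕ)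
    (s : OnePoint ℚ) : c.LineTorsion k (slopeDir (g • s)) ↔ c.LineTorsion k (slopeDir s) := by
  obtain ⟨v, hv, hr, hgv⟩ := hg
  obtain ⟨N, f, t, hN, hs, hgs⟩ := exists_slopeDir_smul g r v s (-1) 0 (by norm_num) hv hr (by
    rw [hgv]; simp)
  -- The Farey reflection fixes the vector of `r`, whereas `reflection` negates it in these
  -- coordinates. The two differ by `-1`, which acts trivially on slopes.
  have e : N.lin (((-1 * f : ℤ) : ℝ), ((t + 0 * f : ℤ) : ℝ)) =
      -N.lin (reflection.lin ((f : ℝ), (t : ℝ))) := by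
    rw [← map_neg]
    congr 1
    ext <;> simp [reflection, LatticeBasis.lin_apply]
  have h' : (c.pullback N.planeLin).LineTorsion 2 (0, 1) := by
    rw [lineTorsion_pullback_lin, hN]
    exact h
  have key := lineTorsion_reflection (hc.pullback_lin N) h' k f t
  rw [lineTorsion_pullback_lin, lineTorsion_pullback_lin, ← hs] at key
  rw [← key]
  rcases hgs with hgs | hgs
  · rw [hgs, e, lineTorsion_neg_iff]
  · rw [hgs, e, neg_neg]

theorem lineTorsion_parabolic (hc : c.IsPeriodic) {r : OnePoint ℚ} (m : ℕ)
    (h : c.LineTorsion m (slopeDir r)) {g : GL (Fin 2) ℚ} (hg : g ∈ parabolics r m) (k : ℕ)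
    (s : OnePoint ℚ) : c.LineTorsion k (slopeDir (g • s)) ↔ c.LineTorsion k (slopeDir s) := by
  obtain ⟨v, hv, hr, hgv⟩ := hg
  obtain ⟨N, f, t, hN, hs, hgs⟩ := exists_slopeDir_smul g r v s 1 m (by norm_num) hv hr (by
    rw [hgv]; simp)
  have e : N.lin (((1 * f : ℤ) : ℝ), ((t + m * f : ℤ) : ℝ)) =
      N.lin ((transvection m).lin ((f : ℝ), (t : ℝ))) := by
    congr 1
    ext <;> simp [transvection, LatticeBasis.lin_apply]
    ring
  have h' : (c.pullback N.planeLin).LineTorsion m (0, 1) := by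
    rw [lineTorsion_pullback_lin, hN]
    exact h
  have key := lineTorsion_transvection (hc.pullback_lin N) m h' k f t
  rw [lineTorsion_pullback_lin, lineTorsion_pullback_lin, ← hs] at key
  rw [← key]
  rcases hgs with hgs | hgs
  · rw [hgs, e]
  · rw [hgs, e, lineTorsion_neg_iff]

theorem lineTorsion_of_inOrbit (hc : c.IsPeriodic) (r : ℚ) (m : ℕ)
    (h2 : c.LineTorsion 2 (slopeDir OnePoint.infty)) (hm : c.LineTorsion m (slopeDir r))
    {s : OnePoint ℚ} (hs : InOrbitOfInfty r m s) : c.LineTorsion 2 (slopeDir s) := by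
  obtain ⟨⟨g, hg⟩, rfl⟩ := hs
  have key : ∀ g ∈ slopeGroup r m, ∀ s : OnePoint ℚ,
      c.LineTorsion 2 (slopeDir (g • s)) ↔ c.LineTorsion 2 (slopeDir s) := by
    intro g hg
    rw [slopeGroup, reflectionGroup, parabolicGroup, ← Subgroup.closure_union] at hg
    induction hg using Subgroup.closure_induction with
    | mem g hg =>
      intro s
      rcases hg with hg | hg
      · exact lineTorsion_edgeReflection hc h2 hg 2 s
      · exact lineTorsion_parabolic hc m hm hg 2 s
    | one => simp
    | mul g g' _ _ ih ih' =>
      intro s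
      rw [mul_smul, ih, ih']
    | inv g _ ih =>
      intro s
      rw [← ih, smul_inv_smul]
  exact (key g hg OnePoint.infty).2 h2

end PathHom

end Heckoid

end

open scoped unitInterval

noncomputable section

namespace Heckoid

/-! ### The transport of the punctured plane in the orbifold fundamental group -/

namespace Frame

variable {X : Type*} [TopologicalSpace X] {Γ : Subgroup (X ≃ₜ X)} {x₀ x y z : X}

theorem val_symm (F : Frame Γ x₀ x) (F' : Frame Γ x₀ y) (γ : Path x y) :
    F'.val F γ.symm = (F.val F' γ)⁻¹ := by
  rw [eq_inv_iff_mul_eq_one, val_mul, ← F.val_refl]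
  exact val_homotopic _ _ ⟨(Path.Homotopy.reflTransSymm γ).symm⟩

/-- Changing the frames at the two ends multiplies the value on either side by elements depending
only on these frames. -/
theorem val_change (F F' : Frame Γ x₀ x) (K K' : Frame Γ x₀ y) (γ : Path x y) :
    F.val K γ = K'.val K (Path.refl y) * F'.val K' γ * F.val F' (Path.refl x) := by
  rw [val_mul, val_mul]
  exact val_homotopic _ _ (.trans ⟨(Path.Homotopy.transRefl γ).symm⟩
    ⟨(Path.Homotopy.reflTrans _).symm⟩)

end Frame

/-- The translation by `(a, b)`, in the group of symmetries. -/
def symm (s : OnePoint ℚ) (a b : ℤ) : symmetryGroup s :=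
  ⟨translation s a b, a, b, isTranslation_translation s a b⟩

theorem symm_mul (s : OnePoint ℚ) (a b a' b' : ℤ) :
    symm s a b * symm s a' b' = symm s (a + a') (b + b') :=
  Subtype.ext (translation_mul s a b a' b')

theorem symm_two (s : OnePoint ℚ) (a b : ℤ) : symm s (2 * a) (2 * b) = 1 :=
  Subtype.ext (translation_two s a b)

theorem symm_bridge (s : OnePoint ℚ) (a b : ℤ) (x : PuncturedPlane) :
    (symm s a b).1 (bridge s x) = bridge s (planeShear 0 a b x) :=
  tunnelMap_bridge s s 0 a b x

theorem planeShear_planeShear (a b a' b' : ℤ) (x : PuncturedPlane) :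
    planeShear 0 a b (planeShear 0 a' b' x) = planeShear 0 (a + a') (b + b') x := by
  refine Subtype.ext ?_
  ext <;> simp [planeShear, shear] <;> ring

theorem planeShear_zero (x : PuncturedPlane) : planeShear 0 0 0 x = x := by
  refine Subtype.ext ?_
  ext <;> simp [planeShear, shear]

/-- The translate of a point into the unit square. -/
def reduce (x : PuncturedPlane) : PuncturedPlane := planeShear 0 (-⌊x.1.1⌋) (-⌊x.1.2⌋) x

theorem planeShear_reduce (x : PuncturedPlane) :
    planeShear 0 ⌊x.1.1⌋ ⌊x.1.2⌋ (reduce x) = x := by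
  rw [reduce, planeShear_planeShear, add_neg_cancel, add_neg_cancel, planeShear_zero]

theorem floor_planeShear (a b : ℤ) (x : PuncturedPlane) :
    ⌊(planeShear 0 a b x).1.1⌋ = a + ⌊x.1.1⌋ ∧ ⌊(planeShear 0 a b x).1.2⌋ = b + ⌊x.1.2⌋ := by
  simp [planeShear, shear, add_comm]

theorem reduce_planeShear (a b : ℤ) (x : PuncturedPlane) :
    reduce (planeShear 0 a b x) = reduce x := by
  rw [reduce, (floor_planeShear a b x).1, (floor_planeShear a b x).2, planeShear_planeShear, reduce]
  congr 2 <;> ring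

variable (s : OnePoint ℚ)

/-- The translate of the path from the base point to the reduced point. -/
def planeFrame (x : PuncturedPlane) : Frame (symmetryGroup s) (base s) (bridge s x) :=
  ((Frame.ofPath (symmetryGroup s) ((PathHom.framePath planeBase (reduce x)).map
    (bridge s).continuous)).smul (symm s ⌊x.1.1⌋ ⌊x.1.2⌋)).castTo
    ((symm_bridge s _ _ _).trans (congrArg (bridge s) (planeShear_reduce x)))

theorem framePath_congr {x y : PuncturedPlane} (h : x = y) (t : I) :
    PathHom.framePath planeBase x t = PathHom.framePath planeBase y t := by
  subst h
  rfl

theorem planeFrame_planeShear (a b : ℤ) (x : PuncturedPlane) :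
    planeFrame s (planeShear 0 a b x) =
      ((planeFrame s x).smul (symm s a b)).castTo (symm_bridge s a b x) := by
  have hs : symm s ⌊(planeShear 0 a b x).1.1⌋ ⌊(planeShear 0 a b x).1.2⌋ =
      symm s a b * symm s ⌊x.1.1⌋ ⌊x.1.2⌋ := by
    rw [(floor_planeShear a b x).1, (floor_planeShear a b x).2, symm_mul]
  refine Frame.ext_path ?_ fun t => ?_
  · change symm s _ _ * 1 = symm s a b * (symm s _ _ * 1)
    rw [mul_one, mul_one, hs]
  · change (symm s _ _).1 (bridge s _) = (symm s a b).1 ((symm s _ _).1 (bridge s _))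
    rw [hs, framePath_congr (reduce_planeShear a b x) t]
    rfl

/-- The transport of the punctured plane in the orbifold fundamental group. -/
def orbHom : PathHom PuncturedPlane (SymmetricGroup s) := framePathHom (bridge s) (planeFrame s)

theorem orbHom_val {x y : PuncturedPlane} (γ : Path x y) :
    (orbHom s).val γ =
      (planeFrame s x).val (planeFrame s y) (γ.map (bridge s).continuous) := rfl

/-- The frames were chosen equivariantly, by translating those of the unit square, so
`Frame.val_smul` applies. -/
theorem orbHom_isPeriodic : (orbHom s).IsPeriodic := by
  intro a b p q γ
  rw [orbHom_val, orbHom_val, planeFrame_planeShear, planeFrame_planeShear]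
  rw [Frame.val_castTo _ _ _ _ _ ((γ.map (bridge s).continuous).map (symm s a b).1.continuous)
    fun t => (symm_bridge s a b (γ t)).symm, Frame.val_smul]

theorem symm_bridge_eq (a b : ℤ) {x y : PuncturedPlane} (h : y = planeShear 0 a b x) :
    (symm s a b).1 (bridge s x) = bridge s y := by
  rw [h, symm_bridge]

/-- For a path from a point to its translate, the frame at the end may be taken as the translate of
any frame at the start, at the cost of a conjugation. -/
theorem orbHom_val_shift (a b : ℤ) {x y : PuncturedPlane} (h : y = planeShear 0 a b x)
    (γ : Path x y) (F : Frame (symmetryGroup s) (base s) (bridge s x)) :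
    ∃ k, (orbHom s).val γ = k * F.val ((F.smul (symm s a b)).castTo (symm_bridge_eq s a b h))
      (γ.map (bridge s).continuous) * k⁻¹ := by
  subst h
  refine ⟨F.val (planeFrame s x) (Path.refl _), ?_⟩
  have e : ((F.smul (symm s a b)).castTo (symm_bridge_eq s a b rfl)).val
      (((planeFrame s x).smul (symm s a b)).castTo (symm_bridge s a b x))
      (Path.refl (bridge s (planeShear 0 a b x))) = F.val (planeFrame s x) (Path.refl _) :=
    (Frame.val_castTo _ _ _ _ _ ((Path.refl (bridge s x)).map (symm s a b).1.continuous)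
      fun _ => (symm_bridge s a b x).symm).trans (Frame.val_smul _ _ _ _)
  rw [orbHom_val, Frame.val_change (planeFrame s x) F _
    ((F.smul (symm s a b)).castTo (symm_bridge_eq s a b rfl)), planeFrame_planeShear, e,
    ← Frame.val_symm F]
  rfl

/-- An even translation acts trivially, so the path projects to a loop and its value comes, up to
conjugation, from the ordinary fundamental group. -/
theorem orbHom_val_loop (a b : ℤ) {x y : PuncturedPlane} (h : y = planeShear 0 (2 * a) (2 * b) x)
    (γ : Path x y) (hxy : bridge s x = bridge s y) (δ : Path (base s) (bridge s x)) :
    ∃ k, (orbHom s).val γ = k * OrbifoldGroup.ofFundamentalGroup _ _ (FundamentalGroup.fromPath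
      (Path.Homotopic.Quotient.mk
        (δ.trans (((γ.map (bridge s).continuous).cast rfl hxy).trans δ.symm)))) * k⁻¹ := by
  obtain ⟨k, hk⟩ := orbHom_val_shift s _ _ h γ (Frame.ofPath _ δ)
  refine ⟨k, ?_⟩
  rw [hk]
  congr 2
  have e : ((Frame.ofPath (symmetryGroup s) δ).smul (symm s (2 * a) (2 * b))).castTo
      (symm_bridge_eq s _ _ h) = (Frame.ofPath (symmetryGroup s) δ).castTo hxy := by
    refine Frame.ext_path ?_ fun t => ?_
    · change symm s _ _ * 1 = 1
      rw [symm_two, mul_one]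
    · change (symm s _ _).1 _ = δ t
      rw [symm_two]
      rfl
  rw [e, ← Frame.val_ofPath]
  exact Frame.val_castTo (Frame.ofPath (symmetryGroup s) δ) (Frame.ofPath (symmetryGroup s) δ) rfl hxy
    _ _ fun _ => rfl

theorem linePath_end (a b : ℤ) (y : ℝ × ℝ) (h : ∀ c : ℝ, y + c • ((a : ℝ), (b : ℝ)) ∉ lattice) :
    (⟨y + (1 : ℝ) • ((a : ℝ), (b : ℝ)), h 1⟩ : PuncturedPlane) =
      planeShear 0 a b ⟨y + (0 : ℝ) • ((a : ℝ), (b : ℝ)), h 0⟩ := by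
  refine Subtype.ext ?_
  ext <;> simp [planeShear, shear]

/-- The second half of the doubled line is a translate of the first; this is the relation `α = β ^
2`. -/
theorem PathHom.IsPeriodic.val_linePath_two {G : Type*} [Group G] {c : PathHom PuncturedPlane G}
    (hc : c.IsPeriodic) {a b : ℤ} {v : ℝ × ℝ}
    (hv : v = ((a : ℝ), (b : ℝ))) (y : ℝ × ℝ) (h : ∀ t : ℝ, y + t • v ∉ lattice)
    (h' : ∀ t : ℝ, y + t • ((2 : ℝ) • v) ∉ lattice) :
    c.val (linePath y _ h') = c.val (linePath y _ h) ^ 2 := by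
  subst hv
  rw [sq]
  nth_rw 1 [← hc a b (linePath y _ h)]
  rw [← c.val_congr (((linePath y _ h).map (planeShear 0 a b).continuous).cast
    (linePath_end a b y h) rfl) ((linePath y _ h).map (planeShear 0 a b).continuous) fun _ => rfl,
    ← c.val_trans]
  refine c.val_congr _ _ fun t => Subtype.ext ?_
  rw [Path.trans_apply]
  split_ifs with ht
  · change y + (t : ℝ) • _ = y + (2 * (t : ℝ)) • ((a : ℝ), (b : ℝ))
    rw [smul_smul, mul_comm]
  · change y + (t : ℝ) • _ = shear 0 a b (y + (2 * (t : ℝ) - 1) • ((a : ℝ), (b : ℝ)))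
    ext <;> simp [shear] <;> ring

theorem linePath_slopeDir_end {a b : ℤ} (hab : slopeDir s = ((a : ℝ), (b : ℝ))) (y : ℝ × ℝ)
    (h : ∀ c : ℝ, y + c • slopeDir s ∉ lattice) :
    (⟨y + (1 : ℝ) • slopeDir s, h 1⟩ : PuncturedPlane) =
      planeShear 0 a b ⟨y + (0 : ℝ) • slopeDir s, h 0⟩ := by
  refine Subtype.ext ?_
  ext <;> simp [planeShear, shear, hab]

/-- The inverse appears because an element of the orbifold group carries a path from the translate
of the base point back to the base point, against the direction of the line. -/
theorem orbHom_linePath {a b : ℤ} (hab : slopeDir s = ((a : ℝ), (b : ℝ))) (y : ℝ × ℝ)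
    (h : ∀ c : ℝ, y + c • slopeDir s ∉ lattice)
    (δ : Path (base s) (bridge s ⟨y + (0 : ℝ) • slopeDir s, h 0⟩))
    (e : (symm s a b).1 (bridge s ⟨_, h 0⟩) = bridge s ⟨_, h 1⟩) :
    ∃ k, (orbHom s).val (linePath y (slopeDir s) h) =
      k * (⟨symm s a b, Path.Homotopic.Quotient.mk
        (((δ.map (symm s a b).1.continuous).cast rfl e.symm).trans
        ((((linePath y (slopeDir s) h).map (bridge s).continuous).symm).trans δ.symm))⟩ :
          SymmetricGroup s)⁻¹ * k⁻¹ := by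
  obtain ⟨k, hk⟩ := orbHom_val_shift s a b (linePath_slopeDir_end s hab y h)
    (linePath y (slopeDir s) h) (Frame.ofPath _ δ)
  refine ⟨k, ?_⟩
  rw [hk, ← inv_inv (Frame.val _ _ _), ← Frame.val_symm]
  congr 3

theorem exists_mem_betaClass (y : ℝ × ℝ) (h : ∀ c : ℝ, y + c • slopeDir s ∉ lattice) :
    ∃ k, ∃ g ∈ betaClass s, (orbHom s).val (linePath y (slopeDir s) h) = k * g⁻¹ * k⁻¹ := by
  obtain ⟨a, b, hab⟩ := slopeDir_integral s
  have e := symm_bridge_eq s a b (linePath_slopeDir_end s hab y h)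
  obtain ⟨k, hk⟩ := orbHom_linePath s hab y h (PathConnectedSpace.somePath _ _) e
  exact ⟨k, _, ⟨a, b, hab, isTranslation_translation s a b, y, h, _, e, rfl⟩, hk⟩

theorem exists_linePath_of_mem_betaClass {g : SymmetricGroup s} (hg : g ∈ betaClass s) :
    ∃ (y : ℝ × ℝ) (h : ∀ c : ℝ, y + c • slopeDir s ∉ lattice) (k : SymmetricGroup s),
      (orbHom s).val (linePath y (slopeDir s) h) = k * g⁻¹ * k⁻¹ := by
  obtain ⟨g, γ⟩ := g
  obtain ⟨a, b, hab, hT, y, h, δ, e, hγ⟩ := hg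
  obtain rfl : g = symm s a b := Subtype.ext hT.eq_translation
  obtain ⟨k, hk⟩ := orbHom_linePath s hab y h δ e
  refine ⟨y, h, k, ?_⟩
  rw [hk]
  simp only at hγ
  rw [hγ]

/-- The doubled vertical line is a loop that becomes constant on the upper level, so `β_∞ ^ 2 = α_∞`
is trivial before any relation is imposed. -/
theorem orbHom_lineTorsion_infty : (orbHom s).LineTorsion 2 (slopeDir OnePoint.infty) := by
  rw [slopeDir_infty]
  intro y h
  have e : ((0 : ℝ), (1 : ℝ)) = (((0 : ℤ) : ℝ), ((1 : ℤ) : ℝ)) := by simp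
  have hx : ∀ a : ℤ, y.1 ≠ a := fun a ha => by
    refine h (-y.2) ⟨a, 0, ?_⟩
    ext <;> simp [ha]
  have h' : ∀ t : ℝ, y + t • ((2 : ℝ) • ((0 : ℝ), (1 : ℝ))) ∉ lattice := fun t => by
    rw [smul_smul]
    exact h _
  have key : (orbHom s).val (linePath y ((2 : ℝ) • ((0 : ℝ), (1 : ℝ))) h') = 1 := by
    have hend : (⟨y + (1 : ℝ) • ((2 : ℝ) • ((0 : ℝ), (1 : ℝ))), h' 1⟩ : PuncturedPlane) =
        planeShear 0 (2 * 0) (2 * 1) ⟨y + (0 : ℝ) • ((2 : ℝ) • ((0 : ℝ), (1 : ℝ))), h' 0⟩ := by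
      refine Subtype.ext ?_
      ext <;> simp [planeShear, shear]
    have hb : bridge s ⟨y + (0 : ℝ) • ((2 : ℝ) • ((0 : ℝ), (1 : ℝ))), h' 0⟩ =
        bridge s ⟨y + (1 : ℝ) • ((2 : ℝ) • ((0 : ℝ), (1 : ℝ))), h' 1⟩ := by
      rw [hend, ← symm_bridge, symm_two]
      rfl
    obtain ⟨k, hk⟩ := orbHom_val_loop s 0 1 hend (linePath y _ h') hb (PathHom.framePath _ _)
    rw [hk, conj_eq_one_iff]
    have := val_vertical_loop s (PathHom.ofHom (base s) (MonoidHom.id _)) (linePath y _ h')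
      (by simpa using hx) (fun t => by simp [linePath]) 1 (by simp)
    have h2 : (PathHom.ofHom (base s) (MonoidHom.id _)).val
        (((linePath y _ h').map (bridge s).continuous).cast rfl hb) = 1 := by
      rw [← this]
      exact PathHom.val_congr _ _ _ fun _ => rfl
    exact (congrArg _ h2).trans (map_one _)
  rw [← (orbHom_isPeriodic s).val_linePath_two e y h h', key]

/-! ### Relations in the group of the quotient orbifold -/

/-- The transport of the punctured plane in the group of the quotient orbifold. -/
def quotHom (r : ℚ) (m : ℕ) : PathHom PuncturedPlane (QuotientOrbifoldGroup r m) :=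
  (orbHom r).mapHom (QuotientGroup.mk' _)

theorem quotHom_isPeriodic (r : ℚ) (m : ℕ) : (quotHom r m).IsPeriodic :=
  (orbHom_isPeriodic r).mapHom _

theorem quotHom_val (r : ℚ) (m : ℕ) {x y : PuncturedPlane} (γ : Path x y) :
    (quotHom r m).val γ = QuotientGroup.mk' _ ((orbHom r).val γ) := rfl

theorem quotHom_lineTorsion_infty (r : ℚ) (m : ℕ) :
    (quotHom r m).LineTorsion 2 (slopeDir OnePoint.infty) := fun y h => by
  rw [quotHom_val, ← map_pow, orbHom_lineTorsion_infty r y h, map_one]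

theorem quotHom_lineTorsion (r : ℚ) (m : ℕ) : (quotHom r m).LineTorsion m (slopeDir r) := by
  intro y h
  obtain ⟨k, g, hg, e⟩ := exists_mem_betaClass r y h
  have : (QuotientGroup.mk' (Subgroup.normalClosure
      {g | ∃ β ∈ betaClass (r : OnePoint ℚ), g = β ^ m})) g ^ m = 1 := by
    rw [← map_pow]
    exact (QuotientGroup.eq_one_iff _).2 (Subgroup.subset_normalClosure ⟨g, hg, rfl⟩)
  rw [quotHom_val, e, map_mul, map_mul, map_inv, map_inv, conj_pow, inv_pow, this]
  simp

theorem quotHom_lineTorsion_of_inOrbit (r : ℚ) (m : ℕ) {s : OnePoint ℚ} (hs : InOrbitOfInfty r m s) :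
    (quotHom r m).LineTorsion 2 (slopeDir s) :=
  PathHom.lineTorsion_of_inOrbit (quotHom_isPeriodic r m) r m (quotHom_lineTorsion_infty r m)
    (quotHom_lineTorsion r m) hs

end Heckoid

end

open scoped unitInterval

noncomputable section

namespace Heckoid

/-! ### Transport along sheared meridians -/

namespace PathHom

variable {G : Type*} [Group G]

/-- The straight-line homotopy maps a square into the punctured plane, and the two ways around the
square agree. -/
theorem val_square (c : PathHom PuncturedPlane G) {p q p' q' : PuncturedPlane} (γ : Path p q)
    (γ' : Path p' q') (h : ∀ t u : I, Path.segment (γ t).1 (γ' t).1 u ∉ lattice) :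
    c.val γ' * c.segVal p.1 p'.1 = c.segVal q.1 q'.1 * c.val γ := by
  have hK : Convex ℝ (Set.Icc (0 : ℝ) 1) := convex_Icc 0 1
  have : ContractibleSpace (Set.Icc (0 : ℝ) 1 ×ˢ Set.Icc (0 : ℝ) 1 : Set (ℝ × ℝ)) :=
    (hK.prod hK).contractibleSpace ⟨(0, 0), by simp⟩
  let F : C((Set.Icc (0 : ℝ) 1 ×ˢ Set.Icc (0 : ℝ) 1 : Set (ℝ × ℝ)), PuncturedPlane) :=
    ⟨fun x => ⟨Path.segment (γ ⟨x.1.1, x.2.1⟩).1 (γ' ⟨x.1.1, x.2.1⟩).1 ⟨x.1.2, x.2.2⟩, h _ _⟩, by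
      refine Continuous.subtype_mk ?_ _
      simp only [Path.segment_apply, AffineMap.lineMap_apply, vsub_eq_sub, vadd_eq_add]
      fun_prop⟩
  let d := c.pullback F
  let across (u : I) : Path (⟨(0, u), by simp [u.2.1, u.2.2]⟩ :
      (Set.Icc (0 : ℝ) 1 ×ˢ Set.Icc (0 : ℝ) 1 : Set (ℝ × ℝ))) ⟨(1, u), by simp [u.2.1, u.2.2]⟩ :=
    { toFun := fun t => ⟨(t, u), t.2, u.2⟩
      continuous_toFun := by fun_prop
      source' := by simp
      target' := by simp }
  let up (t : I) : Path (⟨(t, 0), by simp [t.2.1, t.2.2]⟩ :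
      (Set.Icc (0 : ℝ) 1 ×ˢ Set.Icc (0 : ℝ) 1 : Set (ℝ × ℝ))) ⟨(t, 1), by simp [t.2.1, t.2.2]⟩ :=
    { toFun := fun u => ⟨(t, u), t.2, u.2⟩
      continuous_toFun := by fun_prop
      source' := by simp
      target' := by simp }
  have h1 : d.val (across 0) = c.val γ := by
    rw [pullback_val]
    exact c.val_congr _ _ fun t => Subtype.ext
      (Path.segment (γ t).1 (γ' t).1).source
  have h2 : d.val (across 1) = c.val γ' := by
    rw [pullback_val]
    exact c.val_congr _ _ fun t => Subtype.ext
      (Path.segment (γ t).1 (γ' t).1).target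
  have h3 : ∀ t : I, d.val (up t) = c.segVal (γ t).1 (γ' t).1 := by
    intro t
    rw [segVal, dif_pos (h t), pullback_val]
    exact c.val_congr _ _ fun u => rfl
  have h4 := h3 0
  have h5 := h3 1
  rw [γ.source, γ'.source] at h4
  rw [γ.target, γ'.target] at h5
  rw [← h1, ← h2, ← h4, ← h5, val_eq_endVal, val_eq_endVal, val_eq_endVal, val_eq_endVal]
  exact (endVal_mul _ _ _ _).trans (endVal_mul _ _ _ _).symm

theorem segment_not_mem_of_fst_eq {x y : ℝ × ℝ} (h : x.1 = y.1)
    (h' : (∀ a : ℤ, x.1 ≠ a) ∨ (x = y ∧ x ∉ lattice)) (u : I) : Path.segment x y u ∉ lattice := by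
  rw [Path.segment_apply]
  rcases h' with h' | ⟨rfl, h'⟩
  · rintro ⟨a, b, hab⟩
    refine h' a ?_
    have := congrArg Prod.fst hab
    simp only [AffineMap.lineMap_apply, vsub_eq_sub, vadd_eq_add, Prod.fst_add, Prod.smul_fst,
      Prod.fst_sub, ← h, sub_self, smul_zero, zero_add] at this
    exact this
  · simpa using h'

variable {r : OnePoint ℚ} (c : PathHom (TunnelComplement r) G)

theorem val_rotate (a b : ℤ) {p q p' q' : PuncturedPlane} (γ : Path p q) (γ' : Path p' q')
    (h : ∀ t, (γ' t).1 = (2 * (a : ℝ) - (γ t).1.1, 2 * (b : ℝ) - (γ t).1.2)) :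
    (c.pullback (bridge r)).val γ' = (c.pullback (bridge r)).val γ :=
  c.val_congr _ _ fun t => bridge_rotate r _ _ a b (h t)

theorem segVal_rotate (a b : ℤ) (x y : ℝ × ℝ) :
    (c.pullback (bridge r)).segVal (2 * (a : ℝ) - x.1, 2 * (b : ℝ) - x.2)
      (2 * (a : ℝ) - y.1, 2 * (b : ℝ) - y.2) = (c.pullback (bridge r)).segVal x y := by
  have e : ∀ t : I, Path.segment (2 * (a : ℝ) - x.1, 2 * (b : ℝ) - x.2)
      (2 * (a : ℝ) - y.1, 2 * (b : ℝ) - y.2) t =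
      (2 * (a : ℝ) - (Path.segment x y t).1, 2 * (b : ℝ) - (Path.segment x y t).2) := fun t => by
    simp only [Path.segment_apply, AffineMap.lineMap_apply, vsub_eq_sub, vadd_eq_add]
    ext <;> simp <;> ring
  have hl : (∀ t : I, Path.segment (2 * (a : ℝ) - x.1, 2 * (b : ℝ) - x.2)
      (2 * (a : ℝ) - y.1, 2 * (b : ℝ) - y.2) t ∉ lattice) ↔
      ∀ t : I, Path.segment x y t ∉ lattice := by
    simp only [e, neg_mem_lattice_iff]
  rw [segVal, segVal]
  by_cases h : ∀ t : I, Path.segment x y t ∉ lattice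
  · rw [dif_pos h, dif_pos (hl.2 h)]
    exact val_rotate c a b _ _ e
  · rw [dif_neg h, dif_neg (mt hl.1 h)]

/-- The rotation by `π` about `(a, b)`, on the punctured plane. -/
def planeRotation (a b : ℤ) : C(PuncturedPlane, PuncturedPlane) where
  toFun x := ⟨_, fun h => x.2 ((neg_mem_lattice_iff x.1 a b).1 h)⟩
  continuous_toFun := by
    refine Continuous.subtype_mk ?_ _
    fun_prop

theorem ne_int_of_abs_lt {x : ℝ} (h0 : x ≠ 0) (h : |x| < 1) (a : ℤ) : x ≠ a := by
  rintro rfl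
  have h1 : |a| < 1 := by exact_mod_cast h
  exact h0 (by rw [Int.abs_lt_one_iff.1 h1, Int.cast_zero])

theorem abs_cos_half_lt (θ : ℝ) : |Real.cos θ / 2| < 1 := by
  rw [abs_div, abs_two]
  linarith [Real.abs_cos_le_one θ]

/-- The shear moves points vertically and fixes the top `(0, 1/2)` of the half circle; elsewhere the
abscissa is not an integer unless it is zero, so the straight homotopy misses the lattice. The
tracks of the endpoints are exchanged by the rotation about the origin, hence are the same
conjugating element. -/
theorem val_halfCircle_left :
    (c.pullback (bridge r)).val ((halfCircle 0 1 (by norm_num)).map (planeShear 1 0 0).continuous) =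
      (c.pullback (bridge r)).segVal (1 / 2, 0) (1 / 2, 1 / 2) *
        (c.pullback (bridge r)).val (halfCircle 0 1 (by norm_num)) *
        ((c.pullback (bridge r)).segVal (1 / 2, 0) (1 / 2, 1 / 2))⁻¹ := by
  rw [eq_mul_inv_iff_mul_eq]
  have h := (c.pullback (bridge r)).val_square (halfCircle 0 1 (by norm_num))
    ((halfCircle 0 1 (by norm_num)).map (planeShear 1 0 0).continuous) (fun t u => by
      refine segment_not_mem_of_fst_eq (y := shear 1 0 0 _) (by simp [shear]) ?_ u
      have hx : (halfCircle 0 1 (by norm_num) t).1.1 = Real.cos (Real.pi * t) / 2 := by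
        simp [halfCircle]
      by_cases h0 : Real.cos (Real.pi * t) / 2 = 0
      · rw [h0] at hx
        exact Or.inr ⟨by ext <;> simp [shear, hx], (halfCircle 0 1 _ t).2⟩
      · rw [hx]
        exact Or.inl (ne_int_of_abs_lt h0 (abs_cos_half_lt _)))
  have h' := segVal_rotate c 0 0 (1 / 2, 0) (1 / 2, 1 / 2)
  convert h using 2
  · congr 1 <;> ext <;> simp [planeShear, shear]
  · rw [← h']
    congr 1 <;> ext <;> norm_num [planeShear, shear]

/-- The sheared half circle crosses `x = 1` at `(1, 3/2)`, below the lattice point `(1, 2)`. It is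
thus deformed vertically to a half circle under that point, which is the original one rotated about
`(1, 1)` and reversed. This reversal is the source of the inverse. -/
theorem val_halfCircle_right :
    (c.pullback (bridge r)).val ((halfCircle 1 (-1) (by norm_num)).map (planeShear 1 0 0).continuous) =
      (c.pullback (bridge r)).segVal (1 / 2, 0) (1 / 2, 1 / 2) *
        ((c.pullback (bridge r)).val (halfCircle 1 (-1) (by norm_num)))⁻¹ *
        ((c.pullback (bridge r)).segVal (1 / 2, 0) (1 / 2, 1 / 2))⁻¹ := by
  rw [eq_mul_inv_iff_mul_eq]
  have ht : ∀ t : I, (halfCircle 1 (-1) (by norm_num) t).1 =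
      (1 - Real.cos (Real.pi * t) / 2, Real.sin (Real.pi * t) / 2) := by
    intro t
    ext <;> simp [halfCircle]
    ring
  set γ := (halfCircle 1 (-1) (by norm_num)).symm.map (planeRotation 1 1).continuous with hγ
  have hγt : ∀ t : I, (γ t).1 = (1 - Real.cos (Real.pi * t) / 2, 2 - Real.sin (Real.pi * t) / 2) := by
    intro t
    have e : Real.pi * (1 - (t : ℝ)) = Real.pi - Real.pi * t := by ring
    have e' : (γ t).1 = (2 * ((1 : ℤ) : ℝ) - (halfCircle 1 (-1) (by norm_num)
        (unitInterval.symm t)).1.1, 2 * ((1 : ℤ) : ℝ) - (halfCircle 1 (-1) (by norm_num)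
        (unitInterval.symm t)).1.2) := rfl
    rw [e', ht, unitInterval.coe_symm_eq, e, Real.cos_pi_sub, Real.sin_pi_sub]
    ext <;> simp
    ring
  have hval : (c.pullback (bridge r)).val γ =
      ((c.pullback (bridge r)).val (halfCircle 1 (-1) (by norm_num)))⁻¹ := by
    rw [← val_symm]
    exact val_rotate c 1 1 _ _ fun t => rfl
  have h := (c.pullback (bridge r)).val_square γ
    ((halfCircle 1 (-1) (by norm_num)).map (planeShear 1 0 0).continuous) (fun t u => by
      refine segment_not_mem_of_fst_eq (y := shear 1 0 0 _) (by simp [shear, hγt, ht]) ?_ u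
      by_cases h0 : Real.cos (Real.pi * t) / 2 = 0
      · have hs : Real.sin (Real.pi * t) = 1 := by
          have hc : Real.cos (Real.pi * t) = 0 := by linarith
          have := Real.sin_sq_add_cos_sq (Real.pi * t)
          have h1 : 0 ≤ Real.sin (Real.pi * t) := Real.sin_nonneg_of_nonneg_of_le_pi
            (mul_nonneg Real.pi_nonneg t.2.1) (mul_le_of_le_one_right Real.pi_nonneg t.2.2)
          rw [hc] at this
          nlinarith
        refine Or.inr ⟨?_, (γ t).2⟩
        rw [hγt]
        ext <;> simp [shear, ht, h0, hs]
        norm_num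
      · refine Or.inl fun a ha => ne_int_of_abs_lt h0 (abs_cos_half_lt _) (1 - a) ?_
        rw [hγt] at ha
        push_cast
        simp only at ha
        linarith)
  rw [hval] at h
  have h' := segVal_rotate c 1 1 (1 / 2, 0) (1 / 2, 1 / 2)
  have m1 : ((1 / 2 : ℝ), (2 : ℝ)) ∈ vStrip 0 := by constructor <;> norm_num
  have m2 : ((1 / 2 : ℝ), (0 : ℝ)) ∈ vStrip 0 := by constructor <;> norm_num
  have m3 : ((1 / 2 : ℝ), (1 / 2 : ℝ)) ∈ vStrip 0 := by constructor <;> norm_num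
  -- The track of the starting point begins at height `2` instead of `0`; the difference is a
  -- vertical loop, which is trivial in the tangle exterior.
  have hv : (c.pullback (bridge r)).segVal (1 / 2, 2) (1 / 2, 0) = 1 := by
    have hne : ∀ a : ℤ, (1 / 2 : ℝ) ≠ a := by
      intro a ha
      have : (2 * a : ℝ) = (1 : ℤ) := by push_cast; linarith
      have : 2 * a = 1 := by exact_mod_cast this
      omega
    have hs := segment_not_mem_of_fst_eq (x := (1 / 2, 2)) (y := (1 / 2, 0)) rfl (Or.inl hne)
    rw [segVal, dif_pos hs]
    refine val_vertical_loop r c (segPath _ _ hs) ?_ (fun t => ?_) (-1) ?_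
    · simpa using hne
    · simp [segPath, Path.segment_apply, AffineMap.lineMap_apply]
    · simp
  have hm := (c.pullback (bridge r)).segVal_mul (convexFree_vStrip 0) m1 m2 m3
  rw [hv, mul_one] at hm
  convert h using 2
  · rw [hm]
    congr 1 <;> ext <;> norm_num [planeShear, shear, planeRotation]
  · rw [← h']
    congr 1 <;> ext <;> norm_num [planeShear, shear, planeRotation]

end PathHom

end Heckoid

end

open scoped unitInterval

noncomputable section

namespace Heckoid

/-! ### Epimorphisms from link groups -/

/-- The relation `β_t ^ 2 = 1` kills the doubled line in the orbifold group. The doubled line comes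
from a loop of the complement, and `hker` transfers its triviality to `π`. -/
theorem val_line_eq_one {H : Type*} [Group H] {r : ℚ} {m : ℕ} {t : OnePoint ℚ}
    (ht : InOrbitOfInfty r m t) {π : FundamentalGroup (TunnelComplement (r : OnePoint ℚ)) (base r) →* H}
    (hker : ∀ g, toQuotientOrbifoldGroup r m g = 1 → π g = 1) (y : ℝ × ℝ)
    (h : ∀ c : ℝ, y + c • ((2 : ℝ) • slopeDir t) ∉ lattice) :
    (PathHom.ofHom (base r) π).val ((linePath y _ h).map (bridge r).continuous) = 1 := by
  obtain ⟨a, b, hab⟩ := slopeDir_integral t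
  have hend : (⟨y + (1 : ℝ) • ((2 : ℝ) • slopeDir t), h 1⟩ : PuncturedPlane) =
      planeShear 0 (2 * a) (2 * b) ⟨y + (0 : ℝ) • ((2 : ℝ) • slopeDir t), h 0⟩ := by
    refine Subtype.ext ?_
    ext <;> simp [planeShear, shear, hab]
  have hb : bridge r ⟨y + (0 : ℝ) • ((2 : ℝ) • slopeDir t), h 0⟩ =
      bridge r ⟨y + (1 : ℝ) • ((2 : ℝ) • slopeDir t), h 1⟩ := by
    rw [hend, ← symm_bridge, symm_two]
    rfl
  have h' : ∀ c : ℝ, y + c • slopeDir t ∉ lattice := fun c => by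
    have := h (c / 2)
    rwa [smul_smul, div_mul_cancel₀ _ two_ne_zero] at this
  have hl : (quotHom r m).val (linePath y _ h) = 1 := by
    rw [(quotHom_isPeriodic r m).val_linePath_two hab y h' h]
    exact quotHom_lineTorsion_of_inOrbit r m ht y h'
  obtain ⟨k, hk⟩ := orbHom_val_loop r a b hend (linePath y _ h) hb (PathHom.framePath _ _)
  rw [quotHom_val, hk, map_mul, map_mul, map_inv, conj_eq_one_iff] at hl
  rw [← hker _ hl]
  exact (PathHom.ofHom (base r) π).val_congr _
    (((linePath y _ h).map (bridge r).continuous).cast rfl hb) fun _ => rfl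

/-- The shear identifies the two tunnel complements and carries loops of slope `s` to loops of slope
`t`, which are trivial in `H`. Thus the pulled back transport extends over the tunnel of `K(s)`. -/
theorem exists_hom_linkGroup {H : Type*} [Group H] {r : ℚ} {m : ℕ} {s t : OnePoint ℚ} (e : ℤ)
    (hdir : slopeDir t = ((slopeDir s).1, (slopeDir s).2 + e * (slopeDir s).1))
    (ht : InOrbitOfInfty r m t) {π : FundamentalGroup (TunnelComplement (r : OnePoint ℚ)) (base r) →* H}
    (hπ : Function.Surjective π) (hker : ∀ g, toQuotientOrbifoldGroup r m g = 1 → π g = 1) :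
    ∃ f : LinkGroup s →* H, Function.Surjective f ∧
      f (toLinkGroup s (meridianA s)) = ((PathHom.ofHom (base r) π).pullback (bridge r)).val
        ((halfCircle 0 1 (by norm_num)).map (planeShear e 0 0).continuous) ∧
      f (toLinkGroup s (meridianB s)) = ((PathHom.ofHom (base r) π).pullback (bridge r)).val
        ((halfCircle 1 (-1) (by norm_num)).map (planeShear e 0 0).continuous) := by
  set c := PathHom.ofHom (base r) π with hc
  have hs : ∀ (x : ℝ × ℝ) (c : ℝ), shear e 0 0 (x + c • ((2 : ℝ) • slopeDir s)) =
      shear e 0 0 x + c • ((2 : ℝ) • slopeDir t) := fun x c => by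
    ext <;> simp [shear, hdir]
    ring
  obtain ⟨d, hd⟩ := exists_extension_linkComplement s (c.pullback (tunnelMap s r e 0 0)) (by
    intro y h
    have h' : ∀ c : ℝ, shear e 0 0 y + c • ((2 : ℝ) • slopeDir t) ∉ lattice := fun c => by
      rw [← hs, shear_mem_lattice_iff]
      exact h c
    rw [PathHom.pullback_val, ← val_line_eq_one ht hker _ h']
    refine c.val_congr _ _ fun u => (tunnelMap_bridge s r e 0 0 _).trans ?_
    exact congrArg (bridge r) (Subtype.ext (hs y u)))
  have hf : ∀ γ : Path (base s) (base s), d.toHom (fillTunnel s (base s)) (toLinkGroup s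
      (FundamentalGroup.fromPath (Path.Homotopic.Quotient.mk γ))) =
      c.val (γ.map (tunnelMap s r e 0 0).continuous) := fun γ =>
    (d.toHom_mk (γ.map (fillTunnel s).continuous)).trans (hd γ)
  refine ⟨d.toHom (fillTunnel s (base s)), fun x => ?_, ?_, ?_⟩
  -- The shear need not preserve base points. Loops are therefore conjugated by a path `ρ` before
  -- being carried back by the inverse shear.
  · let ρ : Path (base r) (tunnelMap s r e 0 0 (base s)) := PathHom.framePath _ _
    obtain ⟨g, hg⟩ := hπ ((c.val ρ)⁻¹ * x * c.val ρ)
    obtain ⟨γ, rfl⟩ : ∃ γ : Path (base (r : OnePoint ℚ)) (base r),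
        g = FundamentalGroup.fromPath (Path.Homotopic.Quotient.mk γ) := by
      induction g using Path.Homotopic.Quotient.ind with | mk γ =>
      exact ⟨γ, rfl⟩
    have hback : ∀ z, tunnelMap r s (-e) 0 0 (tunnelMap s r e 0 0 z) = z := fun z => by
      rw [tunnelMap_tunnelMap]
      simp [tunnelMap_zero]
    have hforth : ∀ z, tunnelMap s r e 0 0 (tunnelMap r s (-e) 0 0 z) = z := fun z => by
      rw [tunnelMap_tunnelMap]
      simp [tunnelMap_zero]
    refine ⟨toLinkGroup s (FundamentalGroup.fromPath (Path.Homotopic.Quotient.mk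
      (((ρ.symm.trans (γ.trans ρ)).map (tunnelMap r s (-e) 0 0).continuous).cast
        (hback _).symm (hback _).symm))), ?_⟩
    rw [hf, c.val_congr _ (ρ.symm.trans (γ.trans ρ)) fun u => hforth _, c.val_trans, c.val_trans,
      c.val_symm, PathHom.ofHom_val_loop, hg]
    group
  · refine (hf _).trans ?_
    exact c.val_congr _ _ fun u => tunnelMap_bridge s r e 0 0 _
  · refine (hf _).trans ?_
    exact c.val_congr _ _ fun u => tunnelMap_bridge s r e 0 0 _

theorem slopeDir_slopeSucc (s : OnePoint ℚ) :
    slopeDir (slopeSucc s) = ((slopeDir s).1, (slopeDir s).2 + (1 : ℤ) * (slopeDir s).1) := by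
  induction s using OnePoint.rec with
  | infty => simp [slopeSucc, slopeDir, fareyVec]
  | coe q =>
    have h1 : (q + 1).den = q.den := Rat.add_ofNat_den q 1
    have h2 : ((q + 1).num : ℚ) = q.num + q.den := by
      rw [num_eq_mul_den, num_eq_mul_den q, h1]
      ring
    have h3 : ((q + 1).num : ℝ) = q.num + q.den := by exact_mod_cast h2
    simp [slopeSucc, slopeDir, fareyVec, h1, h3]

theorem exists_epimorphism {H : Type*} [Group H] {r : ℚ} {m : ℕ} {s : OnePoint ℚ}
    (hs : InOrbitOfInfty r m s ∨ InOrbitOfInfty r m (slopeSucc s))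
    {π : FundamentalGroup (TunnelComplement (r : OnePoint ℚ)) (base r) →* H}
    (hπ : Function.Surjective π) (hker : ∀ g, toQuotientOrbifoldGroup r m g = 1 → π g = 1) :
    ∃ f : LinkGroup s →* H, Function.Surjective f ∧ SamePair (π (meridianA r)) (π (meridianB r))
      (f (toLinkGroup s (meridianA s))) (f (toLinkGroup s (meridianB s))) := by
  have hA : ((PathHom.ofHom (base r) π).pullback (bridge r)).val (halfCircle 0 1 (by norm_num)) =
      π (meridianA r) := by
    rw [PathHom.pullback_val, meridianA, ← PathHom.ofHom_val_loop]
    exact (PathHom.ofHom (base r) π).val_congr _ _ fun _ => rfl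
  have hB : ((PathHom.ofHom (base r) π).pullback (bridge r)).val (halfCircle 1 (-1) (by norm_num)) =
      π (meridianB r) := by
    rw [PathHom.pullback_val, meridianB, ← PathHom.ofHom_val_loop]
    exact (PathHom.ofHom (base r) π).val_congr _ _ fun _ => rfl
  rcases hs with hs | hs
  · obtain ⟨f, hf, hfA, hfB⟩ := exists_hom_linkGroup (s := s) 0 (by simp) hs hπ hker
    refine ⟨f, hf, 1, π (meridianA r), Set.mem_insert _ _, π (meridianB r), Set.mem_insert _ _,
      Or.inl ⟨?_, ?_⟩⟩
    · rw [one_mul, inv_one, mul_one, hfA, ← hA]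
      exact ((PathHom.ofHom (base r) π).pullback (bridge r)).val_congr _ _ fun _ => planeShear_zero _
    · rw [one_mul, inv_one, mul_one, hfB, ← hB]
      exact ((PathHom.ofHom (base r) π).pullback (bridge r)).val_congr _ _ fun _ => planeShear_zero _
  · obtain ⟨f, hf, hfA, hfB⟩ := exists_hom_linkGroup (s := s) 1 (slopeDir_slopeSucc s) hs hπ hker
    -- The same vertical segment conjugates both meridians, so the pairs `{a, b⁻¹}` match
    -- simultaneously.
    refine ⟨f, hf, ((PathHom.ofHom (base r) π).pullback (bridge r)).segVal (1 / 2, 0) (1 / 2, 1 / 2),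
      π (meridianA r), Set.mem_insert _ _, (π (meridianB r))⁻¹, Set.mem_insert_of_mem _ rfl,
      Or.inl ⟨?_, ?_⟩⟩
    · rw [hfA, PathHom.val_halfCircle_left, hA]
    · rw [hfB, PathHom.val_halfCircle_right, hB]

end Heckoid

end

open scoped unitInterval

noncomputable section

namespace Heckoid

/-! ### The even Heckoid groups inside the groups of the quotient orbifolds -/

theorem ofFundamentalGroup_injective {X : Type*} [TopologicalSpace X] (Γ : Subgroup (X ≃ₜ X))
    (x₀ : X) : Function.Injective (OrbifoldGroup.ofFundamentalGroup Γ x₀) := by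
  intro g g' h
  have h' := (OrbifoldGroup.mk.injEq _ _ _ _).mp h
  exact eq_of_heq h'.2

theorem homotopic_cancel {X : Type*} [TopologicalSpace X] {a b c : X} (p : Path a c)
    (q : Path a b) : (p.trans ((Path.refl c).trans (q.symm.trans p).symm)).Homotopic q := by
  rw [← Path.Homotopic.Quotient.eq]
  simp only [Path.Homotopic.Quotient.mk_trans, Path.Homotopic.Quotient.mk_symm,
    Path.trans_symm, Path.symm_symm, Path.Homotopic.Quotient.mk_refl,
    Path.Homotopic.Quotient.refl_trans]
  rw [← Path.Homotopic.Quotient.trans_assoc]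
  simp

variable (s : OnePoint ℚ)

/-- Translations permute the lines of slope `s`, so the class of `α_s` is stable under conjugation
by the whole orbifold group, not only by the fundamental group of the complement. -/
theorem exists_conj_alphaClass (x : SymmetricGroup s)
    {g : FundamentalGroup (TunnelComplement s) (base s)} (hg : g ∈ alphaClass s) :
    ∃ g' ∈ alphaClass s, x * OrbifoldGroup.ofFundamentalGroup _ _ g * x⁻¹ =
      OrbifoldGroup.ofFundamentalGroup _ _ g' := by
  obtain ⟨y, h, δ, rfl⟩ := hg
  obtain ⟨f, η⟩ := x
  obtain ⟨a, b, hf⟩ := f.2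
  obtain rfl : f = symm s a b := Subtype.ext hf.eq_translation
  induction η using Path.Homotopic.Quotient.ind with | mk η =>
  have hs : ∀ c : ℝ, y + ((a : ℝ), (b : ℝ)) + c • ((2 : ℝ) • slopeDir s) =
      shear 0 a b (y + c • ((2 : ℝ) • slopeDir s)) := fun c => by
    ext <;> simp [shear] <;> ring
  have h' : ∀ c : ℝ, y + ((a : ℝ), (b : ℝ)) + c • ((2 : ℝ) • slopeDir s) ∉ lattice := fun c => by
    rw [hs, shear_mem_lattice_iff]
    exact h c
  have e : (symm s a b).1 (bridge s ⟨_, h 0⟩) = bridge s ⟨_, h' 0⟩ :=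
    symm_bridge_eq s a b (Subtype.ext (hs 0))
  set δ' : Path (base s) (bridge s ⟨_, h' 0⟩) :=
    η.symm.trans ((δ.map (symm s a b).1.continuous).cast rfl e.symm) with hδ'
  refine ⟨_, ⟨_, h', δ', rfl⟩, ?_⟩
  rw [← Frame.val_ofPath, ← Frame.val_ofPath, Frame.val_change (Frame.ofPath _ δ')
    (((Frame.ofPath _ δ).smul (symm s a b)).castTo e) _
    (((Frame.ofPath _ δ).smul (symm s a b)).castTo e),
    Frame.val_castTo _ _ e e (slopeLoop s _ h') ((slopeLoop s y h).map (symm s a b).1.continuous)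
    (fun t => ((symm_bridge_eq s a b (Subtype.ext (hs t))).symm)), Frame.val_smul]
  have hk : (((Frame.ofPath _ δ).smul (symm s a b)).castTo e).val (Frame.ofPath _ δ')
      (Path.refl _) = ⟨symm s a b, Path.Homotopic.Quotient.mk η⟩ := by
    refine OrbifoldGroup.ext_mk ?_ ((η.map ((Frame.ofPath (symmetryGroup s) δ').elt⁻¹).1.continuous).cast
      rfl rfl) (fun t => rfl) (Path.Homotopic.pathCast ?_ _ _)
    · change 1⁻¹ * (symm s a b * 1) = symm s a b
      rw [inv_one, one_mul, mul_one]
    · exact (homotopic_cancel _ _).map ⟨_, ((Frame.ofPath (symmetryGroup s) δ').elt⁻¹).1.continuous⟩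
  rw [← hk, ← Frame.val_symm]
  rfl

theorem exists_conj_of_mem_betaClass {g : SymmetricGroup s} (hg : g ∈ betaClass s) :
    ∃ k, ∃ α ∈ alphaClass s, g ^ 2 = (k * OrbifoldGroup.ofFundamentalGroup _ _ α * k⁻¹)⁻¹ := by
  obtain ⟨y, h, k, hk⟩ := exists_linePath_of_mem_betaClass s hg
  obtain ⟨a, b, hab⟩ := slopeDir_integral s
  have h' : ∀ c : ℝ, y + c • ((2 : ℝ) • slopeDir s) ∉ lattice := fun c => by
    rw [smul_smul]
    exact h _
  have hend : (⟨y + (1 : ℝ) • ((2 : ℝ) • slopeDir s), h' 1⟩ : PuncturedPlane) =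
      planeShear 0 (2 * a) (2 * b) ⟨y + (0 : ℝ) • ((2 : ℝ) • slopeDir s), h' 0⟩ := by
    refine Subtype.ext ?_
    ext <;> simp [planeShear, shear, hab]
  have hb : bridge s ⟨y + (0 : ℝ) • ((2 : ℝ) • slopeDir s), h' 0⟩ =
      bridge s ⟨y + (1 : ℝ) • ((2 : ℝ) • slopeDir s), h' 1⟩ := by
    rw [hend, ← symm_bridge, symm_two]
    rfl
  obtain ⟨k', hk'⟩ := orbHom_val_loop s a b hend (linePath y _ h') hb (PathHom.framePath _ _)
  rw [(orbHom_isPeriodic s).val_linePath_two hab y h h', hk] at hk'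
  refine ⟨k⁻¹ * k', _, ⟨y, h', PathHom.framePath _ _, rfl⟩, ?_⟩
  rw [conj_pow] at hk'
  have e : g ^ 2 = (k⁻¹ * (k * g⁻¹ ^ 2 * k⁻¹) * k)⁻¹ := by
    rw [inv_pow]
    group
  rw [e, hk']
  have e2 : ∀ x : SymmetricGroup s, (k⁻¹ * (k' * x * k'⁻¹) * k)⁻¹ =
      (k⁻¹ * k' * x * (k⁻¹ * k')⁻¹)⁻¹ := fun x => by group
  exact e2 _

/-- Each relator `β ^ (2 * n)` is the inverse of a conjugate of some `α ^ n`. By the stability of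
the class of `α_r`, the image of the normal closure of the `α ^ n` is already normal in the orbifold
group, so it contains all these relators. Injectivity of the inclusion brings the relation back. -/
theorem toEven_eq_one (r : ℚ) (n : ℕ)
    (g : FundamentalGroup (TunnelComplement (r : OnePoint ℚ)) (base r))
    (hg : toQuotientOrbifoldGroup r (2 * n) g = 1) : toEven r n g = 1 := by
  set ι := OrbifoldGroup.ofFundamentalGroup (symmetryGroup (r : OnePoint ℚ)) (base r) with hι
  set N := Subgroup.normalClosure {g | ∃ α ∈ alphaClass (r : OnePoint ℚ), g = α ^ n} with hN
  have hconj : ∀ x, ∀ α ∈ alphaClass (r : OnePoint ℚ), x * ι (α ^ n) * x⁻¹ ∈ N.map ι := by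
    intro x α hα
    obtain ⟨α', hα', e⟩ := exists_conj_alphaClass r x hα
    refine ⟨α' ^ n, Subgroup.subset_normalClosure ⟨α', hα', rfl⟩, ?_⟩
    rw [map_pow, map_pow, ← conj_pow, e]
  have hnormal : (N.map ι).Normal := by
    refine ⟨?_⟩
    rintro _ ⟨a, ha, rfl⟩ x
    induction ha using Subgroup.closure_induction with
    | mem a ha =>
      obtain ⟨_, ⟨α, hα, rfl⟩, hc⟩ := Group.mem_conjugatesOfSet_iff.1 ha
      obtain ⟨c, rfl⟩ := isConj_iff.1 hc
      have := hconj (x * ι c) α hα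
      rw [map_mul, map_mul, map_inv]
      convert this using 1
      group
    | one =>
      rw [show ι (1 : FundamentalGroup _ _) = 1 from map_one ι, mul_one, mul_inv_cancel]
      exact one_mem _
    | mul a b _ _ iha ihb =>
      rw [map_mul, ← conj_mul]
      exact mul_mem iha ihb
    | inv a _ iha =>
      rw [map_inv, ← conj_inv]
      exact inv_mem iha
  have hle : Subgroup.normalClosure {g | ∃ β ∈ betaClass (r : OnePoint ℚ), g = β ^ (2 * n)} ≤
      N.map ι := by
    refine Subgroup.normalClosure_le_normal ?_
    rintro _ ⟨β, hβ, rfl⟩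
    obtain ⟨k, α, hα, e⟩ := exists_conj_of_mem_betaClass r hβ
    rw [pow_mul, e, inv_pow, conj_pow, ← map_pow]
    exact inv_mem (hconj k α hα)
  obtain ⟨g', hg', e⟩ := hle ((QuotientGroup.eq_one_iff _).1 hg)
  rw [← ofFundamentalGroup_injective _ _ e]
  exact (QuotientGroup.eq_one_iff _).2 hg'

end Heckoid

end

theorem mainTheorem5 (r : ℚ) (s : OnePoint ℚ) :
    (∀ n : ℕ, 2 ≤ n →
      (Heckoid.InOrbitOfInfty r (2 * n) s ∨ Heckoid.InOrbitOfInfty r (2 * n) (Heckoid.slopeSucc s)) →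
      ∃ f : Heckoid.LinkGroup s →* Heckoid.EvenHeckoidGroup r n,
        Function.Surjective f ∧
        Heckoid.SamePair
          (Heckoid.toEven r n (Heckoid.meridianA r)) (Heckoid.toEven r n (Heckoid.meridianB r))
          (f (Heckoid.toLinkGroup s (Heckoid.meridianA s)))
          (f (Heckoid.toLinkGroup s (Heckoid.meridianB s)))) ∧
    (∀ m : ℕ, 3 ≤ m → Odd m →
      (Heckoid.InOrbitOfInfty r m s ∨ Heckoid.InOrbitOfInfty r m (Heckoid.slopeSucc s)) →
      ∃ f : Heckoid.LinkGroup s →* Heckoid.OddHeckoidGroup r m,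
        Function.Surjective f ∧
        Heckoid.SamePair
          (Heckoid.toOdd r m (Heckoid.meridianA r)) (Heckoid.toOdd r m (Heckoid.meridianB r))
          (f (Heckoid.toLinkGroup s (Heckoid.meridianA s)))
          (f (Heckoid.toLinkGroup s (Heckoid.meridianB s)))) := by
  refine ⟨fun n _ hs => ?_, fun m _ _ hs => ?_⟩
  · exact Heckoid.exists_epimorphism hs (QuotientGroup.mk'_surjective _)
      (Heckoid.toEven_eq_one r n)
  -- The odd Heckoid group is the range of the natural homomorphism, so the kernel condition is
  -- immediate.
  · exact Heckoid.exists_epimorphism hs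
      (MonoidHom.rangeRestrict_surjective (Heckoid.toQuotientOrbifoldGroup r m))
      fun g hg => Subtype.ext hg
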